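/- Let $Q$ be a smooth manifold (finite-dimensional, Hausdorff, second countable) with a smooth, free and proper action of a Lie group $G$ with Lie algebra $\mathfrak g$; for $\eta\in\mathfrak g$ let $\eta_Q$ be its infinitesimal generator, and let $V_q=\{\eta_Q(q):\eta\in\mathfrak g\}=T_q(\mathrm{Orb}(q))$. Let $D\subseteq TQ$ be a $G$-invariant smooth (regular) distribution, and let $W\subseteq TQ$ be a $G$-invariant vertical complement of $D$: a $G$-invariant smooth distribution with $TQ=D\oplus W$ and $W\subseteq V$. Suppose that $W$ satisfies the vertical-symmetry condition: there is a Lie subalgebra $\mathfrak g_W\subseteq\mathfrak g$ such that $W_q=\{\eta_Q(q):\eta\in\mathfrak g_W\}$ for all $q\in Q$. Let $W^\circ\subset T^*Q$ be the annihilator of $W$, with inclusion $\iota_0:W^\circ\hookrightarrow T^*Q$, projection $\tau_0:W^\circ\to Q$, the $G$-action that is the restriction of the cotangent lift, the vertical distribution $\mathcal V_0\subset T(W^\circ)$ tangent to its orbits, and the orbit projection $\rho:W^\circ\to W^\circ/G$; a function $f$ on $W^\circ/G$ is smooth if and only if $f\circ\rho$ is smooth. Let $\Omega_Q=-d\Theta_Q$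 be the canonical 2-form on $T^*Q$ ($\Theta_Q$ being the Liouville 1-form), and put $$\Omega_{W^\circ}=\iota_0^*\Omega_Q,\qquad \mathcal C_0=\{v\in T(W^\circ): T\tau_0(v)\in D\},\qquad \mathcal W_0=(T\tau_0|_{\mathcal V_0})^{-1}(W)\subseteq\mathcal V_0 .$$ Then: 1. There is exactly one family of linear maps $\pi_0^\sharp:T^*_m(W^\circ)\to T_m(W^\circ)$, $m\in W^\circ$, such that, for all $\alpha\in T^*_m(W^\circ)$ and $X\in T_m(W^\circ)$, one has $\pi_0^\sharp(\alpha)=-X$ if and only if $X\in\mathcal C_0$ and $\mathbf i_X\Omega_{W^\circ}|_{\mathcal C_0}=\alpha|_{\mathcal C_0}$. It is given by a smooth $G$-invariant bivector field $\pi_0$ on $W^\circ$, $\pi_0(\alpha,\beta)=\beta(\pi_0^\sharp(\alpha))$. 2. There is exactly one almost Poisson bracket $\{\cdot,\cdot\}_{\Lambda_0}$ on $C^\infty(W^\circ/G)$ (bilinear, skew-symmetric, with the Leibniz rule) such that $$\{f,g\}_{\Lambda_0}\circ\rho=\pi_0(d(f\circ\rho),d(g\circ\rho))\qquad\text{for all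 } f,g\in C^\infty(W^\circ/G),$$ and this reduction $\Lambda_0$ of $\pi_0$ is a Poisson structure: it satisfies the Jacobi identity. 3. $\mathrm{Ker}\,\Omega_{W^\circ}=\mathcal W_0$. 4. The presymplectic form $\Omega_{W^\circ}$ reduces to exactly one bracket on $C^\infty(W^\circ/G)$, and this bracket is $\Lambda_0$. Explicitly: for every $f\in C^\infty(W^\circ/G)$ there is a smooth vector field $X$ on $W^\circ$ with $\mathbf i_X\Omega_{W^\circ}=d(f\circ\rho)$; and $\{\cdot,\cdot\}_{\Lambda_0}$ is the only almost Poisson bracket $\{\cdot,\cdot\}$ on $C^\infty(W^\circ/G)$ such that $\{f,g\}\circ\rho=-d(g\circ\rho)(X)$ for all $f,g\in C^\infty(W^\circ/G)$ and every such $X$. -/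

import Mathlib

open scoped Manifold ContDiff Topology

noncomputable section

/-! ### Almost Poisson brackets and Poisson brackets on an algebra of functions -/

/-- An almost Poisson bracket on a commutative `ℝ`-algebra `A` (of smooth functions): a bilinear
skew-symmetric bracket `A × A → A` with the Leibniz rule. -/
structure AlmostPoissonBracket (A : Type*) [CommRing A] [Algebra ℝ A] where
  bracket : A →ₗ[ℝ] A →ₗ[ℝ] A
  skew : ∀ f g : A, bracket f g = -bracket g f
  leibniz : ∀ f g h : A, bracket (f * g) h = f * bracket g h + bracket f h * g

/-- An almost Poisson bracket is Poisson if it satisfies the Jacobi identity. -/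
def AlmostPoissonBracket.IsPoisson {A : Type*} [CommRing A] [Algebra ℝ A]
    (L : AlmostPoissonBracket A) : Prop :=
  ∀ f g h : A, L.bracket f (L.bracket g h) + L.bracket g (L.bracket h f)
    + L.bracket h (L.bracket f g) = 0

/-! ### Calculus on an embedded submanifold `S` of a manifold `M` -/

section Submanifold

variable {E : Type*} [NormedAddCommGroup E] [NormedSpace ℝ E] {H : Type*} [TopologicalSpace H]
  (I : ModelWithCorners ℝ E H) {M : Type*} [TopologicalSpace M] [ChartedSpace H M]

/-- `F : M → ℝ` is a smooth extension of `f : S → ℝ` near `m ∈ S`: `F` is smooth on `M` and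
agrees with `f` on a neighbourhood of `m` in `S`. -/
def IsExtensionNear {S : Set M} (f : S → ℝ) (m : S) (F : M → ℝ) : Prop :=
  ContMDiff I 𝓘(ℝ, ℝ) ∞ F ∧ ∀ᶠ s : S in 𝓝 m, F s = f s

/-- The algebra `C^∞(S)` of smooth functions on an embedded submanifold `S ⊆ M`: the functions
that extend, locally around every point of `S`, to smooth functions on `M`. -/
def smoothFunctions (S : Set M) : Subalgebra ℝ (S → ℝ) where
  carrier := {f | ∀ m : S, ∃ F : M → ℝ, IsExtensionNear I f m F}
  mul_mem' := by
    intro f g hf hg m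
    obtain ⟨F, hF, hF'⟩ := hf m
    obtain ⟨K, hK, hK'⟩ := hg m
    refine ⟨fun x => F x * K x, hF.mul hK, ?_⟩
    filter_upwards [hF', hK'] with s h1 h2
    simp [h1, h2]
  add_mem' := by
    intro f g hf hg m
    obtain ⟨F, hF, hF'⟩ := hf m
    obtain ⟨K, hK, hK'⟩ := hg m
    refine ⟨fun x => F x + K x, hF.add hK, ?_⟩
    filter_upwards [hF', hK'] with s h1 h2
    simp [h1, h2]
  algebraMap_mem' := by
    intro c m
    exact ⟨fun _ => c, contMDiff_const, Filter.Eventually.of_forall fun s => rfl⟩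

/-- The tangent space `T_m S` of an embedded submanifold `S ⊆ M`: the tangent vectors of `M` at
`m` that annihilate every smooth function on `M` vanishing on a neighbourhood of `m` in `S`. -/
def submanifoldTangent (S : Set M) (m : S) : Submodule ℝ (TangentSpace I (m : M)) where
  carrier := {v | ∀ F : M → ℝ, IsExtensionNear I (fun _ : S => (0 : ℝ)) m F →
    mvfderiv I F (m : M) v = 0}
  add_mem' := by
    intro v w hv hw F hF
    rw [map_add, hv F hF, hw F hF, add_zero]
  zero_mem' := by
    intro F _
    exact map_zero _
  smul_mem' := by
    intro c v hv F hF
    rw [map_smul, hv F hF, smul_zero]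

/-- The restriction to `T_m S` of the differential at `m` of a function `F` on `M`. -/
def restrictDifferential {S : Set M} (F : M → ℝ) (m : S) :
    Module.Dual ℝ (submanifoldTangent I S m) :=
  (mvfderiv I F (m : M)).toLinearMap ∘ₗ (submanifoldTangent I S m).subtype

open Classical in
/-- The differential `df_m : T_m S → ℝ` of a smooth function `f` on `S`: the restriction to
`T_m S` of the differential of any smooth extension of `f` near `m`
(see `submanifoldDifferential_eq` for the independence of the extension). -/
def submanifoldDifferential {S : Set M} (f : S → ℝ) (m : S) :
    Module.Dual ℝ (submanifoldTangent I S m) :=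
  if h : ∃ F : M → ℝ, IsExtensionNear I f m F then restrictDifferential I h.choose m else 0

theorem submanifoldDifferential_eq {S : Set M} (f : S → ℝ) (m : S) (F : M → ℝ)
    (hF : IsExtensionNear I f m F) :
    submanifoldDifferential I f m = restrictDifferential I F m := by
  have h : ∃ F : M → ℝ, IsExtensionNear I f m F := ⟨F, hF⟩
  rw [submanifoldDifferential, dif_pos h]
  ext v
  obtain ⟨h1, h2⟩ := h.choose_spec
  obtain ⟨h3, h4⟩ := hF
  have key := v.2 (h.choose - F) ⟨h1.sub h3, by
    filter_upwards [h2, h4] with s hs hs'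
    simp [hs, hs']⟩
  rw [mvfderiv_sub (h1.mdifferentiable (by simp) _) (h3.mdifferentiable (by simp) _)] at key
  exact sub_eq_zero.mp key

/-- A (not necessarily continuous) vector field on `S`. -/
abbrev SubmanifoldField (S : Set M) : Type _ := (m : S) → submanifoldTangent I S m

/-- A vector field `X` on `S` is smooth if it maps `C^∞(S)` to `C^∞(S)`. -/
def IsSmoothField {S : Set M} (X : SubmanifoldField I S) : Prop :=
  ∀ f ∈ smoothFunctions I S, (fun m => submanifoldDifferential I f m (X m)) ∈ smoothFunctions I S

/-- A family of linear maps `π_m^♯ : T_m^*S → T_m S`, `m ∈ S`. -/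
abbrev SharpMap (S : Set M) : Type _ :=
  (m : S) → Module.Dual ℝ (submanifoldTangent I S m) →ₗ[ℝ] submanifoldTangent I S m

/-- `π^♯` comes from a smooth bivector field `π(α, β) = β(π^♯ α)` on `S`. -/
def IsBivectorField {S : Set M} (sharp : SharpMap I S) : Prop :=
  (∀ (m : S) (α β : Module.Dual ℝ (submanifoldTangent I S m)), β (sharp m α) = -α (sharp m β)) ∧
  ∀ f ∈ smoothFunctions I S, ∀ g ∈ smoothFunctions I S,
    (fun m => submanifoldDifferential I g m (sharp m (submanifoldDifferential I f m)))
      ∈ smoothFunctions I S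

/-- `π^♯` is the map determined by a distribution `F ⊆ TS` and (the restriction to `F` of) a
2-form `Ω`: for `X ∈ F`, `i_X Ω |_F = α |_F` if and only if `π^♯(α) = -X`. In particular every
`α |_F` is `i_X Ω |_F` for exactly one `X ∈ F`, that is, `Ω |_F` is nondegenerate. -/
def IsDefinedBy {S : Set M} (F : (m : S) → Submodule ℝ (submanifoldTangent I S m))
    (Ω : (x : M) → TangentSpace I x → TangentSpace I x → ℝ) (sharp : SharpMap I S) : Prop :=
  ∀ (m : S) (α : Module.Dual ℝ (submanifoldTangent I S m)) (X : submanifoldTangent I S m),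
    (X ∈ F m ∧ ∀ Y ∈ F m, Ω m X Y = α Y) ↔ sharp m α = -X

/-- The expression of a 1-form `θ` on `M` in the preferred chart at `x`, a 1-form on (an open
subset of) the model space `E`: the pull-back of `θ` by the inverse of the chart. -/
def formInChart (θ : (x : M) → TangentSpace I x →L[ℝ] ℝ) (x : M) (y : E) : E →L[ℝ] ℝ :=
  (θ ((extChartAt I x).symm y)).comp (mfderiv 𝓘(ℝ, E) I (extChartAt I x).symm y)

/-- The value at `x` of the exterior derivative `dθ` of a 1-form `θ` on a manifold without
boundary, computed in the preferred chart at `x`. -/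
def exteriorDerivative (θ : (x : M) → TangentSpace I x →L[ℝ] ℝ) (x : M)
    (u v : TangentSpace I x) : ℝ :=
  extDeriv
    (fun y : E => ContinuousAlternatingMap.ofSubsingleton ℝ E ℝ (0 : Fin 1) (formInChart I θ x y))
    (extChartAt I x x)
    ![mfderiv I 𝓘(ℝ, E) (extChartAt I x) x u, mfderiv I 𝓘(ℝ, E) (extChartAt I x) x v]

end Submanifold

/-! ### Distributions on `Q`, group actions -/

section Distribution

variable {E : Type*} [NormedAddCommGroup E] [NormedSpace ℝ E]
  {Q : Type*} [TopologicalSpace Q] [ChartedSpace E Q] [IsManifold 𝓘(ℝ, E) ∞ Q]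

/-- `D ⊆ TQ` is a regular smooth distribution, i.e. a smooth vector subbundle: around every point
there is a frame of `D` consisting of smooth vector fields. -/
def IsSmoothDistribution (D : (q : Q) → Submodule ℝ (TangentSpace 𝓘(ℝ, E) q)) : Prop :=
  ∀ q₀ : Q, ∃ U ∈ 𝓝 q₀, ∃ (k : ℕ) (X : Fin k → (q : Q) → TangentSpace 𝓘(ℝ, E) q),
    (∀ i, ContMDiffOn 𝓘(ℝ, E) (𝓘(ℝ, E).prod 𝓘(ℝ, E)) ∞
      (fun q => (⟨q, X i q⟩ : TangentBundle 𝓘(ℝ, E) Q)) U) ∧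
    ∀ q ∈ U, LinearIndependent ℝ (fun i => X i q) ∧
      Submodule.span ℝ (Set.range fun i => X i q) = D q

/-- `D ⊆ TQ` is invariant: `T_q g (D_q) = D_{g q}`. -/
def IsInvariantDistribution (G : Type*) [Group G] [MulAction G Q]
    (D : (q : Q) → Submodule ℝ (TangentSpace 𝓘(ℝ, E) q)) : Prop :=
  ∀ (g : G) (q : Q),
    (D q).map (mfderiv 𝓘(ℝ, E) 𝓘(ℝ, E) (fun x : Q => g • x) q).toLinearMap = D (g • q)

variable {EG : Type*} [NormedAddCommGroup EG] [NormedSpace ℝ EG]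
  {G : Type*} [TopologicalSpace G] [ChartedSpace EG G] [Group G]

instance instLieGroupMinSmoothness [LieGroup 𝓘(ℝ, EG) ∞ G] :
    LieGroup 𝓘(ℝ, EG) (minSmoothness ℝ 3) G := by
  rw [minSmoothness_of_isRCLikeNormedField]
  infer_instance

/-- The infinitesimal generator `ξ_Q(q) = d/dt|_{t=0} exp(tξ) q`, as a linear map in `ξ ∈ 𝔤`: it
is the derivative at `1` of the orbit map `g ↦ g q`. (The derivative takes its values in
`T_{1 q} Q`, and `1 q = q`.) -/
def infinitesimalGenerator (EG : Type*) [NormedAddCommGroup EG] [NormedSpace ℝ EG]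
    (G : Type*) [TopologicalSpace G] [ChartedSpace EG G] [Group G] [MulAction G Q] (q : Q) :
    GroupLieAlgebra 𝓘(ℝ, EG) G →ₗ[ℝ] TangentSpace 𝓘(ℝ, E) q :=
  (mfderiv 𝓘(ℝ, EG) 𝓘(ℝ, E) (fun g : G => g • q) 1).toLinearMap

/-- The vertical space `V_q = T_q(Orb(q))` of the action on `Q`. -/
def verticalSpace (EG : Type*) [NormedAddCommGroup EG] [NormedSpace ℝ EG]
    (G : Type*) [TopologicalSpace G] [ChartedSpace EG G] [Group G] [MulAction G Q] (q : Q) :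
    Submodule ℝ (TangentSpace 𝓘(ℝ, E) q) :=
  LinearMap.range (infinitesimalGenerator (E := E) EG G q)

end Distribution

/-! ### The cotangent bundle -/

section Cotangent

/-- The cotangent bundle `T^*Q`, a smooth vector bundle over `Q` and a smooth manifold. -/
abbrev CotangentBundle (E : Type*) [NormedAddCommGroup E] [NormedSpace ℝ E]
    (Q : Type*) [TopologicalSpace Q] [ChartedSpace E Q] [IsManifold 𝓘(ℝ, E) ∞ Q] : Type _ :=
  Bundle.TotalSpace (E →L[ℝ] ℝ) (fun q : Q => TangentSpace 𝓘(ℝ, E) q →L[ℝ] ℝ)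

/-- The model with corners of `T^*Q` (it has no boundary). -/
abbrev cotangentModel (E : Type*) [NormedAddCommGroup E] [NormedSpace ℝ E] :
    ModelWithCorners ℝ (E × (E →L[ℝ] ℝ)) (ModelProd E (E →L[ℝ] ℝ)) :=
  𝓘(ℝ, E).prod 𝓘(ℝ, E →L[ℝ] ℝ)

variable {E : Type*} [NormedAddCommGroup E] [NormedSpace ℝ E]
  {Q : Type*} [TopologicalSpace Q] [ChartedSpace E Q] [IsManifold 𝓘(ℝ, E) ∞ Q]

/-- The tangent map `T_m τ_Q` of the canonical projection `τ_Q : T^*Q → Q`. -/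
def tangentProj (m : CotangentBundle E Q) :
    TangentSpace (cotangentModel E) m →L[ℝ] TangentSpace 𝓘(ℝ, E) m.proj :=
  mfderiv (cotangentModel E) 𝓘(ℝ, E) (fun x : CotangentBundle E Q => x.proj) m

/-- The Liouville 1-form `Θ_Q` on `T^*Q`: `Θ_Q(m)(v) = m(T_m τ_Q (v))`. -/
def liouvilleForm (m : CotangentBundle E Q) : TangentSpace (cotangentModel E) m →L[ℝ] ℝ :=
  m.snd.comp (tangentProj m)

/-- The canonical symplectic form `Ω_Q = -dΘ_Q` on `T^*Q`. -/
def canonicalForm (m : CotangentBundle E Q) (u v : TangentSpace (cotangentModel E) m) : ℝ :=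
  -exteriorDerivative (cotangentModel E) liouvilleForm m u v

/-- The annihilator `W° ⊆ T^*Q` of a distribution `W ⊆ TQ`. -/
def annihilator (W : (q : Q) → Submodule ℝ (TangentSpace 𝓘(ℝ, E) q)) :
    Set (CotangentBundle E Q) :=
  {m | ∀ v ∈ W m.proj, m.snd v = 0}

/-- The cotangent lift of the action: `g (q, p) = (g q, p ∘ (T_q g)⁻¹)`. -/
def cotangentLift {G : Type*} [Group G] [MulAction G Q] (g : G) (m : CotangentBundle E Q) :
    CotangentBundle E Q :=
  ⟨g • m.proj, m.snd.comp (mfderiv 𝓘(ℝ, E) 𝓘(ℝ, E) (fun x : Q => g • x) m.proj).inverse⟩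

set_option linter.unusedSectionVars false in
theorem cotangentBundle_mk_congr {q q' : Q} (h : q = q') (p p' : E →L[ℝ] ℝ) (hp : p = p') :
    (⟨q, p⟩ : CotangentBundle E Q) = ⟨q', p'⟩ := by
  subst h
  subst hp
  rfl

set_option linter.unusedSectionVars false in
theorem mfderiv_eq_id_of_eq {f : Q → Q} (hf : f = id) (q : Q) :
    (mfderiv 𝓘(ℝ, E) 𝓘(ℝ, E) f q : E →L[ℝ] E) = ContinuousLinearMap.id ℝ E := by
  subst hf
  exact mfderiv_id

set_option linter.unusedSectionVars false in
theorem mfderiv_eq_comp_of_eq {f g h : Q → Q} (hf : f = g ∘ h) (q : Q)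
    (hg : MDifferentiableAt 𝓘(ℝ, E) 𝓘(ℝ, E) g (h q)) (hh : MDifferentiableAt 𝓘(ℝ, E) 𝓘(ℝ, E) h q) :
    (mfderiv 𝓘(ℝ, E) 𝓘(ℝ, E) f q : E →L[ℝ] E) =
      (mfderiv 𝓘(ℝ, E) 𝓘(ℝ, E) g (h q) : E →L[ℝ] E).comp
        (mfderiv 𝓘(ℝ, E) 𝓘(ℝ, E) h q : E →L[ℝ] E) := by
  subst hf
  exact mfderiv_comp q hg hh

theorem cotangentLift_one {G : Type*} [Group G] [MulAction G Q] (m : CotangentBundle E Q) :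
    cotangentLift (1 : G) m = m := by
  obtain ⟨q, p⟩ := m
  refine cotangentBundle_mk_congr (E := E) (one_smul G q) _ p ?_
  have h := mfderiv_eq_id_of_eq (E := E) (f := fun x : Q => (1 : G) • x)
    (funext fun x => one_smul G x) q
  have key : ∀ (A : E →L[ℝ] E) (r : E →L[ℝ] ℝ), A = ContinuousLinearMap.id ℝ E →
      r.comp A.inverse = r := fun A r hA => by
    rw [hA, ContinuousLinearMap.inverse_id, ContinuousLinearMap.comp_id]
  exact key _ p h

theorem cotangentLift_mul (EG : Type*) [NormedAddCommGroup EG] [NormedSpace ℝ EG]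
    {G : Type*} [TopologicalSpace G] [ChartedSpace EG G] [Group G] [MulAction G Q]
    [ContMDiffSMul 𝓘(ℝ, EG) 𝓘(ℝ, E) ∞ G Q] (g h : G) (m : CotangentBundle E Q) :
    cotangentLift (g * h) m = cotangentLift g (cotangentLift h m) := by
  obtain ⟨q, p⟩ := m
  have hd : ∀ (k : G) (x : Q), MDifferentiableAt 𝓘(ℝ, E) 𝓘(ℝ, E) (fun y : Q => k • y) x :=
    fun k x => (ContMDiffSMul.contMDiff_const_smul (I := 𝓘(ℝ, EG)) (n := ∞) k).mdifferentiable
      (by simp) x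
  have hcomp : ∀ (k l : G) (x : Q), (mfderiv 𝓘(ℝ, E) 𝓘(ℝ, E) (fun y : Q => (k * l) • y) x :
      E →L[ℝ] E) = (mfderiv 𝓘(ℝ, E) 𝓘(ℝ, E) (fun y : Q => k • y) (l • x) : E →L[ℝ] E).comp
        (mfderiv 𝓘(ℝ, E) 𝓘(ℝ, E) (fun y : Q => l • y) x : E →L[ℝ] E) := fun k l x =>
    mfderiv_eq_comp_of_eq (funext fun y => mul_smul k l y) x (hd k _) (hd l x)
  have hone : ∀ (k l : G), k * l = 1 → ∀ x : Q,
      (mfderiv 𝓘(ℝ, E) 𝓘(ℝ, E) (fun y : Q => k • y) (l • x) : E →L[ℝ] E).comp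
        (mfderiv 𝓘(ℝ, E) 𝓘(ℝ, E) (fun y : Q => l • y) x : E →L[ℝ] E) =
      ContinuousLinearMap.id ℝ E := fun k l hkl x => by
    rw [← hcomp k l x]
    exact mfderiv_eq_id_of_eq (funext fun y => by rw [hkl, one_smul, id]) x
  have hinv : ∀ (k : G) (x : Q), ContinuousLinearMap.IsInvertible
      (mfderiv 𝓘(ℝ, E) 𝓘(ℝ, E) (fun y : Q => k • y) x : E →L[ℝ] E) := fun k x => by
    have h1 := hone k⁻¹ k (inv_mul_cancel k) x
    have h2 := hone k k⁻¹ (mul_inv_cancel k) (k • x)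
    rw [inv_smul_smul] at h2
    exact ⟨ContinuousLinearEquiv.equivOfInverse' _ _ h2 h1, rfl⟩
  refine cotangentBundle_mk_congr (E := E) (mul_smul g h q) _ _ ?_
  have key : ∀ (A B C : E →L[ℝ] E) (r : E →L[ℝ] ℝ), A = B.comp C → B.IsInvertible →
      r.comp A.inverse = (r.comp C.inverse).comp B.inverse := fun A B C r hA hB => by
    rw [hA, hB.inverse_comp_of_left, ContinuousLinearMap.comp_assoc]
  exact key _ _ _ p (hcomp g h q) (hinv g (h • q))

/-- The action of `G` on `T^*Q` by cotangent lifts. -/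
abbrev cotangentAction (EG : Type*) [NormedAddCommGroup EG] [NormedSpace ℝ EG]
    (G : Type*) [TopologicalSpace G] [ChartedSpace EG G] [Group G]
    (E : Type*) [NormedAddCommGroup E] [NormedSpace ℝ E]
    (Q : Type*) [TopologicalSpace Q] [ChartedSpace E Q] [IsManifold 𝓘(ℝ, E) ∞ Q]
    [MulAction G Q] [ContMDiffSMul 𝓘(ℝ, EG) 𝓘(ℝ, E) ∞ G Q] :
    MulAction G (CotangentBundle E Q) where
  smul := cotangentLift
  one_smul := cotangentLift_one
  mul_smul := cotangentLift_mul EG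

/-- The relation "in the same `G`-orbit" on `W°`. -/
def orbitSetoid (EG : Type*) [NormedAddCommGroup EG] [NormedSpace ℝ EG]
    (G : Type*) [TopologicalSpace G] [ChartedSpace EG G] [Group G] [MulAction G Q]
    [ContMDiffSMul 𝓘(ℝ, EG) 𝓘(ℝ, E) ∞ G Q]
    (W : (q : Q) → Submodule ℝ (TangentSpace 𝓘(ℝ, E) q)) : Setoid (annihilator W) :=
  letI := cotangentAction EG G E Q
  (MulAction.orbitRel G (CotangentBundle E Q)).comap Subtype.val

/-- The orbit space `W°/G`. -/
abbrev ReducedSpace (EG : Type*) [NormedAddCommGroup EG] [NormedSpace ℝ EG]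
    (G : Type*) [TopologicalSpace G] [ChartedSpace EG G] [Group G] [MulAction G Q]
    [ContMDiffSMul 𝓘(ℝ, EG) 𝓘(ℝ, E) ∞ G Q]
    (W : (q : Q) → Submodule ℝ (TangentSpace 𝓘(ℝ, E) q)) : Type _ :=
  Quotient (orbitSetoid EG G W)

/-- The orbit projection `ρ : W° → W°/G`. -/
def orbitProj (EG : Type*) [NormedAddCommGroup EG] [NormedSpace ℝ EG]
    (G : Type*) [TopologicalSpace G] [ChartedSpace EG G] [Group G] [MulAction G Q]
    [ContMDiffSMul 𝓘(ℝ, EG) 𝓘(ℝ, E) ∞ G Q]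
    (W : (q : Q) → Submodule ℝ (TangentSpace 𝓘(ℝ, E) q)) (m : annihilator W) :
    ReducedSpace EG G W :=
  Quotient.mk (orbitSetoid EG G W) m

/-- The algebra `C^∞(W°/G)` for the quotient smooth structure: a function `f` on `W°/G` is smooth
if and only if `f ∘ ρ` is smooth on `W°`. -/
def reducedFunctions (EG : Type*) [NormedAddCommGroup EG] [NormedSpace ℝ EG]
    (G : Type*) [TopologicalSpace G] [ChartedSpace EG G] [Group G] [MulAction G Q]
    [ContMDiffSMul 𝓘(ℝ, EG) 𝓘(ℝ, E) ∞ G Q]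
    (W : (q : Q) → Submodule ℝ (TangentSpace 𝓘(ℝ, E) q)) :
    Subalgebra ℝ (ReducedSpace EG G W → ℝ) where
  carrier := {f | (fun m => f (orbitProj EG G W m)) ∈
    smoothFunctions (cotangentModel E) (annihilator W)}
  mul_mem' := fun hf hg => (smoothFunctions (cotangentModel E) (annihilator W)).mul_mem hf hg
  add_mem' := fun hf hg => (smoothFunctions (cotangentModel E) (annihilator W)).add_mem hf hg
  algebraMap_mem' := fun c =>
    (smoothFunctions (cotangentModel E) (annihilator W)).algebraMap_mem c

/-- The pull-back `ρ^* f = f ∘ ρ` of a smooth function on `W°/G`. -/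
def pullback {EG : Type*} [NormedAddCommGroup EG] [NormedSpace ℝ EG]
    {G : Type*} [TopologicalSpace G] [ChartedSpace EG G] [Group G] [MulAction G Q]
    [ContMDiffSMul 𝓘(ℝ, EG) 𝓘(ℝ, E) ∞ G Q]
    {W : (q : Q) → Submodule ℝ (TangentSpace 𝓘(ℝ, E) q)} (f : reducedFunctions EG G W) :
    annihilator W → ℝ :=
  fun m => (f : ReducedSpace EG G W → ℝ) (orbitProj EG G W m)

variable (W D : (q : Q) → Submodule ℝ (TangentSpace 𝓘(ℝ, E) q))

/-- The distribution `C₀ = {v ∈ T(W°) : Tτ₀(v) ∈ D}` on `W°`. -/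
def distributionC₀ (m : annihilator W) :
    Submodule ℝ (submanifoldTangent (cotangentModel E) (annihilator W) m) :=
  ((D m.1.proj).comap (tangentProj m.1).toLinearMap).comap
    (submanifoldTangent (cotangentModel E) (annihilator W) m).subtype

/-- The vertical space at `m` of the lifted action: the tangent space at `m` to the `G`-orbit
of `m`, i.e. the range of the derivative at `1` of the orbit map `g ↦ g m`. -/
def verticalSpaceCotangent (EG : Type*) [NormedAddCommGroup EG] [NormedSpace ℝ EG]
    (G : Type*) [TopologicalSpace G] [ChartedSpace EG G] [Group G] [MulAction G Q]
    (m : CotangentBundle E Q) : Submodule ℝ (TangentSpace (cotangentModel E) m) :=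
  LinearMap.range (show GroupLieAlgebra 𝓘(ℝ, EG) G →ₗ[ℝ] TangentSpace (cotangentModel E) m from
    (mfderiv 𝓘(ℝ, EG) (cotangentModel E) (fun g : G => cotangentLift g m) 1).toLinearMap)

/-- The distribution `W₀ = (Tτ₀|_{V₀})⁻¹(W) = {v ∈ V₀ : Tτ₀(v) ∈ W}` on `W°`. -/
def distributionW₀ (EG : Type*) [NormedAddCommGroup EG] [NormedSpace ℝ EG]
    (G : Type*) [TopologicalSpace G] [ChartedSpace EG G] [Group G] [MulAction G Q]
    (m : annihilator W) : Submodule ℝ (TangentSpace (cotangentModel E) m.1) :=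
  verticalSpaceCotangent EG G m.1 ⊓ (W m.1.proj).comap (tangentProj m.1).toLinearMap

/-- The kernel at `m` of the presymplectic form `Ω_{W°} = ι₀^* Ω_Q`, as a set of tangent vectors
of `T^*Q`. -/
def kernelForm (m : annihilator W) : Set (TangentSpace (cotangentModel E) m.1) :=
  {v | v ∈ submanifoldTangent (cotangentModel E) (annihilator W) m ∧
    ∀ u ∈ submanifoldTangent (cotangentModel E) (annihilator W) m, canonicalForm m.1 v u = 0}

variable {W}

/-- `π^♯` is `G`-invariant: `{F ∘ g, K ∘ g} = {F, K} ∘ g` on `W°` for all `g ∈ G` and all smooth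
functions `F`, `K` on `T^*Q`, restricted to `W°`. -/
def IsInvariantBivector (G : Type*) [Group G] [MulAction G Q]
    (sharp : SharpMap (cotangentModel E) (annihilator W)) : Prop :=
  ∀ (g : G) (m m' : annihilator W), (m' : CotangentBundle E Q) = cotangentLift g m.1 →
    ∀ F K : CotangentBundle E Q → ℝ, ContMDiff (cotangentModel E) 𝓘(ℝ, ℝ) ∞ F →
      ContMDiff (cotangentModel E) 𝓘(ℝ, ℝ) ∞ K →
      restrictDifferential (cotangentModel E) (fun x => K (cotangentLift g x)) m
          (sharp m (restrictDifferential (cotangentModel E) (fun x => F (cotangentLift g x)) m)) =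
        restrictDifferential (cotangentModel E) K m'
          (sharp m' (restrictDifferential (cotangentModel E) F m'))

variable {EG : Type*} [NormedAddCommGroup EG] [NormedSpace ℝ EG]
  {G : Type*} [TopologicalSpace G] [ChartedSpace EG G] [Group G] [MulAction G Q]
  [ContMDiffSMul 𝓘(ℝ, EG) 𝓘(ℝ, E) ∞ G Q]

/-- `L` is the reduction to `W°/G` of the bivector field `π(α, β) = β(π^♯ α)` on `W°`:
`{f, g}_L ∘ ρ = π(d(f ∘ ρ), d(g ∘ ρ))`. -/
def IsReduction (sharp : SharpMap (cotangentModel E) (annihilator W))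
    (L : AlmostPoissonBracket (reducedFunctions EG G W)) : Prop :=
  ∀ (f g : reducedFunctions EG G W) (m : annihilator W),
    pullback (L.bracket f g) m =
      submanifoldDifferential (cotangentModel E) (pullback g) m
        (sharp m (submanifoldDifferential (cotangentModel E) (pullback f) m))

/-- `X` is a smooth vector field on `W°` with `i_X Ω_{W°} = df`. -/
def IsHamiltonianField (f : annihilator W → ℝ)
    (X : SubmanifoldField (cotangentModel E) (annihilator W)) : Prop :=
  IsSmoothField (cotangentModel E) X ∧
  ∀ (m : annihilator W) (u : submanifoldTangent (cotangentModel E) (annihilator W) m),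
    canonicalForm m.1 (X m).1 u.1 = submanifoldDifferential (cotangentModel E) f m u

/-- `L` is obtained by reduction to `W°/G` of the presymplectic form `Ω_{W°}`:
`{f, g}_L ∘ ρ = -d(g ∘ ρ)(X)` for any smooth vector field `X` on `W°` such that
`i_X Ω_{W°} = d(f ∘ ρ)`, and such vector fields `X` exist. -/
def IsPresymplecticReduction (L : AlmostPoissonBracket (reducedFunctions EG G W)) : Prop :=
  ∀ f : reducedFunctions EG G W,
    (∃ X, IsHamiltonianField (pullback f) X) ∧
    ∀ X, IsHamiltonianField (pullback f) X →
      ∀ (g : reducedFunctions EG G W) (m : annihilator W),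
        pullback (L.bracket f g) m =
          -submanifoldDifferential (cotangentModel E) (pullback g) m (X m)

end Cotangent

end

/-! Choose a basis ξ_i of 𝔤_W. The action is free, so η ↦ η_Q(q) is injective at every q
(`infinitesimalGenerator_injective`) and the generators of the ξ_i are a global frame of W. Let β_i
be the dual coframe that vanishes on D, b_i its pull-back to T^*Q, and J_i(m) = m((ξ_i)_Q) the
momentum functions. Then W° is the common zero set of the J_i. The lifted action preserves the
Liouville form, so the Hamiltonian vector field of J_i is the lifted generator of ξ_i
(`canonicalForm_cotangentGenerator`). As W is invariant, lifted orbits stay in W°; hence on W° every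
dJ_i kills every such generator, that is, W° is coisotropic.

At a point of W° the covectors dJ_i and b_i are therefore canonically conjugate
(`IsVerticalFrame.isConjugateFrame`), and the pointwise claims become symplectic linear algebra.
T(W°) = {dJ = 0} splits as C₀ = {dJ = b = 0}, which is symplectic, plus the span of the lifted
generators of the ξ_i, which is the kernel of Ω_{W°} and equals W₀. Nondegeneracy on C₀ gives
existence and uniqueness of π₀. An explicit formula for π₀ in terms of canonical pairings of smooth
1-forms gives smoothness, and uniqueness gives invariance.

The differential of f ∘ ρ kills the orbit directions, in particular that kernel. For such functions
the correction terms in the formula for π₀ vanish, so the reduced bracket is the canonical bracket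
of arbitrary extensions to T^*Q (`IsVerticalFrame.upstairsBracket_eq_cotangentBracket`), and the
Jacobi identity is inherited from T^*Q. For the same reason X = -π₀^♯ d(f ∘ ρ) solves i_X Ω_{W°} =
d(f ∘ ρ) on all of T(W°), not only on C₀. Two solutions differ by a kernel vector, which d(g ∘ ρ)
does not see, so the presymplectic reduction is the same bracket.

The fibrewise retraction p ↦ p - ∑ J_i(p) β_i of T^*Q onto W° supplies global smooth extensions and
identifies the tangent spaces of W°. -/

set_option linter.unusedSectionVars false

noncomputable section

/-! ### The canonical forms on `E × E*` -/

section Model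

variable {E : Type*} [NormedAddCommGroup E] [NormedSpace ℝ E]
  {F : Type*} [NormedAddCommGroup F] [NormedSpace ℝ F]

theorem differentiableAt_ofSubsingleton {θ : E → E →L[ℝ] ℝ} {x : E}
    (hθ : DifferentiableAt ℝ θ x) :
    DifferentiableAt ℝ
      (fun y => ContinuousAlternatingMap.ofSubsingleton ℝ E ℝ (0 : Fin 1) (θ y)) x :=
  ((ContinuousAlternatingMap.ofSubsingletonLIE (𝕜 := ℝ) (E := E) (F := ℝ)
    (0 : Fin 1)).toContinuousLinearEquiv.differentiableAt (x := θ x)).comp x hθ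

/-- The exterior derivative of a 1-form on a normed space, as an antisymmetrized derivative. -/
theorem extDeriv_ofSubsingleton_apply {θ : E → E →L[ℝ] ℝ} {x : E} (hθ : DifferentiableAt ℝ θ x)
    (u v : E) :
    extDeriv (fun y => ContinuousAlternatingMap.ofSubsingleton ℝ E ℝ (0 : Fin 1) (θ y)) x ![u, v] =
      fderiv ℝ θ x u v - fderiv ℝ θ x v u := by
  rw [extDeriv_apply (differentiableAt_ofSubsingleton hθ)]
  have h2 : ∀ w : E, (fderiv ℝ (fun y => θ y w) x) = (fderiv ℝ θ x).flip w := fun w => by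
    rw [fderiv_clm_apply hθ (differentiableAt_const w)]
    simp
  simp [Fin.sum_univ_two, Fin.removeNth, h2, sub_eq_add_neg]

/-- The Liouville form on `E × E*`. -/
def liouvilleModel (E : Type*) [NormedAddCommGroup E] [NormedSpace ℝ E] :
    (E × (E →L[ℝ] ℝ)) →L[ℝ] (E × (E →L[ℝ] ℝ)) →L[ℝ] ℝ :=
  ((ContinuousLinearMap.compL ℝ (E × (E →L[ℝ] ℝ)) E ℝ).flip
    (ContinuousLinearMap.fst ℝ E (E →L[ℝ] ℝ))).comp (ContinuousLinearMap.snd ℝ E (E →L[ℝ] ℝ))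

@[simp] theorem liouvilleModel_apply (z u : E × (E →L[ℝ] ℝ)) :
    liouvilleModel E z u = z.2 u.1 := rfl

/-- The canonical symplectic form on `E × E*`. -/
def symplecticModel (E : Type*) [NormedAddCommGroup E] [NormedSpace ℝ E] :
    (E × (E →L[ℝ] ℝ)) →L[ℝ] (E × (E →L[ℝ] ℝ)) →L[ℝ] ℝ :=
  (liouvilleModel E).flip - liouvilleModel E

@[simp] theorem symplecticModel_apply (u v : E × (E →L[ℝ] ℝ)) :
    symplecticModel E u v = v.2 u.1 - u.2 v.1 := rfl

theorem extDeriv_liouvilleModel (z u v : E × (E →L[ℝ] ℝ)) :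
    extDeriv (fun y => ContinuousAlternatingMap.ofSubsingleton ℝ _ ℝ (0 : Fin 1)
      (liouvilleModel E y)) z ![u, v] = - symplecticModel E u v := by
  rw [extDeriv_ofSubsingleton_apply (liouvilleModel E).differentiableAt, ContinuousLinearMap.fderiv]
  simp

/-- A map preserving the Liouville form preserves the symplectic form. -/
theorem symplecticModel_fderiv {Φ : E × (E →L[ℝ] ℝ) → E × (E →L[ℝ] ℝ)} {z : E × (E →L[ℝ] ℝ)}
    (hΦ : ContDiffAt ℝ 2 Φ z)
    (h : ∀ᶠ y in 𝓝 z, ∀ v, (Φ y).2 (fderiv ℝ Φ y v).1 = y.2 v.1) (u v : E × (E →L[ℝ] ℝ)) :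
    symplecticModel E (fderiv ℝ Φ z u) (fderiv ℝ Φ z v) = symplecticModel E u v := by
  -- The hypothesis says that the pull-back of the Liouville form by Φ is the Liouville form near z;
  -- exterior differentiation commutes with pull-back.
  have h1 := extDeriv_pullback (r := 2)
    (differentiableAt_ofSubsingleton (liouvilleModel E).differentiableAt) hΦ (by simp)
  have h2 : (fun x => (ContinuousAlternatingMap.ofSubsingleton ℝ _ ℝ (0 : Fin 1)
      (liouvilleModel E (Φ x))).compContinuousLinearMap (fderiv ℝ Φ x)) =ᶠ[𝓝 z]
      fun x => ContinuousAlternatingMap.ofSubsingleton ℝ _ ℝ (0 : Fin 1) (liouvilleModel E x) := by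
    filter_upwards [h] with y hy
    ext w
    simp [hy]
  have h3 := congrArg (fun A => A ![u, v]) (h1.symm.trans h2.extDeriv_eq)
  simp only [extDeriv_liouvilleModel, ContinuousAlternatingMap.compContinuousLinearMap_apply] at h3
  have h4 : (fderiv ℝ Φ z : _ → _) ∘ ![u, v] = ![fderiv ℝ Φ z u, fderiv ℝ Φ z v] := by
    ext i <;> fin_cases i <;> rfl
  rw [h4, extDeriv_liouvilleModel] at h3
  exact neg_injective h3

/-- If a family of maps `A (s, ·)` preserves the Liouville form, then its infinitesimal generator
is the Hamiltonian vector field of its contraction with the Liouville form. -/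
theorem symplecticModel_generator {A : F × (E × (E →L[ℝ] ℝ)) → E × (E →L[ℝ] ℝ)} {s₀ : F}
    {z : E × (E →L[ℝ] ℝ)} (hA : ContDiffAt ℝ 2 A (s₀, z)) (hA0 : A (s₀, z) = z)
    (hA0' : ∀ᶠ y in 𝓝 z, A (s₀, y) = y)
    (h : ∀ᶠ s in 𝓝 s₀, ∀ v, (A (s, z)).2 (fderiv ℝ A (s, z) (0, v)).1 = z.2 v.1)
    (ξ : F) (v : E × (E →L[ℝ] ℝ)) :
    symplecticModel E (fderiv ℝ A (s₀, z) (ξ, 0)) v =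
      fderiv ℝ (fun y => y.2 (fderiv ℝ A (s₀, y) (ξ, 0)).1) z v := by
  have hA1 : DifferentiableAt ℝ A (s₀, z) := hA.differentiableAt (by simp)
  have hdA : DifferentiableAt ℝ (fderiv ℝ A) (s₀, z) :=
    (hA.fderiv_right (m := 1) (by norm_num)).differentiableAt (by simp)
  have hsymm : IsSymmSndFDerivAt ℝ A (s₀, z) := hA.isSymmSndFDerivAt (by simp)
  set B := fderiv ℝ (fderiv ℝ A) (s₀, z) with hB
  -- A (s₀, ·) is the identity near z, so its partial derivative there is the identity.
  have hid : ∀ w, fderiv ℝ A (s₀, z) (0, w) = w := fun w => by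
    have h1 : HasFDerivAt (fun y => A (s₀, y)) ((fderiv ℝ A (s₀, z)).comp
        (ContinuousLinearMap.inr ℝ F (E × (E →L[ℝ] ℝ)))) z :=
      hA1.hasFDerivAt.comp z (hasFDerivAt_prodMk_right s₀ z)
    have h2 : HasFDerivAt (fun y => A (s₀, y)) (ContinuousLinearMap.id ℝ _) z :=
      (hasFDerivAt_id z).congr_of_eventuallyEq hA0'
    exact congrArg (fun L => L w) (h1.unique h2)
  -- differentiate the invariance of the form in the direction `ξ`
  have hfam : HasFDerivAt (fun s => (A (s, z)).2 (fderiv ℝ A (s, z) (0, v)).1)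
      (0 : F →L[ℝ] ℝ) s₀ := by
    refine (hasFDerivAt_const (z.2 v.1) s₀).congr_of_eventuallyEq ?_
    filter_upwards [h] with s hs using hs v
  have hl : HasFDerivAt (fun s : F => ((s, z) : F × (E × (E →L[ℝ] ℝ))))
      (ContinuousLinearMap.inl ℝ F (E × (E →L[ℝ] ℝ))) s₀ := hasFDerivAt_prodMk_left s₀ z
  have hr : HasFDerivAt (fun y => ((s₀, y) : F × (E × (E →L[ℝ] ℝ))))
      (ContinuousLinearMap.inr ℝ F (E × (E →L[ℝ] ℝ))) z := hasFDerivAt_prodMk_right s₀ z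
  -- This is Cartan's formula L_X θ = 0 in coordinates. With X = ∂_ξ A, the constancy in s gives X.2
  -- v.1 + z.2 (B (ξ,0) (0,v)).1 = 0, while the derivative of θ(X) along v is v.2 X.1 + z.2 (B (0,v)
  -- (ξ,0)).1. The symmetry of B lets the second-order terms be eliminated.
  have h1 := ((hA1.hasFDerivAt.comp s₀ hl).snd).clm_apply
    (HasFDerivAt.fst ((HasFDerivAt.comp (g := fderiv ℝ A) s₀ hdA.hasFDerivAt hl).clm_apply
      (hasFDerivAt_const ((0 : F), v) s₀)))
  have h2 := congrArg (fun L => L ξ) (h1.unique hfam)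
  have h3 := (hasFDerivAt_snd (𝕜 := ℝ) (p := z)).clm_apply
    (HasFDerivAt.fst ((HasFDerivAt.comp (g := fderiv ℝ A) z hdA.hasFDerivAt hr).clm_apply
      (hasFDerivAt_const (ξ, (0 : E × (E →L[ℝ] ℝ))) z)))
  have h4 := congrArg (fun L => L v) h3.fderiv
  have h5 := hsymm (ξ, 0) (0, v)
  simp only [Function.comp_def] at h2 h4
  rw [h4]
  simp [hid, hA0, ← hB] at h2 ⊢
  rw [← h5]
  linarith

end Model

/-! ### The Poisson bracket on `E × E*` -/

section Bracket

variable {E : Type*} [NormedAddCommGroup E] [NormedSpace ℝ E]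

/-- Vectors (w, 0) detect the covector part, and vectors (0, f) detect the vector part by
Hahn–Banach. In finite dimension injectivity suffices to invert the form. -/
theorem symplecticModel_injective : Function.Injective (symplecticModel E) := by
  rw [injective_iff_map_eq_zero]
  intro u hu
  have h : ∀ v, symplecticModel E u v = 0 := fun v => by rw [hu]; rfl
  have h2 : u.2 = 0 := by
    ext w
    simpa using h (w, 0)
  have h1 : u.1 = 0 := by
    by_contra hne
    obtain ⟨f, hf⟩ := SeparatingDual.exists_ne_zero (R := ℝ) hne
    exact hf (by simpa using h (0, f))
  exact Prod.ext h1 h2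

variable [FiniteDimensional ℝ E]

theorem finrank_continuousDual (V : Type*) [NormedAddCommGroup V] [NormedSpace ℝ V]
    [FiniteDimensional ℝ V] : Module.finrank ℝ (V →L[ℝ] ℝ) = Module.finrank ℝ V :=
  (LinearMap.toContinuousLinearMap (𝕜 := ℝ) (E := V) (F' := ℝ)).finrank_eq.symm.trans
    Subspace.dual_finrank_eq

theorem continuous_of_dual {X Y : Type*} [NormedAddCommGroup X] [NormedSpace ℝ X]
    [FiniteDimensional ℝ X] [NormedAddCommGroup Y] [NormedSpace ℝ Y] (f : (X →L[ℝ] ℝ) →ₗ[ℝ] Y) :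
    Continuous f :=
  LinearMap.continuous_of_finiteDimensional f

/-- The identification of vectors and covectors given by the symplectic form of `E × E*`. -/
def flatModel (E : Type*) [NormedAddCommGroup E] [NormedSpace ℝ E] [FiniteDimensional ℝ E] :
    (E × (E →L[ℝ] ℝ)) ≃ₗ[ℝ] ((E × (E →L[ℝ] ℝ)) →L[ℝ] ℝ) :=
  LinearEquiv.ofInjectiveOfFinrankEq (symplecticModel E).toLinearMap
    symplecticModel_injective (finrank_continuousDual _).symm

/-- The vector corresponding to a covector under the symplectic form of `E × E*`. -/
def sharpModel (E : Type*) [NormedAddCommGroup E] [NormedSpace ℝ E] [FiniteDimensional ℝ E] :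
    ((E × (E →L[ℝ] ℝ)) →L[ℝ] ℝ) →L[ℝ] (E × (E →L[ℝ] ℝ)) :=
  ⟨(flatModel E).symm.toLinearMap, continuous_of_dual _⟩

@[simp] theorem symplecticModel_sharpModel (α : (E × (E →L[ℝ] ℝ)) →L[ℝ] ℝ) :
    symplecticModel E (sharpModel E α) = α :=
  (flatModel E).apply_symm_apply α

theorem apply_sharpModel_skew (α β : (E × (E →L[ℝ] ℝ)) →L[ℝ] ℝ) :
    β (sharpModel E α) = - α (sharpModel E β) := by
  have h : symplecticModel E (sharpModel E β) (sharpModel E α) =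
      - symplecticModel E (sharpModel E α) (sharpModel E β) := by
    simp only [symplecticModel_apply]
    ring
  rwa [symplecticModel_sharpModel, symplecticModel_sharpModel] at h

/-- The canonical Poisson bracket of functions on `E × E*`. -/
def modelBracket (F K : E × (E →L[ℝ] ℝ) → ℝ) (z : E × (E →L[ℝ] ℝ)) : ℝ :=
  - fderiv ℝ K z (sharpModel E (fderiv ℝ F z))

/-- The sharp map has constant coefficients, so only the two Hessians appear; skewness moves it off
the derivative of dF. This is the shape in which the Jacobi terms cancel. -/
theorem fderiv_modelBracket {F K : E × (E →L[ℝ] ℝ) → ℝ} {z : E × (E →L[ℝ] ℝ)}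
    (hF : ContDiffAt ℝ 2 F z) (hK : ContDiffAt ℝ 2 K z) (w : E × (E →L[ℝ] ℝ)) :
    fderiv ℝ (modelBracket F K) z w =
      fderiv ℝ (fderiv ℝ F) z w (sharpModel E (fderiv ℝ K z)) -
        fderiv ℝ (fderiv ℝ K) z w (sharpModel E (fderiv ℝ F z)) := by
  have hdF : DifferentiableAt ℝ (fderiv ℝ F) z :=
    (hF.fderiv_right (m := 1) (by norm_num)).differentiableAt (by simp)
  have hdK : DifferentiableAt ℝ (fderiv ℝ K) z :=
    (hK.fderiv_right (m := 1) (by norm_num)).differentiableAt (by simp)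
  have h := (hdK.hasFDerivAt.clm_apply
    (HasFDerivAt.comp (f := fderiv ℝ F) z (sharpModel E).hasFDerivAt hdF.hasFDerivAt)).neg
  have h1 := congrArg (fun L => L w) h.fderiv
  simp only [Function.comp_def] at h1
  have h2 : fderiv ℝ (modelBracket F K) z w =
    fderiv ℝ (-fun y => fderiv ℝ K y (sharpModel E (fderiv ℝ F y))) z w := rfl
  rw [h2, h1]
  simp only [_root_.neg_apply, _root_.add_apply,
    ContinuousLinearMap.comp_apply, ContinuousLinearMap.flip_apply]
  rw [apply_sharpModel_skew (fderiv ℝ (fderiv ℝ F) z w)]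
  ring

/-- The cyclic sum has six Hessian terms. Each Hessian occurs twice, with opposite signs and its two
arguments exchanged, so symmetry of second derivatives finishes. -/
theorem modelBracket_jacobi {F K L : E × (E →L[ℝ] ℝ) → ℝ} {z : E × (E →L[ℝ] ℝ)}
    (hF : ContDiffAt ℝ 2 F z) (hK : ContDiffAt ℝ 2 K z) (hL : ContDiffAt ℝ 2 L z) :
    modelBracket F (modelBracket K L) z + modelBracket K (modelBracket L F) z +
      modelBracket L (modelBracket F K) z = 0 := by
  have h1 := fderiv_modelBracket hK hL (sharpModel E (fderiv ℝ F z))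
  have h2 := fderiv_modelBracket hL hF (sharpModel E (fderiv ℝ K z))
  have h3 := fderiv_modelBracket hF hK (sharpModel E (fderiv ℝ L z))
  have sF : IsSymmSndFDerivAt ℝ F z := hF.isSymmSndFDerivAt (by simp)
  have sK : IsSymmSndFDerivAt ℝ K z := hK.isSymmSndFDerivAt (by simp)
  have sL : IsSymmSndFDerivAt ℝ L z := hL.isSymmSndFDerivAt (by simp)
  have e1 := sF (sharpModel E (fderiv ℝ K z)) (sharpModel E (fderiv ℝ L z))
  have e2 := sK (sharpModel E (fderiv ℝ F z)) (sharpModel E (fderiv ℝ L z))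
  have e3 := sL (sharpModel E (fderiv ℝ F z)) (sharpModel E (fderiv ℝ K z))
  change - fderiv ℝ (modelBracket K L) z _ + - fderiv ℝ (modelBracket L F) z _ +
    - fderiv ℝ (modelBracket F K) z _ = 0
  rw [h1, h2, h3]
  linarith

end Bracket

/-! ### Calculus in charts on a manifold without boundary -/

section Charts

theorem isManifold_one_of_infty {E : Type*} [NormedAddCommGroup E] [NormedSpace ℝ E] {H : Type*}
    [TopologicalSpace H] {I : ModelWithCorners ℝ E H} {M : Type*} [TopologicalSpace M]
    [ChartedSpace H M] [IsManifold I ∞ M] : IsManifold I 1 M :=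
  IsManifold.of_le (n := ∞) (by simp)

variable {E : Type*} [NormedAddCommGroup E] [NormedSpace ℝ E] {H : Type*} [TopologicalSpace H]
  (I : ModelWithCorners ℝ E H) [I.Boundaryless] {M : Type*} [TopologicalSpace M]
  [ChartedSpace H M] [IsManifold I ∞ M]
  {E' : Type*} [NormedAddCommGroup E'] [NormedSpace ℝ E'] {H' : Type*} [TopologicalSpace H']
  (I' : ModelWithCorners ℝ E' H') [I'.Boundaryless] {M' : Type*} [TopologicalSpace M']
  [ChartedSpace H' M'] [IsManifold I' ∞ M']

/-- The derivative at `x` of the preferred chart at `x₀`. -/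
def chartDeriv (x₀ x : M) : TangentSpace I x →L[ℝ] E :=
  mfderiv I 𝓘(ℝ, E) (extChartAt I x₀) x

variable {I I'}

theorem chartDeriv_bijective {x₀ x : M} (hx : x ∈ (extChartAt I x₀).source) :
    Function.Bijective (chartDeriv I x₀ x) := by
  have : IsManifold I 1 M := isManifold_one_of_infty
  obtain ⟨e, he⟩ := isInvertible_mfderiv_extChartAt (I := I) hx
  have : (chartDeriv I x₀ x : TangentSpace I x → E) = e := by
    funext v
    exact congrArg (fun L => L v) he.symm
  rw [this]
  exact e.bijective

theorem exists_extChartAt_symm_eq {x₀ x : M} (hx : x ∈ (extChartAt I x₀).source) :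
    ∃ y ∈ (extChartAt I x₀).target, (extChartAt I x₀).symm y = x :=
  ⟨_, (extChartAt I x₀).map_source hx, (extChartAt I x₀).left_inv hx⟩

theorem chartDeriv_mfderiv_symm {x₀ : M} {y : E} (hy : y ∈ (extChartAt I x₀).target) (w : E) :
    chartDeriv I x₀ ((extChartAt I x₀).symm y)
      (mfderiv 𝓘(ℝ, E) I (extChartAt I x₀).symm y w) = w := by
  have : IsManifold I 1 M := isManifold_one_of_infty
  have h := mfderiv_extChartAt_comp_mfderivWithin_extChartAt_symm (I := I) hy
  rw [I.range_eq_univ, mfderivWithin_univ] at h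
  exact congrArg (fun L => L w) h

theorem mfderiv_symm_chartDeriv {x₀ : M} {y : E} (hy : y ∈ (extChartAt I x₀).target)
    (v : TangentSpace I ((extChartAt I x₀).symm y)) :
    mfderiv 𝓘(ℝ, E) I (extChartAt I x₀).symm y
      (chartDeriv I x₀ ((extChartAt I x₀).symm y) v) = v :=
  (chartDeriv_bijective ((extChartAt I x₀).map_target hy)).1 (chartDeriv_mfderiv_symm hy _)

theorem formInChart_chartDeriv (θ : (x : M) → TangentSpace I x →L[ℝ] ℝ) {x₀ x : M}
    (hx : x ∈ (extChartAt I x₀).source) (v : TangentSpace I x) :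
    formInChart I θ x₀ (extChartAt I x₀ x) (chartDeriv I x₀ x v) = θ x v := by
  obtain ⟨y, hy, rfl⟩ := exists_extChartAt_symm_eq hx
  rw [(extChartAt I x₀).right_inv hy]
  exact congrArg (θ _) (mfderiv_symm_chartDeriv hy v)

/-- The chain rule at every point of a fixed chart domain, not only at its base point: invariance of
the Liouville form has to be read on a whole neighbourhood before it is differentiated. -/
theorem fderiv_writtenInCharts {f : M → M'} {x₀ x : M} {x₁ : M'}
    (hx : x ∈ (extChartAt I x₀).source) (hfx : f x ∈ (extChartAt I' x₁).source)
    (hf : MDifferentiableAt I I' f x) (v : TangentSpace I x) :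
    fderiv ℝ (fun y => extChartAt I' x₁ (f ((extChartAt I x₀).symm y))) (extChartAt I x₀ x)
      (chartDeriv I x₀ x v) = chartDeriv I' x₁ (f x) (mfderiv I I' f x v) := by
  have : IsManifold I 1 M := isManifold_one_of_infty
  have : IsManifold I' 1 M' := isManifold_one_of_infty
  obtain ⟨y, hy, rfl⟩ := exists_extChartAt_symm_eq hx
  rw [(extChartAt I x₀).right_inv hy]
  have h1 : MDifferentiableAt 𝓘(ℝ, E) I (extChartAt I x₀).symm y := by
    have := mdifferentiableWithinAt_extChartAt_symm (I := I) hy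
    rwa [I.range_eq_univ, mdifferentiableWithinAt_univ] at this
  have h2 : MDifferentiableAt I' 𝓘(ℝ, E') (extChartAt I' x₁) (f ((extChartAt I x₀).symm y)) :=
    mdifferentiableAt_extChartAt (by rwa [extChartAt_source] at hfx)
  have h3 := (h2.hasMFDerivAt.comp y (hf.hasMFDerivAt.comp y h1.hasMFDerivAt)).mfderiv
  rw [mfderiv_eq_fderiv] at h3
  refine (congrArg (fun L => L (chartDeriv I x₀ _ v)) h3).trans ?_
  exact congrArg (fun w => chartDeriv I' x₁ _ (mfderiv I I' f _ w)) (mfderiv_symm_chartDeriv hy v)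

theorem mvfderiv_eq_fderiv_chart {F : M → ℝ} {x₀ x : M} (hx : x ∈ (extChartAt I x₀).source)
    (hF : MDifferentiableAt I 𝓘(ℝ, ℝ) F x) (v : TangentSpace I x) :
    mvfderiv I F x v = fderiv ℝ (fun y => F ((extChartAt I x₀).symm y)) (extChartAt I x₀ x)
      (chartDeriv I x₀ x v) := by
  have : IsManifold I 1 M := isManifold_one_of_infty
  obtain ⟨y, hy, rfl⟩ := exists_extChartAt_symm_eq hx
  rw [(extChartAt I x₀).right_inv hy]
  have h1 : MDifferentiableAt 𝓘(ℝ, E) I (extChartAt I x₀).symm y := by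
    have := mdifferentiableWithinAt_extChartAt_symm (I := I) hy
    rwa [I.range_eq_univ, mdifferentiableWithinAt_univ] at this
  have h3 := (hF.hasMFDerivAt.comp y h1.hasMFDerivAt).mfderiv
  rw [mfderiv_eq_fderiv] at h3
  refine Eq.symm ((congrArg (fun L => L (chartDeriv I x₀ _ v)) h3).trans ?_)
  exact congrArg (fun w => mfderiv I 𝓘(ℝ, ℝ) F _ w) (mfderiv_symm_chartDeriv hy v)

theorem mvfderiv_comp_of_mdifferentiableAt {f : M → M'} {F : M' → ℝ} {x : M}
    (hF : MDifferentiableAt I' 𝓘(ℝ, ℝ) F (f x)) (hf : MDifferentiableAt I I' f x)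
    (v : TangentSpace I x) :
    mvfderiv I (fun y => F (f y)) x v = mvfderiv I' F (f x) (mfderiv I I' f x v) :=
  mvfderiv_comp_apply x hF hf v

theorem contDiffOn_comp_extChartAt_symm {F : M → E'} (hF : ContMDiff I 𝓘(ℝ, E') ∞ F) (x₀ : M) :
    ContDiffOn ℝ ∞ (fun y => F ((extChartAt I x₀).symm y)) (extChartAt I x₀).target :=
  (hF.comp_contMDiffOn (contMDiffOn_extChartAt_symm x₀)).contDiffOn

theorem contMDiff_of_contDiffOn_charts {F : M → E'}
    (h : ∀ x₀ : M, ∃ K : E → E', ContDiffAt ℝ ∞ K (extChartAt I x₀ x₀) ∧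
      ∀ᶠ x in 𝓝 x₀, F x = K (extChartAt I x₀ x)) :
    ContMDiff I 𝓘(ℝ, E') ∞ F := by
  intro x₀
  obtain ⟨K, hK, hFK⟩ := h x₀
  have h1 : ContMDiffAt I 𝓘(ℝ, E') ∞ (fun x => K (extChartAt I x₀ x)) x₀ :=
    hK.contMDiffAt.comp x₀ contMDiffAt_extChartAt
  exact h1.congr_of_eventuallyEq hFK

variable (I) in
/-- A 1-form is smooth if its expressions in all preferred charts are. -/
def IsSmoothForm (θ : (x : M) → TangentSpace I x →L[ℝ] ℝ) : Prop :=
  ∀ x₀ : M, ContDiffAt ℝ ∞ (formInChart I θ x₀) (extChartAt I x₀ x₀)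

theorem eventually_mem_extChartAt_source (x₀ : M) : ∀ᶠ x in 𝓝 x₀, x ∈ (extChartAt I x₀).source :=
  extChartAt_source_mem_nhds (I := I) x₀

theorem eventually_mem_extChartAt_target {x₀ x : M} (hx : x ∈ (extChartAt I x₀).source) :
    ∀ᶠ y in 𝓝 (extChartAt I x₀ x), y ∈ (extChartAt I x₀).target :=
  (isOpen_extChartAt_target x₀).mem_nhds ((extChartAt I x₀).map_source hx)

theorem formInChart_mvfderiv {F : M → ℝ} (hF : MDifferentiable I 𝓘(ℝ, ℝ) F) {x₀ : M} {y : E}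
    (hy : y ∈ (extChartAt I x₀).target) :
    formInChart I (mvfderiv I F) x₀ y = fderiv ℝ (fun y => F ((extChartAt I x₀).symm y)) y := by
  ext w
  have h := mvfderiv_eq_fderiv_chart ((extChartAt I x₀).map_target hy) (hF _)
    (mfderiv 𝓘(ℝ, E) I (extChartAt I x₀).symm y w)
  rw [(extChartAt I x₀).right_inv hy, chartDeriv_mfderiv_symm hy] at h
  exact h

theorem isSmoothForm_mvfderiv {F : M → ℝ} (hF : ContMDiff I 𝓘(ℝ, ℝ) ∞ F) :
    IsSmoothForm I (mvfderiv I F) := by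
  intro x₀
  have hx := mem_extChartAt_source (I := I) x₀
  have h1 : ContDiffAt ℝ ∞ (fun y => F ((extChartAt I x₀).symm y)) (extChartAt I x₀ x₀) :=
    (contDiffOn_comp_extChartAt_symm hF x₀).contDiffAt (eventually_mem_extChartAt_target hx)
  refine (h1.fderiv_right (m := ∞) (by simp)).congr_of_eventuallyEq ?_
  filter_upwards [eventually_mem_extChartAt_target hx] with y hy
  exact formInChart_mvfderiv (hF.mdifferentiable (by simp)) hy

end Charts

/-! ### The canonical form of the cotangent bundle in charts -/

section CotangentCharts

variable {E : Type*} [NormedAddCommGroup E] [NormedSpace ℝ E]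
  {Q : Type*} [TopologicalSpace Q] [ChartedSpace E Q] [IsManifold 𝓘(ℝ, E) ∞ Q]

/-- The preferred charts of T^*Q are the canonical coordinates (q, p) induced by the charts of Q.
This is why the Liouville form has the same expression in all of them. -/
theorem cotangent_extChartAt_apply (m₀ m : CotangentBundle E Q) :
    extChartAt (cotangentModel E) m₀ m = (extChartAt 𝓘(ℝ, E) m₀.proj m.proj,
      m.snd.comp ((trivializationAt E (TangentSpace 𝓘(ℝ, E)) m₀.proj).symmL ℝ m.proj)) := by
  rw [FiberBundle.extChartAt]
  simp
  rw [hom_trivializationAt_apply]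
  simp [ContinuousLinearMap.inCoordinates]

theorem mem_cotangent_extChartAt_source {m₀ m : CotangentBundle E Q} :
    m ∈ (extChartAt (cotangentModel E) m₀).source ↔
      m.proj ∈ (extChartAt 𝓘(ℝ, E) m₀.proj).source := by
  rw [FiberBundle.extChartAt]
  simp
  rw [hom_trivializationAt_apply]
  exact id

theorem mdifferentiable_cotangent_proj :
    MDifferentiable (cotangentModel E) 𝓘(ℝ, E) (fun x : CotangentBundle E Q => x.proj) :=
  (Bundle.contMDiff_proj (n := ∞) (IB := 𝓘(ℝ, E)) (F := E →L[ℝ] ℝ)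
    (fun q : Q => TangentSpace 𝓘(ℝ, E) q →L[ℝ] ℝ)).mdifferentiable (by simp)

theorem chartDeriv_fst {m₀ m : CotangentBundle E Q}
    (hm : m ∈ (extChartAt (cotangentModel E) m₀).source) (v : TangentSpace (cotangentModel E) m) :
    (chartDeriv (cotangentModel E) m₀ m v).1 =
      chartDeriv 𝓘(ℝ, E) m₀.proj m.proj (tangentProj m v) := by
  have : IsManifold 𝓘(ℝ, E) 1 Q := isManifold_one_of_infty
  have : IsManifold (cotangentModel E) 1 (CotangentBundle E Q) := isManifold_one_of_infty
  have hm' := mem_cotangent_extChartAt_source.1 hm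
  rw [extChartAt_source] at hm hm'
  have h1 := ((mdifferentiableAt_extChartAt (I := 𝓘(ℝ, E)) hm').hasMFDerivAt.comp m
    (mdifferentiable_cotangent_proj m).hasMFDerivAt)
  have h2 := (mdifferentiableAt_extChartAt (I := cotangentModel E) hm).hasMFDerivAt
  have h3 : HasMFDerivAt 𝓘(ℝ, E × (E →L[ℝ] ℝ)) 𝓘(ℝ, E)
      (Prod.fst : E × (E →L[ℝ] ℝ) → E) (extChartAt (cotangentModel E) m₀ m)
      (ContinuousLinearMap.fst ℝ E (E →L[ℝ] ℝ)) := hasFDerivAt_fst.hasMFDerivAt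
  have h4 := h3.comp m h2
  have h5 : (Prod.fst ∘ extChartAt (cotangentModel E) m₀ : CotangentBundle E Q → E) =
      extChartAt 𝓘(ℝ, E) m₀.proj ∘ fun x : CotangentBundle E Q => x.proj := by
    funext x
    simp only [Function.comp_apply, cotangent_extChartAt_apply]
  have h6 := h4.mfderiv
  rw [h5] at h6
  exact congrArg (fun L => L v) (h6.symm.trans h1.mfderiv)

/-- This is Θ = p dq: the covector coordinate is composed with the inverse of the tangent
trivialization, and the derivative of the base chart is that trivialization, so the two cancel. -/
theorem liouvilleForm_eq_chart {m₀ m : CotangentBundle E Q}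
    (hm : m ∈ (extChartAt (cotangentModel E) m₀).source) (v : TangentSpace (cotangentModel E) m) :
    liouvilleForm m v =
      (extChartAt (cotangentModel E) m₀ m).2 (chartDeriv (cotangentModel E) m₀ m v).1 := by
  have : IsManifold 𝓘(ℝ, E) 1 Q := isManifold_one_of_infty
  have hm' := mem_cotangent_extChartAt_source.1 hm
  rw [extChartAt_source] at hm'
  rw [chartDeriv_fst hm, cotangent_extChartAt_apply]
  have h1 := TangentBundle.continuousLinearMapAt_trivializationAt (I := 𝓘(ℝ, E)) hm'
  have h2 : chartDeriv 𝓘(ℝ, E) m₀.proj m.proj =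
    (trivializationAt E (TangentSpace 𝓘(ℝ, E)) m₀.proj).continuousLinearMapAt ℝ m.proj := h1.symm
  rw [h2]
  change _ = m.snd (((trivializationAt E (TangentSpace 𝓘(ℝ, E)) m₀.proj).symmL ℝ m.proj) _)
  rw [Bundle.Trivialization.symmL_continuousLinearMapAt]
  · rfl
  · exact hm'

theorem formInChart_liouvilleForm {m₀ : CotangentBundle E Q} {y : E × (E →L[ℝ] ℝ)}
    (hy : y ∈ (extChartAt (cotangentModel E) m₀).target) :
    formInChart (cotangentModel E) liouvilleForm m₀ y = liouvilleModel E y := by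
  refine ContinuousLinearMap.ext fun w => ?_
  have h := liouvilleForm_eq_chart ((extChartAt (cotangentModel E) m₀).map_target hy)
    (mfderiv 𝓘(ℝ, E × (E →L[ℝ] ℝ)) (cotangentModel E) (extChartAt (cotangentModel E) m₀).symm y w)
  rw [(extChartAt (cotangentModel E) m₀).right_inv hy, chartDeriv_mfderiv_symm hy] at h
  exact h

/-- `exteriorDerivative` is computed at m in the chart based at m, so unfolding gives the constant
model form only in that chart. Independence of the chart is proved in `canonicalForm_eq_chart`. -/
theorem canonicalForm_eq_self_chart (m : CotangentBundle E Q)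
    (u v : TangentSpace (cotangentModel E) m) :
    canonicalForm m u v = symplecticModel E (chartDeriv (cotangentModel E) m m u)
      (chartDeriv (cotangentModel E) m m v) := by
  have h : (fun y => ContinuousAlternatingMap.ofSubsingleton ℝ (E × (E →L[ℝ] ℝ)) ℝ (0 : Fin 1)
      (formInChart (cotangentModel E) liouvilleForm m y))
      =ᶠ[𝓝 (extChartAt (cotangentModel E) m m)]
      fun y => ContinuousAlternatingMap.ofSubsingleton ℝ _ ℝ (0 : Fin 1) (liouvilleModel E y) := by
    filter_upwards [eventually_mem_extChartAt_target
      (mem_extChartAt_source (I := cotangentModel E) m)] with y hy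
    rw [formInChart_liouvilleForm hy]
  rw [canonicalForm, exteriorDerivative, h.extDeriv_eq]
  exact (congrArg Neg.neg (extDeriv_liouvilleModel _ (chartDeriv (cotangentModel E) m m u)
    (chartDeriv (cotangentModel E) m m v))).trans (neg_neg _)

/-- A map of cotangent bundles that preserves the Liouville form preserves the canonical form
(in charts). -/
theorem symplecticModel_chartDeriv_of_preserves {f : CotangentBundle E Q → CotangentBundle E Q}
    {m₀ m₁ m : CotangentBundle E Q} (hf : ContMDiff (cotangentModel E) (cotangentModel E) ∞ f)
    (hm : m ∈ (extChartAt (cotangentModel E) m₀).source)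
    (hfm : f m ∈ (extChartAt (cotangentModel E) m₁).source)
    (h : ∀ x (v : TangentSpace (cotangentModel E) x),
      liouvilleForm (f x) (mfderiv (cotangentModel E) (cotangentModel E) f x v) =
        liouvilleForm x v)
    (u v : TangentSpace (cotangentModel E) m) :
    symplecticModel E
      (chartDeriv (cotangentModel E) m₁ (f m)
        (mfderiv (cotangentModel E) (cotangentModel E) f m u))
      (chartDeriv (cotangentModel E) m₁ (f m)
        (mfderiv (cotangentModel E) (cotangentModel E) f m v)) =
    symplecticModel E (chartDeriv (cotangentModel E) m₀ m u)
      (chartDeriv (cotangentModel E) m₀ m v) := by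
  have hfd : ∀ x, MDifferentiableAt (cotangentModel E) (cotangentModel E) f x :=
    hf.mdifferentiable (by simp)
  have hpre : ∀ᶠ y in 𝓝 (extChartAt (cotangentModel E) m₀ m),
      y ∈ (extChartAt (cotangentModel E) m₀).target ∧
      f ((extChartAt (cotangentModel E) m₀).symm y) ∈
        (extChartAt (cotangentModel E) m₁).source := by
    refine (eventually_mem_extChartAt_target hm).and ?_
    have hc : ContinuousAt (fun y => f ((extChartAt (cotangentModel E) m₀).symm y))
        (extChartAt (cotangentModel E) m₀ m) :=
      hf.continuous.continuousAt.comp (continuousAt_extChartAt_symm' hm)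
    refine hc.eventually_mem ((isOpen_extChartAt_source m₁).mem_nhds ?_)
    rwa [(extChartAt (cotangentModel E) m₀).left_inv hm]
  have hΦ : ContDiffAt ℝ 2 (fun y => extChartAt (cotangentModel E) m₁
      (f ((extChartAt (cotangentModel E) m₀).symm y))) (extChartAt (cotangentModel E) m₀ m) := by
    refine ContDiffAt.of_le (n := ∞) ?_ (by norm_cast)
    refine ContMDiffAt.contDiffAt ?_
    have h1 : ContMDiffAt 𝓘(ℝ, E × (E →L[ℝ] ℝ)) (cotangentModel E) ∞
        (extChartAt (cotangentModel E) m₀).symm (extChartAt (cotangentModel E) m₀ m) :=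
      (contMDiffOn_extChartAt_symm m₀).contMDiffAt (eventually_mem_extChartAt_target hm)
    refine ContMDiffAt.comp _ (contMDiffAt_extChartAt' ?_) (ContMDiffAt.comp _ (hf _) h1)
    rw [(extChartAt (cotangentModel E) m₀).left_inv hm, ← extChartAt_source (cotangentModel E)]
    exact hfm
  -- In canonical coordinates both Liouville forms are p dq, so the local expression of f satisfies
  -- the hypothesis of `symplecticModel_fderiv`.
  have key := symplecticModel_fderiv hΦ ?_ (chartDeriv (cotangentModel E) m₀ m u)
    (chartDeriv (cotangentModel E) m₀ m v)
  · rwa [fderiv_writtenInCharts hm hfm (hfd m), fderiv_writtenInCharts hm hfm (hfd m)] at key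
  · filter_upwards [hpre] with y hy w
    have hx := (extChartAt (cotangentModel E) m₀).map_target hy.1
    obtain ⟨v, rfl⟩ := (chartDeriv_bijective hx).2 w
    have h1 := fderiv_writtenInCharts hx hy.2 (hfd _) v
    have h2 := h _ v
    rw [liouvilleForm_eq_chart hy.2, liouvilleForm_eq_chart hx, ← h1] at h2
    rw [(extChartAt (cotangentModel E) m₀).right_inv hy.1] at h2
    exact h2

/-- The identity map preserves the Liouville form; read in two different charts, it says that the
coordinate change preserves the model symplectic form. -/
theorem canonicalForm_eq_chart {m₀ m : CotangentBundle E Q}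
    (hm : m ∈ (extChartAt (cotangentModel E) m₀).source)
    (u v : TangentSpace (cotangentModel E) m) :
    canonicalForm m u v = symplecticModel E (chartDeriv (cotangentModel E) m₀ m u)
      (chartDeriv (cotangentModel E) m₀ m v) := by
  have h := symplecticModel_chartDeriv_of_preserves (f := id) contMDiff_id hm
    (mem_extChartAt_source (I := cotangentModel E) m) (fun x v => by rw [mfderiv_id]; rfl) u v
  rw [mfderiv_id] at h
  rw [canonicalForm_eq_self_chart]
  exact h

theorem canonicalForm_of_preserves {f : CotangentBundle E Q → CotangentBundle E Q}
    (hf : ContMDiff (cotangentModel E) (cotangentModel E) ∞ f)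
    (h : ∀ x (v : TangentSpace (cotangentModel E) x),
      liouvilleForm (f x) (mfderiv (cotangentModel E) (cotangentModel E) f x v) =
        liouvilleForm x v)
    (m : CotangentBundle E Q) (u v : TangentSpace (cotangentModel E) m) :
    canonicalForm (f m) (mfderiv (cotangentModel E) (cotangentModel E) f m u)
      (mfderiv (cotangentModel E) (cotangentModel E) f m v) = canonicalForm m u v := by
  rw [canonicalForm_eq_self_chart, canonicalForm_eq_self_chart]
  exact symplecticModel_chartDeriv_of_preserves hf (mem_extChartAt_source m)
    (mem_extChartAt_source (f m)) h u v

/-- The canonical form at `m` as a bilinear map. -/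
def canonicalFlat (m : CotangentBundle E Q) :
    TangentSpace (cotangentModel E) m →ₗ[ℝ] Module.Dual ℝ (TangentSpace (cotangentModel E) m) :=
  LinearMap.mk₂ ℝ (canonicalForm m)
    (fun u v w => by simp only [canonicalForm_eq_self_chart, map_add, _root_.add_apply])
    (fun c u v => by simp only [canonicalForm_eq_self_chart, map_smul, _root_.smul_apply])
    (fun u v w => by simp only [canonicalForm_eq_self_chart, map_add])
    (fun c u v => by simp only [canonicalForm_eq_self_chart, map_smul])

@[simp] theorem canonicalFlat_apply (m : CotangentBundle E Q)
    (u v : TangentSpace (cotangentModel E) m) : canonicalFlat m u v = canonicalForm m u v := rfl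

theorem canonicalForm_skew (m : CotangentBundle E Q) (u v : TangentSpace (cotangentModel E) m) :
    canonicalForm m u v = - canonicalForm m v u := by
  simp [canonicalForm_eq_self_chart]

theorem canonicalFlat_injective (m : CotangentBundle E Q) :
    Function.Injective (canonicalFlat m) := by
  rw [injective_iff_map_eq_zero]
  intro u hu
  have hc := chartDeriv_bijective (mem_extChartAt_source (I := cotangentModel E) m)
  apply hc.1
  rw [map_zero]
  apply symplecticModel_injective
  rw [map_zero]
  refine ContinuousLinearMap.ext fun w => ?_
  obtain ⟨v, rfl⟩ := hc.2 w
  rw [← canonicalForm_eq_self_chart, ← canonicalFlat_apply, hu]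
  rfl

/-! ### Inversion of the canonical form and the canonical Poisson bracket -/

variable [FiniteDimensional ℝ E]

instance finiteDimensional_tangentSpace_cotangent (m : CotangentBundle E Q) :
    FiniteDimensional ℝ (TangentSpace (cotangentModel E) m) :=
  inferInstanceAs (FiniteDimensional ℝ (E × (E →L[ℝ] ℝ)))

/-- The identification of covectors and vectors of `T^*Q` given by the canonical form. -/
def canonicalSharp (m : CotangentBundle E Q) :
    Module.Dual ℝ (TangentSpace (cotangentModel E) m) →ₗ[ℝ] TangentSpace (cotangentModel E) m :=
  (LinearEquiv.ofInjectiveOfFinrankEq (canonicalFlat m) (canonicalFlat_injective m)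
    Subspace.dual_finrank_eq.symm).symm.toLinearMap

@[simp] theorem canonicalForm_canonicalSharp (m : CotangentBundle E Q)
    (α : Module.Dual ℝ (TangentSpace (cotangentModel E) m))
    (u : TangentSpace (cotangentModel E) m) : canonicalForm m (canonicalSharp m α) u = α u :=
  congrArg (fun L => L u) ((LinearEquiv.ofInjectiveOfFinrankEq (canonicalFlat m)
    (canonicalFlat_injective m) Subspace.dual_finrank_eq.symm).apply_symm_apply α)

theorem chartDeriv_canonicalSharp {m₀ m : CotangentBundle E Q}
    (hm : m ∈ (extChartAt (cotangentModel E) m₀).source)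
    (α : Module.Dual ℝ (TangentSpace (cotangentModel E) m)) (a : (E × (E →L[ℝ] ℝ)) →L[ℝ] ℝ)
    (h : ∀ v, α v = a (chartDeriv (cotangentModel E) m₀ m v)) :
    chartDeriv (cotangentModel E) m₀ m (canonicalSharp m α) = sharpModel E a := by
  apply symplecticModel_injective
  rw [symplecticModel_sharpModel]
  refine ContinuousLinearMap.ext fun w => ?_
  obtain ⟨v, rfl⟩ := (chartDeriv_bijective hm).2 w
  rw [← canonicalForm_eq_chart hm, canonicalForm_canonicalSharp, h]

theorem eq_canonicalSharp {m : CotangentBundle E Q} {X : TangentSpace (cotangentModel E) m}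
    {α : Module.Dual ℝ (TangentSpace (cotangentModel E) m)}
    (h : ∀ u, canonicalForm m X u = α u) : X = canonicalSharp m α :=
  canonicalFlat_injective m (LinearMap.ext fun u => by simp [h])

/-- The value `b(a^♯)` for 1-forms `a`, `b` on `T^*Q`. -/
def formPairing (a b : (m : CotangentBundle E Q) → TangentSpace (cotangentModel E) m →L[ℝ] ℝ)
    (m : CotangentBundle E Q) : ℝ :=
  b m (canonicalSharp m (a m).toLinearMap)

theorem formPairing_eq_chart
    (a b : (m : CotangentBundle E Q) → TangentSpace (cotangentModel E) m →L[ℝ] ℝ)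
    {m₀ m : CotangentBundle E Q} (hm : m ∈ (extChartAt (cotangentModel E) m₀).source) :
    formPairing a b m =
      formInChart (cotangentModel E) b m₀ (extChartAt (cotangentModel E) m₀ m)
        (sharpModel E (formInChart (cotangentModel E) a m₀
          (extChartAt (cotangentModel E) m₀ m))) := by
  rw [← chartDeriv_canonicalSharp hm (a m).toLinearMap _
    (fun v => (formInChart_chartDeriv a hm v).symm), formInChart_chartDeriv b hm]
  rfl

/-- In canonical coordinates the sharp map is the constant `sharpModel`, so smoothness of the
pairing only involves the coordinate expressions of the two forms. -/
theorem contMDiff_formPairing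
    {a b : (m : CotangentBundle E Q) → TangentSpace (cotangentModel E) m →L[ℝ] ℝ}
    (ha : IsSmoothForm (cotangentModel E) a) (hb : IsSmoothForm (cotangentModel E) b) :
    ContMDiff (cotangentModel E) 𝓘(ℝ, ℝ) ∞ (formPairing a b) := by
  refine contMDiff_of_contDiffOn_charts fun m₀ => ⟨fun y =>
    formInChart (cotangentModel E) b m₀ y (sharpModel E (formInChart (cotangentModel E) a m₀ y)),
    ?_, ?_⟩
  · have h := (ha m₀).continuousLinearMap_comp (sharpModel E)
    exact (hb m₀).clm_apply h
  filter_upwards [eventually_mem_extChartAt_source (I := cotangentModel E) m₀] with m hm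
  exact formPairing_eq_chart a b hm

/-- The canonical Poisson bracket on `T^*Q`. -/
def cotangentBracket (F K : CotangentBundle E Q → ℝ) (m : CotangentBundle E Q) : ℝ :=
  - formPairing (mvfderiv (cotangentModel E) F) (mvfderiv (cotangentModel E) K) m

theorem contMDiff_cotangentBracket {F K : CotangentBundle E Q → ℝ}
    (hF : ContMDiff (cotangentModel E) 𝓘(ℝ, ℝ) ∞ F)
    (hK : ContMDiff (cotangentModel E) 𝓘(ℝ, ℝ) ∞ K) :
    ContMDiff (cotangentModel E) 𝓘(ℝ, ℝ) ∞ (cotangentBracket F K) :=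
  (contMDiff_formPairing (isSmoothForm_mvfderiv hF) (isSmoothForm_mvfderiv hK)).neg

theorem cotangentBracket_eq_chart {F K : CotangentBundle E Q → ℝ}
    (hF : ContMDiff (cotangentModel E) 𝓘(ℝ, ℝ) ∞ F)
    (hK : ContMDiff (cotangentModel E) 𝓘(ℝ, ℝ) ∞ K) {m₀ : CotangentBundle E Q}
    {y : E × (E →L[ℝ] ℝ)} (hy : y ∈ (extChartAt (cotangentModel E) m₀).target) :
    cotangentBracket F K ((extChartAt (cotangentModel E) m₀).symm y) =
      modelBracket (fun y => F ((extChartAt (cotangentModel E) m₀).symm y))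
        (fun y => K ((extChartAt (cotangentModel E) m₀).symm y)) y := by
  rw [cotangentBracket, formPairing_eq_chart _ _
    ((extChartAt (cotangentModel E) m₀).map_target hy),
    (extChartAt (cotangentModel E) m₀).right_inv hy,
    formInChart_mvfderiv (hF.mdifferentiable (by simp)) hy,
    formInChart_mvfderiv (hK.mdifferentiable (by simp)) hy]
  rfl

theorem cotangentBracket_jacobi {F K L : CotangentBundle E Q → ℝ}
    (hF : ContMDiff (cotangentModel E) 𝓘(ℝ, ℝ) ∞ F)
    (hK : ContMDiff (cotangentModel E) 𝓘(ℝ, ℝ) ∞ K)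
    (hL : ContMDiff (cotangentModel E) 𝓘(ℝ, ℝ) ∞ L) (m : CotangentBundle E Q) :
    cotangentBracket F (cotangentBracket K L) m + cotangentBracket K (cotangentBracket L F) m +
      cotangentBracket L (cotangentBracket F K) m = 0 := by
  have hm := mem_extChartAt_source (I := cotangentModel E) m
  have hev := eventually_mem_extChartAt_target hm
  have hd : ∀ {A : CotangentBundle E Q → ℝ}, ContMDiff (cotangentModel E) 𝓘(ℝ, ℝ) ∞ A →
      ContDiffAt ℝ 2 (fun y => A ((extChartAt (cotangentModel E) m).symm y))
        (extChartAt (cotangentModel E) m m) := fun hA =>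
    ((contDiffOn_comp_extChartAt_symm hA m).contDiffAt hev).of_le (by norm_cast)
  have hb : ∀ {A B C : CotangentBundle E Q → ℝ}, ContMDiff (cotangentModel E) 𝓘(ℝ, ℝ) ∞ A →
      ContMDiff (cotangentModel E) 𝓘(ℝ, ℝ) ∞ B → ContMDiff (cotangentModel E) 𝓘(ℝ, ℝ) ∞ C →
      cotangentBracket A (cotangentBracket B C) m =
        modelBracket (fun y => A ((extChartAt (cotangentModel E) m).symm y))
          (modelBracket (fun y => B ((extChartAt (cotangentModel E) m).symm y))
            (fun y => C ((extChartAt (cotangentModel E) m).symm y)))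
          (extChartAt (cotangentModel E) m m) := by
    intro A B C hA hB hC
    have h1 := cotangentBracket_eq_chart hA (contMDiff_cotangentBracket hB hC) (m₀ := m)
      ((extChartAt (cotangentModel E) m).map_source hm)
    rw [(extChartAt (cotangentModel E) m).left_inv hm] at h1
    rw [h1, modelBracket, modelBracket]
    -- The outer bracket sees only the derivative of the inner one at m, so it is enough that the
    -- inner bracket agrees with its model expression near m.
    congr 2
    refine Filter.EventuallyEq.fderiv_eq ?_
    filter_upwards [hev] with y hy
    exact cotangentBracket_eq_chart hB hC hy
  rw [hb hF hK hL, hb hK hL hF, hb hL hF hK]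
  exact modelBracket_jacobi (hd hF) (hd hK) (hd hL)

end CotangentCharts

/-! ### The lifted action on the cotangent bundle -/

section LiftedAction

variable {E : Type*} [NormedAddCommGroup E] [NormedSpace ℝ E]
  {Q : Type*} [TopologicalSpace Q] [ChartedSpace E Q] [IsManifold 𝓘(ℝ, E) ∞ Q]

theorem snd_apply_eq_chart {m₀ m : CotangentBundle E Q}
    (hm : m ∈ (extChartAt (cotangentModel E) m₀).source) (v : TangentSpace 𝓘(ℝ, E) m.proj) :
    m.snd v = (extChartAt (cotangentModel E) m₀ m).2 (chartDeriv 𝓘(ℝ, E) m₀.proj m.proj v) := by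
  have : IsManifold 𝓘(ℝ, E) 1 Q := isManifold_one_of_infty
  have hm' := mem_cotangent_extChartAt_source.1 hm
  rw [extChartAt_source] at hm'
  rw [cotangent_extChartAt_apply]
  have h1 := TangentBundle.continuousLinearMapAt_trivializationAt (I := 𝓘(ℝ, E)) hm'
  have h2 : chartDeriv 𝓘(ℝ, E) m₀.proj m.proj =
    (trivializationAt E (TangentSpace 𝓘(ℝ, E)) m₀.proj).continuousLinearMapAt ℝ m.proj := h1.symm
  rw [h2]
  change _ = m.snd (((trivializationAt E (TangentSpace 𝓘(ℝ, E)) m₀.proj).symmL ℝ m.proj) _)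
  rw [Bundle.Trivialization.symmL_continuousLinearMapAt]
  exact hm'

/-! ### Smoothness of maps into the cotangent bundle and of derivatives with parameters -/

section Smoothness

variable {E' : Type*} [NormedAddCommGroup E'] [NormedSpace ℝ E'] {H' : Type*}
  [TopologicalSpace H'] {I' : ModelWithCorners ℝ E' H'} {M : Type*} [TopologicalSpace M]
  [ChartedSpace H' M]

theorem contMDiffAt_cotangent {f : M → CotangentBundle E Q} {x : M} :
    ContMDiffAt I' (cotangentModel E) ∞ f x ↔
      ContMDiffAt I' 𝓘(ℝ, E) ∞ (fun y => (f y).proj) x ∧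
      ContMDiffAt I' 𝓘(ℝ, E →L[ℝ] ℝ) ∞
        (fun y => (extChartAt (cotangentModel E) (f x) (f y)).2) x := by
  rw [contMDiffAt_hom_bundle]
  simp only [cotangent_extChartAt_apply]
  simp [ContinuousLinearMap.inCoordinates]

/-- Tangent coordinates on a normed space are trivial, so the bundle statement about `mfderiv`
becomes one about `fderiv`. It serves both the lifted action and the infinitesimal generators, with
parameters in a manifold. -/
theorem contMDiffAt_fderiv_param {N F F' : Type*} [NormedAddCommGroup F] [NormedSpace ℝ F]
    [NormedAddCommGroup F'] [NormedSpace ℝ F'] [TopologicalSpace N] [ChartedSpace H' N]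
    [IsManifold I' ∞ N] {f : N → F → F'} {g : N → F} {x : N}
    (hf : ContMDiffAt (I'.prod 𝓘(ℝ, F)) 𝓘(ℝ, F') ∞ (Function.uncurry f) (x, g x))
    (hg : ContMDiffAt I' 𝓘(ℝ, F) ∞ g x) :
    ContMDiffAt I' 𝓘(ℝ, F →L[ℝ] F') ∞ (fun y => fderiv ℝ (f y) (g y)) x := by
  have : IsManifold I' 1 N := isManifold_one_of_infty
  have h := ContMDiffAt.mfderiv (m := ∞) f g hf hg (by simp)
  refine h.congr_of_eventuallyEq (Filter.Eventually.of_forall fun y => ?_)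
  exact (mfderiv_eq_fderiv (𝕜 := ℝ) (f := f y) (x := g y)).symm.trans
    (congrFun (inTangentCoordinates_model_space (I := 𝓘(ℝ, F)) (I' := 𝓘(ℝ, F')) g
    (fun y => f y (g y)) (fun y => mfderiv 𝓘(ℝ, F) 𝓘(ℝ, F') (f y) (g y)) x) y).symm

end Smoothness

/-! ### Translations and their cotangent lifts -/

variable {G : Type*} [Group G] [MulAction G Q]

theorem mdifferentiableAt_translation
    (hG : ∀ g : G, ContMDiff 𝓘(ℝ, E) 𝓘(ℝ, E) ∞ (fun x : Q => g • x))
    (g : G) (q : Q) :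
    MDifferentiableAt 𝓘(ℝ, E) 𝓘(ℝ, E) (fun x : Q => g • x) q :=
  (hG g).mdifferentiable (by simp) q

theorem mfderiv_translation_leftInverse
    (hG : ∀ g : G, ContMDiff 𝓘(ℝ, E) 𝓘(ℝ, E) ∞ (fun x : Q => g • x))
    {g h : G} (hgh : g * h = 1) (q : Q)
    (v : TangentSpace 𝓘(ℝ, E) q) :
    (mfderiv 𝓘(ℝ, E) 𝓘(ℝ, E) (fun x : Q => g • x) (h • q)
      (mfderiv 𝓘(ℝ, E) 𝓘(ℝ, E) (fun x : Q => h • x) q v) : E) = v := by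
  have h1 := mfderiv_eq_comp_of_eq (E := E) (f := id) (g := fun x : Q => g • x)
    (h := fun x : Q => h • x) (by funext x; simp [smul_smul, hgh]) q
    (mdifferentiableAt_translation hG g _) (mdifferentiableAt_translation hG h q)
  have h2 := h1.symm.trans (mfderiv_eq_id_of_eq (E := E) (f := (id : Q → Q)) rfl q)
  exact congrArg (fun L : E →L[ℝ] E => L v) h2

theorem isInvertible_mfderiv_translation
    (hG : ∀ g : G, ContMDiff 𝓘(ℝ, E) 𝓘(ℝ, E) ∞ (fun x : Q => g • x))
    (g : G) (q : Q) :
    ContinuousLinearMap.IsInvertible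
      (mfderiv 𝓘(ℝ, E) 𝓘(ℝ, E) (fun x : Q => g • x) q : E →L[ℝ] E) := by
  refine ⟨ContinuousLinearEquiv.equivOfInverse
    (mfderiv 𝓘(ℝ, E) 𝓘(ℝ, E) (fun x : Q => g • x) q : E →L[ℝ] E)
    (mfderiv 𝓘(ℝ, E) 𝓘(ℝ, E) (fun x : Q => g⁻¹ • x) (g • q) : E →L[ℝ] E)
    (mfderiv_translation_leftInverse hG (inv_mul_cancel g) q) ?_, rfl⟩
  intro v
  have h := mfderiv_translation_leftInverse hG (mul_inv_cancel g) (g • q) v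
  rwa [inv_smul_smul] at h

/-- Trades the inverse of T_q g in `cotangentLift` for the derivative of translation by g⁻¹. Joint
smoothness in (g, m) then needs no inversion of operators. -/
theorem cotangentLift_snd_apply
    (hG : ∀ g : G, ContMDiff 𝓘(ℝ, E) 𝓘(ℝ, E) ∞ (fun x : Q => g • x))
    (g : G) (m : CotangentBundle E Q)
    (w : TangentSpace 𝓘(ℝ, E) (g • m.proj)) :
    (cotangentLift g m).snd w =
      m.snd (mfderiv 𝓘(ℝ, E) 𝓘(ℝ, E) (fun x : Q => g⁻¹ • x) (g • m.proj) w : E) := by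
  obtain ⟨e, he⟩ := isInvertible_mfderiv_translation hG g m.proj
  have h1 : (cotangentLift g m).snd w = m.snd (e.symm w) := by
    change m.snd ((mfderiv 𝓘(ℝ, E) 𝓘(ℝ, E) (fun x : Q => g • x) m.proj : E →L[ℝ] E).inverse w) = _
    rw [← he, ContinuousLinearMap.inverse_equiv]
    rfl
  have h2 := mfderiv_translation_leftInverse hG (inv_mul_cancel g) m.proj (e.symm w)
  have h3 : (mfderiv 𝓘(ℝ, E) 𝓘(ℝ, E) (fun x : Q => g • x) m.proj : E →L[ℝ] E) (e.symm w) = w := by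
    rw [← he]
    exact e.apply_symm_apply w
  rw [h1]
  exact congrArg m.snd (h2.symm.trans (congrArg
    (mfderiv 𝓘(ℝ, E) 𝓘(ℝ, E) (fun x : Q => g⁻¹ • x) (g • m.proj) : E →L[ℝ] E) h3))

theorem cotangentLift_snd_apply_mfderiv
    (hG : ∀ g : G, ContMDiff 𝓘(ℝ, E) 𝓘(ℝ, E) ∞ (fun x : Q => g • x))
    (g : G) (m : CotangentBundle E Q)
    (v : TangentSpace 𝓘(ℝ, E) m.proj) :
    (cotangentLift g m).snd (mfderiv 𝓘(ℝ, E) 𝓘(ℝ, E) (fun x : Q => g • x) m.proj v) = m.snd v :=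
  (cotangentLift_snd_apply hG g m _).trans
    (congrArg m.snd (mfderiv_translation_leftInverse hG (inv_mul_cancel g) m.proj v))

variable {EG : Type*} [NormedAddCommGroup EG] [NormedSpace ℝ EG] [TopologicalSpace G]
  [ChartedSpace EG G] [LieGroup 𝓘(ℝ, EG) ∞ G] [ContMDiffSMul 𝓘(ℝ, EG) 𝓘(ℝ, E) ∞ G Q]

variable (EG) in
-- In canonical coordinates the fibre component of g m is p composed with the derivative of the
-- coordinate expression of translation by g⁻¹; that derivative is smooth in g and in the base point
-- by `contMDiffAt_fderiv_param`.
theorem contMDiff_cotangentLift_uncurry :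
    ContMDiff (𝓘(ℝ, EG).prod (cotangentModel E)) (cotangentModel E) ∞
      (fun p : G × CotangentBundle E Q => cotangentLift p.1 p.2) := by
  rintro ⟨g₀, m₀⟩
  have hG : ∀ g : G, ContMDiff 𝓘(ℝ, E) 𝓘(ℝ, E) ∞ (fun x : Q => g • x) := fun g =>
    ContMDiffSMul.contMDiff_const_smul (I := 𝓘(ℝ, EG)) (n := ∞) g
  have hproj : ContMDiff (𝓘(ℝ, EG).prod (cotangentModel E)) 𝓘(ℝ, E) ∞
      (fun p : G × CotangentBundle E Q => p.1 • p.2.proj) :=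
    contMDiff_fst.smul ((Bundle.contMDiff_proj _).comp contMDiff_snd)
  rw [contMDiffAt_cotangent]
  refine ⟨hproj _, ?_⟩
  have hs0 : g₀ • m₀.proj ∈ (extChartAt 𝓘(ℝ, E) (g₀ • m₀.proj)).source :=
    mem_extChartAt_source _
  have hp : ContMDiffAt (𝓘(ℝ, EG).prod (cotangentModel E)) 𝓘(ℝ, E) ∞
      (fun p : G × CotangentBundle E Q =>
        extChartAt 𝓘(ℝ, E) (g₀ • m₀.proj) (p.1 • p.2.proj)) (g₀, m₀) :=
    ContMDiffAt.comp (g₀, m₀) (contMDiffAt_extChartAt (I := 𝓘(ℝ, E)) (x := g₀ • m₀.proj)) (hproj _)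
  have hf : ContMDiffAt ((𝓘(ℝ, EG).prod (cotangentModel E)).prod 𝓘(ℝ, E)) 𝓘(ℝ, E) ∞
      (Function.uncurry fun (p : G × CotangentBundle E Q) (y : E) =>
        extChartAt 𝓘(ℝ, E) m₀.proj (p.1⁻¹ • (extChartAt 𝓘(ℝ, E) (g₀ • m₀.proj)).symm y))
      ((g₀, m₀), extChartAt 𝓘(ℝ, E) (g₀ • m₀.proj) (g₀ • m₀.proj)) := by
    have h1 : ContMDiffAt 𝓘(ℝ, E) 𝓘(ℝ, E) ∞ (extChartAt 𝓘(ℝ, E) (g₀ • m₀.proj)).symm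
        (extChartAt 𝓘(ℝ, E) (g₀ • m₀.proj) (g₀ • m₀.proj)) :=
      (contMDiffOn_extChartAt_symm _).contMDiffAt (eventually_mem_extChartAt_target hs0)
    have h2 : ContMDiffAt ((𝓘(ℝ, EG).prod (cotangentModel E)).prod 𝓘(ℝ, E)) 𝓘(ℝ, E) ∞
        (fun p : (G × CotangentBundle E Q) × E =>
          p.1.1⁻¹ • (extChartAt 𝓘(ℝ, E) (g₀ • m₀.proj)).symm p.2)
        ((g₀, m₀), extChartAt 𝓘(ℝ, E) (g₀ • m₀.proj) (g₀ • m₀.proj)) :=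
      ContMDiffAt.smul
        ((contMDiff_inv 𝓘(ℝ, EG) ∞).comp (contMDiff_fst.comp contMDiff_fst) _)
        (ContMDiffAt.comp _ h1 contMDiffAt_snd)
    refine ContMDiffAt.comp _ (contMDiffAt_extChartAt' ?_) h2
    rw [(extChartAt 𝓘(ℝ, E) (g₀ • m₀.proj)).left_inv hs0, inv_smul_smul]
    exact mem_chart_source _ _
  have h1 := contMDiffAt_fderiv_param hf hp
  have h2 : ContMDiffAt (𝓘(ℝ, EG).prod (cotangentModel E)) 𝓘(ℝ, E →L[ℝ] ℝ) ∞
      (fun p : G × CotangentBundle E Q => (extChartAt (cotangentModel E) m₀ p.2).2) (g₀, m₀) := by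
    have h3 := (contMDiffAt_cotangent (f := fun p : G × CotangentBundle E Q => p.2)
      (x := (g₀, m₀)) (I' := 𝓘(ℝ, EG).prod (cotangentModel E))).1 contMDiffAt_snd
    exact h3.2
  refine (h2.clm_comp h1).congr_of_eventuallyEq ?_
  have hev1 : ∀ᶠ p : G × CotangentBundle E Q in 𝓝 (g₀, m₀),
      p.2 ∈ (extChartAt (cotangentModel E) m₀).source :=
    continuousAt_snd.eventually_mem (eventually_mem_extChartAt_source (I := cotangentModel E) m₀)
  have hev2 : ∀ᶠ p : G × CotangentBundle E Q in 𝓝 (g₀, m₀),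
      p.1 • p.2.proj ∈ (extChartAt 𝓘(ℝ, E) (g₀ • m₀.proj)).source :=
    (hproj.continuous.continuousAt (x := (g₀, m₀))).eventually_mem
      (eventually_mem_extChartAt_source (I := 𝓘(ℝ, E)) (g₀ • m₀.proj))
  filter_upwards [hev1, hev2] with p hp1 hp2
  obtain ⟨g, m⟩ := p
  have hs1 : cotangentLift g m ∈ (extChartAt (cotangentModel E) (cotangentLift g₀ m₀)).source :=
    mem_cotangent_extChartAt_source.2 hp2
  have hs2 := mem_cotangent_extChartAt_source.1 hp1
  refine ContinuousLinearMap.ext fun w => ?_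
  obtain ⟨v, rfl⟩ := (chartDeriv_bijective hp2).2 w
  refine (snd_apply_eq_chart hs1 v).symm.trans ?_
  refine (cotangentLift_snd_apply hG g m v).trans ?_
  refine (snd_apply_eq_chart hp1 _).trans ?_
  refine congrArg (extChartAt (cotangentModel E) m₀ m).2 ?_
  have h3 := fderiv_writtenInCharts (f := fun x : Q => g⁻¹ • x) (x₁ := m₀.proj) hp2
    (by simpa only [inv_smul_smul] using hs2) (mdifferentiableAt_translation hG g⁻¹ _) v
  exact (congrArg (fun x => (chartDeriv 𝓘(ℝ, E) m₀.proj x : E →L[ℝ] E)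
    (mfderiv 𝓘(ℝ, E) 𝓘(ℝ, E) (fun x : Q => g⁻¹ • x) (g • m.proj) v))
    (inv_smul_smul g m.proj).symm).trans h3.symm

theorem contMDiff_cotangentLift
    (EG : Type*) [NormedAddCommGroup EG] [NormedSpace ℝ EG]
    {G : Type*} [TopologicalSpace G] [ChartedSpace EG G] [Group G] [LieGroup 𝓘(ℝ, EG) ∞ G]
    [MulAction G Q] [ContMDiffSMul 𝓘(ℝ, EG) 𝓘(ℝ, E) ∞ G Q]
    (g : G) :
    ContMDiff (cotangentModel E) (cotangentModel E) ∞
      (cotangentLift g : CotangentBundle E Q → CotangentBundle E Q) :=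
  (contMDiff_cotangentLift_uncurry EG).comp (contMDiff_const.prodMk contMDiff_id)

theorem tangentProj_mfderiv_cotangentLift
    (EG : Type*) [NormedAddCommGroup EG] [NormedSpace ℝ EG]
    {G : Type*} [TopologicalSpace G] [ChartedSpace EG G] [Group G] [LieGroup 𝓘(ℝ, EG) ∞ G]
    [MulAction G Q] [ContMDiffSMul 𝓘(ℝ, EG) 𝓘(ℝ, E) ∞ G Q]
    (g : G) (m : CotangentBundle E Q)
    (v : TangentSpace (cotangentModel E) m) :
    tangentProj (cotangentLift g m)
      (mfderiv (cotangentModel E) (cotangentModel E) (cotangentLift g) m v) =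
    mfderiv 𝓘(ℝ, E) 𝓘(ℝ, E) (fun x : Q => g • x) m.proj (tangentProj m v) := by
  have hG : ∀ g : G, ContMDiff 𝓘(ℝ, E) 𝓘(ℝ, E) ∞ (fun x : Q => g • x) := fun g =>
    ContMDiffSMul.contMDiff_const_smul (I := 𝓘(ℝ, EG)) (n := ∞) g
  have h1 := (mdifferentiable_cotangent_proj (cotangentLift g m)).hasMFDerivAt.comp m
    ((contMDiff_cotangentLift EG g).mdifferentiable (by simp) m).hasMFDerivAt
  have h2 := (mdifferentiableAt_translation hG g m.proj).hasMFDerivAt.comp m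
    (mdifferentiable_cotangent_proj m).hasMFDerivAt
  exact congrArg (fun L => L v) (h1.mfderiv.symm.trans h2.mfderiv)

/-- The tangent projection intertwines the lift with T g on the base, and the lifted covector undoes
T g. -/
theorem liouvilleForm_cotangentLift
    (EG : Type*) [NormedAddCommGroup EG] [NormedSpace ℝ EG]
    {G : Type*} [TopologicalSpace G] [ChartedSpace EG G] [Group G] [LieGroup 𝓘(ℝ, EG) ∞ G]
    [MulAction G Q] [ContMDiffSMul 𝓘(ℝ, EG) 𝓘(ℝ, E) ∞ G Q]
    (g : G) (m : CotangentBundle E Q)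
    (v : TangentSpace (cotangentModel E) m) :
    liouvilleForm (cotangentLift g m)
      (mfderiv (cotangentModel E) (cotangentModel E) (cotangentLift g) m v) =
    liouvilleForm m v := by
  have hG : ∀ g : G, ContMDiff 𝓘(ℝ, E) 𝓘(ℝ, E) ∞ (fun x : Q => g • x) := fun g =>
    ContMDiffSMul.contMDiff_const_smul (I := 𝓘(ℝ, EG)) (n := ∞) g
  exact (congrArg (cotangentLift g m).snd (tangentProj_mfderiv_cotangentLift EG g m v)).trans
    (cotangentLift_snd_apply_mfderiv hG g m (tangentProj m v))

theorem canonicalForm_cotangentLift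
    (EG : Type*) [NormedAddCommGroup EG] [NormedSpace ℝ EG]
    {G : Type*} [TopologicalSpace G] [ChartedSpace EG G] [Group G] [LieGroup 𝓘(ℝ, EG) ∞ G]
    [MulAction G Q] [ContMDiffSMul 𝓘(ℝ, EG) 𝓘(ℝ, E) ∞ G Q]
    (g : G) (m : CotangentBundle E Q)
    (u v : TangentSpace (cotangentModel E) m) :
    canonicalForm (cotangentLift g m)
      (mfderiv (cotangentModel E) (cotangentModel E) (cotangentLift g) m u)
      (mfderiv (cotangentModel E) (cotangentModel E) (cotangentLift g) m v) =
    canonicalForm m u v :=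
  canonicalForm_of_preserves (contMDiff_cotangentLift EG g) (liouvilleForm_cotangentLift EG g) m u v

/-! ### Infinitesimal generators and their momentum functions -/

/-- The infinitesimal generator of the lifted action. -/
def cotangentGenerator (EG : Type*) [NormedAddCommGroup EG] [NormedSpace ℝ EG] (G : Type*)
    [TopologicalSpace G] [ChartedSpace EG G] [Group G] [MulAction G Q] (m : CotangentBundle E Q) :
    GroupLieAlgebra 𝓘(ℝ, EG) G →ₗ[ℝ] TangentSpace (cotangentModel E) m :=
  (mfderiv 𝓘(ℝ, EG) (cotangentModel E) (fun g : G => cotangentLift g m) 1).toLinearMap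

/-- The momentum function `m ↦ m(ξ_Q)` of `ξ`. -/
def momentum (ξ : GroupLieAlgebra 𝓘(ℝ, EG) G) (m : CotangentBundle E Q) : ℝ :=
  m.snd (infinitesimalGenerator EG G m.proj ξ)

theorem contMDiff_orbitMap_cotangent (m : CotangentBundle E Q) :
    ContMDiff 𝓘(ℝ, EG) (cotangentModel E) ∞ (fun g : G => cotangentLift g m) :=
  (contMDiff_cotangentLift_uncurry EG).comp (contMDiff_id.prodMk contMDiff_const)

theorem contMDiff_orbitMap (q : Q) : ContMDiff 𝓘(ℝ, EG) 𝓘(ℝ, E) ∞ (fun g : G => g • q) :=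
  contMDiff_id.smul contMDiff_const

/-- Derivatives of orbit maps at 1 live over 1 q rather than q. Taking v in the model space lets the
base point be rewritten without transporting vectors. -/
theorem chartDeriv_congr {E₁ H₁ M₁ : Type*} [NormedAddCommGroup E₁] [NormedSpace ℝ E₁]
    [TopologicalSpace H₁] {I₁ : ModelWithCorners ℝ E₁ H₁} [TopologicalSpace M₁]
    [ChartedSpace H₁ M₁] (x₀ : M₁) {x y : M₁} (h : x = y) (v : E₁) :
    (chartDeriv I₁ x₀ x : E₁ →L[ℝ] E₁) v = (chartDeriv I₁ x₀ y : E₁ →L[ℝ] E₁) v := by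
  rw [h]

theorem tangentProj_cotangentGenerator (m : CotangentBundle E Q)
    (ξ : GroupLieAlgebra 𝓘(ℝ, EG) G) :
    tangentProj m (cotangentGenerator EG G m ξ) = infinitesimalGenerator EG G m.proj ξ := by
  have h1 := (mdifferentiable_cotangent_proj (cotangentLift (1 : G) m)).hasMFDerivAt.comp (1 : G)
    ((contMDiff_orbitMap_cotangent (EG := EG) m).mdifferentiable (by simp) (1 : G)).hasMFDerivAt
  have h2 := congrArg (fun L => L ξ) h1.mfderiv
  have h3 : ∀ m' : CotangentBundle E Q, m' = m → ∀ v : E × (E →L[ℝ] ℝ),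
      (tangentProj m' : E × (E →L[ℝ] ℝ) →L[ℝ] E) v =
        (tangentProj m : E × (E →L[ℝ] ℝ) →L[ℝ] E) v := fun m' h v => by rw [h]
  exact (h3 _ (cotangentLift_one m) _).symm.trans h2.symm

theorem liouvilleForm_cotangentGenerator (m : CotangentBundle E Q)
    (ξ : GroupLieAlgebra 𝓘(ℝ, EG) G) :
    liouvilleForm m (cotangentGenerator EG G m ξ) = momentum ξ m :=
  congrArg m.snd (tangentProj_cotangentGenerator m ξ)

/-- In charts the generator at q is the derivative, in the coordinate s of the group at 1, of the
jointly smooth map (q, s) ↦ s q; q is the parameter. -/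
theorem contMDiffAt_chartDeriv_infinitesimalGenerator (ξ : GroupLieAlgebra 𝓘(ℝ, EG) G) (q₀ : Q) :
    ContMDiffAt 𝓘(ℝ, E) 𝓘(ℝ, E) ∞
      (fun q => chartDeriv 𝓘(ℝ, E) q₀ q (infinitesimalGenerator EG G q ξ)) q₀ := by
  have hs : (1 : G) ∈ (extChartAt 𝓘(ℝ, EG) (1 : G)).source := mem_extChartAt_source _
  have hs' : q₀ ∈ (extChartAt 𝓘(ℝ, E) q₀).source := mem_extChartAt_source _
  have hf : ContMDiffAt (𝓘(ℝ, E).prod 𝓘(ℝ, EG)) 𝓘(ℝ, E) ∞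
      (Function.uncurry fun (q : Q) (s : EG) =>
        extChartAt 𝓘(ℝ, E) q₀ ((extChartAt 𝓘(ℝ, EG) (1 : G)).symm s • q))
      (q₀, extChartAt 𝓘(ℝ, EG) (1 : G) 1) := by
    have h1 : ContMDiffAt 𝓘(ℝ, EG) 𝓘(ℝ, EG) ∞ (extChartAt 𝓘(ℝ, EG) (1 : G)).symm
        (extChartAt 𝓘(ℝ, EG) (1 : G) 1) :=
      (contMDiffOn_extChartAt_symm _).contMDiffAt (eventually_mem_extChartAt_target hs)
    have h2 : ContMDiffAt (𝓘(ℝ, E).prod 𝓘(ℝ, EG)) 𝓘(ℝ, E) ∞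
        (fun p : Q × EG => (extChartAt 𝓘(ℝ, EG) (1 : G)).symm p.2 • p.1)
        (q₀, extChartAt 𝓘(ℝ, EG) (1 : G) 1) :=
      ContMDiffAt.smul (ContMDiffAt.comp _ h1 contMDiffAt_snd) contMDiffAt_fst
    refine ContMDiffAt.comp _ (contMDiffAt_extChartAt' ?_) h2
    rw [(extChartAt 𝓘(ℝ, EG) (1 : G)).left_inv hs, one_smul]
    exact mem_chart_source _ _
  have h1 := (contMDiffAt_fderiv_param hf (contMDiffAt_const (c := extChartAt 𝓘(ℝ, EG) (1 : G) 1))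
    ).clm_apply (contMDiffAt_const (c := chartDeriv 𝓘(ℝ, EG) (1 : G) 1 ξ))
  refine h1.congr_of_eventuallyEq ?_
  filter_upwards [eventually_mem_extChartAt_source (I := 𝓘(ℝ, E)) q₀] with q hq
  have h2 := fderiv_writtenInCharts (I' := 𝓘(ℝ, E)) (f := fun g : G => g • q) (x₁ := q₀) hs
    (by simpa only [one_smul] using hq)
    ((contMDiff_orbitMap (EG := EG) q).mdifferentiable (by simp) 1) ξ
  exact (chartDeriv_congr q₀ (one_smul G q).symm _).trans h2.symm

theorem contMDiff_momentum (ξ : GroupLieAlgebra 𝓘(ℝ, EG) G) :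
    ContMDiff (cotangentModel E) 𝓘(ℝ, ℝ) ∞
      (momentum ξ : CotangentBundle E Q → ℝ) := by
  intro m₀
  have h1 := (contMDiffAt_cotangent (f := fun m : CotangentBundle E Q => m)
    (x := m₀) (I' := cotangentModel E)).1 contMDiffAt_id
  have h2 := (contMDiffAt_chartDeriv_infinitesimalGenerator ξ m₀.proj).comp m₀ h1.1
  refine (h1.2.clm_apply h2).congr_of_eventuallyEq ?_
  filter_upwards [eventually_mem_extChartAt_source (I := cotangentModel E) m₀] with m hm
  exact snd_apply_eq_chart hm _

/-- The generator of the lifted action is the Hamiltonian vector field of the momentum function. -/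
theorem canonicalForm_cotangentGenerator (ξ : GroupLieAlgebra 𝓘(ℝ, EG) G) (m : CotangentBundle E Q)
    (u : TangentSpace (cotangentModel E) m) :
    canonicalForm m (cotangentGenerator EG G m ξ) u =
      mvfderiv (cotangentModel E) (momentum ξ) m u := by
  set φ := extChartAt (cotangentModel E) m with hφ
  set κ := extChartAt 𝓘(ℝ, EG) (1 : G) with hκ
  have hs : (1 : G) ∈ κ.source := mem_extChartAt_source _
  have hm : m ∈ φ.source := mem_extChartAt_source _
  have hκ1 : κ.symm (κ 1) = 1 := κ.left_inv hs
  have hφm : φ.symm (φ m) = m := φ.left_inv hm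
  -- The lifted action in the chart of G at 1 and the chart of T^*Q at m, prepared for
  -- `symplecticModel_generator`.
  set A : EG × (E × (E →L[ℝ] ℝ)) → E × (E →L[ℝ] ℝ) :=
    fun p => φ (cotangentLift (κ.symm p.1) (φ.symm p.2)) with hA
  have hcont : ContMDiffAt (𝓘(ℝ, EG).prod 𝓘(ℝ, E × (E →L[ℝ] ℝ))) (cotangentModel E) ∞
      (fun p : EG × (E × (E →L[ℝ] ℝ)) => cotangentLift (κ.symm p.1) (φ.symm p.2))
      (κ 1, φ m) := by
    have h1 : ContMDiffAt 𝓘(ℝ, EG) 𝓘(ℝ, EG) ∞ κ.symm (κ 1) :=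
      (contMDiffOn_extChartAt_symm _).contMDiffAt (eventually_mem_extChartAt_target hs)
    have h2 : ContMDiffAt 𝓘(ℝ, E × (E →L[ℝ] ℝ)) (cotangentModel E) ∞ φ.symm (φ m) :=
      (contMDiffOn_extChartAt_symm _).contMDiffAt (eventually_mem_extChartAt_target hm)
    exact ContMDiffAt.comp (κ 1, φ m) (contMDiff_cotangentLift_uncurry EG _)
      ((h1.comp (κ 1, φ m) contMDiffAt_fst).prodMk (h2.comp (κ 1, φ m) contMDiffAt_snd))
  have hAsmooth : ContDiffAt ℝ 2 A (κ 1, φ m) := by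
    refine ContDiffAt.of_le (n := ∞) ?_ (by norm_cast)
    have hs2 : cotangentLift (κ.symm (κ 1)) (φ.symm (φ m)) ∈
        (chartAt (ModelProd E (E →L[ℝ] ℝ)) m).source := by
      rw [hκ1, hφm, cotangentLift_one]
      exact mem_chart_source _ _
    have h := ContMDiffAt.comp (κ 1, φ m) (contMDiffAt_extChartAt' (n := ∞)
      (I := cotangentModel E) hs2) hcont
    rw [← modelWithCornersSelf_prod, chartedSpaceSelf_prod] at h
    exact h.contDiffAt
  have hAdiff : ∀ᶠ p in 𝓝 (κ 1, φ m), DifferentiableAt ℝ A p :=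
    (hAsmooth.eventually (by simp)).mono fun p hp => hp.differentiableAt (by simp)
  have hA0 : ∀ y ∈ φ.target, A (κ 1, y) = y := fun y hy => by
    simp only [hA, hκ1, cotangentLift_one, φ.right_inv hy]
  have htarget : ∀ᶠ y in 𝓝 (φ m), y ∈ φ.target := eventually_mem_extChartAt_target hm
  -- Each lift preserves the Liouville form. The restriction to s near κ 1 keeps the translate of m
  -- inside the chart.
  have hpres : ∀ᶠ s in 𝓝 (κ 1), ∀ v, (A (s, φ m)).2 (fderiv ℝ A (s, φ m) (0, v)).1 =
      (φ m).2 v.1 := by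
    have hc : ContinuousAt (fun s : EG => (s, φ m)) (κ 1) := by fun_prop
    have hsrc : ∀ᶠ p in 𝓝 (κ 1, φ m), cotangentLift (κ.symm p.1) (φ.symm p.2) ∈ φ.source := by
      refine hcont.continuousAt.eventually_mem ((isOpen_extChartAt_source m).mem_nhds ?_)
      simp only [hκ1, hφm, cotangentLift_one]
      exact hm
    filter_upwards [hc.eventually hAdiff, hc.eventually hsrc] with s hs1 hs2 v
    obtain ⟨w, rfl⟩ := (chartDeriv_bijective hm).2 v
    have h1 : fderiv ℝ A (s, φ m) (0, chartDeriv (cotangentModel E) m m w) =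
        fderiv ℝ (fun y => A (s, y)) (φ m) (chartDeriv (cotangentModel E) m m w) := by
      have h2 := hs1.hasFDerivAt.comp (φ m) (hasFDerivAt_prodMk_right s (φ m))
      exact congrArg (fun L => L (chartDeriv (cotangentModel E) m m w)) h2.fderiv.symm
    simp only [hφm] at hs2
    have h2 := fderiv_writtenInCharts (f := cotangentLift (κ.symm s)) hm hs2
      ((contMDiff_cotangentLift EG (κ.symm s)).mdifferentiable (by simp) m) w
    have h3 := liouvilleForm_cotangentLift EG (κ.symm s) m w
    rw [liouvilleForm_eq_chart hs2, liouvilleForm_eq_chart hm, ← h2] at h3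
    rw [h1]
    simpa only [hA, hφm] using h3
  have hgen : ∀ y ∈ φ.target, DifferentiableAt ℝ A (κ 1, y) →
      fderiv ℝ A (κ 1, y) (chartDeriv 𝓘(ℝ, EG) (1 : G) 1 ξ, 0) =
        chartDeriv (cotangentModel E) m (φ.symm y) (cotangentGenerator EG G (φ.symm y) ξ) := by
    intro y hy hd
    have h1 := congrArg (fun L => L (chartDeriv 𝓘(ℝ, EG) (1 : G) 1 ξ))
      (HasFDerivAt.comp (g := A) (f := fun s => (s, y)) (κ 1) hd.hasFDerivAt
        (hasFDerivAt_prodMk_left (κ 1) y)).fderiv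
    have h2 := fderiv_writtenInCharts (I' := cotangentModel E)
      (f := fun g : G => cotangentLift g (φ.symm y)) (x₁ := m) hs
      (by simpa only [cotangentLift_one] using φ.map_target hy)
      ((contMDiff_orbitMap_cotangent (EG := EG) (φ.symm y)).mdifferentiable (by simp) 1) ξ
    refine (h1.symm.trans h2).trans ?_
    exact chartDeriv_congr (I₁ := cotangentModel E) m (cotangentLift_one (φ.symm y)) _
  have key := symplecticModel_generator hAsmooth (hA0 _ (φ.map_source hm))
    (htarget.mono fun y hy => hA0 y hy) hpres (chartDeriv 𝓘(ℝ, EG) (1 : G) 1 ξ)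
    (chartDeriv (cotangentModel E) m m u)
  rw [hgen _ (φ.map_source hm) hAdiff.self_of_nhds] at key
  -- The contraction of the generator with the Liouville form is the momentum function.
  have hJ : (fun y => y.2 (fderiv ℝ A (κ 1, y) (chartDeriv 𝓘(ℝ, EG) (1 : G) 1 ξ, 0)).1)
      =ᶠ[𝓝 (φ m)] fun y => momentum ξ (φ.symm y) := by
    have hc : ContinuousAt (fun y : E × (E →L[ℝ] ℝ) => (κ 1, y)) (φ m) := by fun_prop
    filter_upwards [htarget, hc.eventually hAdiff] with y hy hd
    rw [hgen y hy hd, ← liouvilleForm_cotangentGenerator,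
      liouvilleForm_eq_chart (φ.map_target hy), ← hφ, φ.right_inv hy]
  rw [hJ.fderiv_eq] at key
  rw [mvfderiv_eq_fderiv_chart hm ((contMDiff_momentum ξ).mdifferentiable (by simp) m),
    canonicalForm_eq_chart hm]
  rw [hφm] at key
  exact key

end LiftedAction

/-! ### Free actions have injective infinitesimal generators -/

section Free

variable {E : Type*} [NormedAddCommGroup E] [NormedSpace ℝ E]
  {Q : Type*} [TopologicalSpace Q] [ChartedSpace E Q] [IsManifold 𝓘(ℝ, E) ∞ Q]
  {EG : Type*} [NormedAddCommGroup EG] [NormedSpace ℝ EG] [FiniteDimensional ℝ EG]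
  {G : Type*} [TopologicalSpace G] [ChartedSpace EG G] [Group G] [LieGroup 𝓘(ℝ, EG) ∞ G]
  [MulAction G Q] [ContMDiffSMul 𝓘(ℝ, EG) 𝓘(ℝ, E) ∞ G Q]

/-- Differentiate (a g) q = a (g q) at g = 1. If the generator vanishes at q, the orbit map is thus
stationary along the whole left-invariant field. -/
theorem mfderiv_orbitMap_mulInvariantVectorField (q : Q) (a : G)
    (ξ : GroupLieAlgebra 𝓘(ℝ, EG) G) :
    (mfderiv 𝓘(ℝ, EG) 𝓘(ℝ, E) (fun g : G => g • q) a (mulInvariantVectorField ξ a) : E) =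
      (mfderiv 𝓘(ℝ, E) 𝓘(ℝ, E) (fun x : Q => a • x) ((1 : G) • q) : E →L[ℝ] E)
        (infinitesimalGenerator EG G q ξ) := by
  have hG : ∀ g : G, ContMDiff 𝓘(ℝ, E) 𝓘(ℝ, E) ∞ (fun x : Q => g • x) := fun g =>
    ContMDiffSMul.contMDiff_const_smul (I := 𝓘(ℝ, EG)) (n := ∞) g
  have ho : ∀ g : G, MDifferentiableAt 𝓘(ℝ, EG) 𝓘(ℝ, E) (fun g : G => g • q) g := fun g =>
    (contMDiff_orbitMap (EG := EG) q).mdifferentiable (by simp) g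
  have hm : MDifferentiableAt 𝓘(ℝ, EG) 𝓘(ℝ, EG) (fun g : G => a * g) 1 :=
    (contMDiff_mul_left (I := 𝓘(ℝ, EG)) (n := ∞) (a := a)).mdifferentiable (by simp) 1
  have h1 := ((ho (a * 1)).hasMFDerivAt.comp (1 : G) hm.hasMFDerivAt).mfderiv
  have h2 := ((mdifferentiableAt_translation hG a ((1 : G) • q)).hasMFDerivAt.comp (1 : G)
    (ho 1).hasMFDerivAt).mfderiv
  have h3 : (fun g : G => g • q) ∘ (fun g : G => a * g) =
      (fun x : Q => a • x) ∘ fun g : G => g • q := by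
    funext g
    exact mul_smul a g q
  rw [h3] at h1
  have h4 := congrArg (fun L => L ξ) (h1.symm.trans h2)
  have h5 : ∀ b : G, b = a → ∀ v : EG,
      (mfderiv 𝓘(ℝ, EG) 𝓘(ℝ, E) (fun g : G => g • q) b : EG →L[ℝ] E) v =
        (mfderiv 𝓘(ℝ, EG) 𝓘(ℝ, E) (fun g : G => g • q) a : EG →L[ℝ] E) v := fun b h v => by rw [h]
  exact (h5 _ (mul_one a) _).symm.trans h4

/-- Let γ be a local integral curve through 1 of the left-invariant field of ξ. If ξ_Q(q) = 0 then
γ(t) q is constant, so γ(t) fixes q and freeness gives γ(t) = 1 for small t. Hence ξ = γ'(0) = 0.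
Only a local curve is needed, not the exponential map. -/
theorem infinitesimalGenerator_injective (hfree : ∀ (g : G) (q : Q), g • q = q → g = 1) (q : Q) :
    Function.Injective (infinitesimalGenerator (E := E) EG G q) := by
  rw [injective_iff_map_eq_zero]
  intro ξ hξ
  have : IsManifold 𝓘(ℝ, E) 1 Q := isManifold_one_of_infty
  have : IsManifold 𝓘(ℝ, EG) 1 G := isManifold_one_of_infty (I := 𝓘(ℝ, EG))
  have : CompleteSpace EG := FiniteDimensional.complete ℝ EG
  have hv : ContMDiffAt 𝓘(ℝ, EG) 𝓘(ℝ, EG).tangent 1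
      (fun g : G => (⟨g, mulInvariantVectorField ξ g⟩ : TangentBundle 𝓘(ℝ, EG) G)) 1 :=
    (contMDiff_mulInvariantVectorField (I := 𝓘(ℝ, EG)) ξ 1).of_le
      (by rw [minSmoothness_of_isRCLikeNormedField]; norm_num)
  obtain ⟨γ, hγ0, hγ⟩ := exists_isMIntegralCurveAt_of_contMDiffAt_boundaryless (0 : ℝ) hv
  have hcont : ContinuousAt γ 0 := hγ.self_of_nhds.continuousAt
  have hsrc : ∀ᶠ t in 𝓝 (0 : ℝ), γ t • q ∈ (extChartAt 𝓘(ℝ, E) q).source := by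
    have h1 : ContinuousAt (fun t => γ t • q) 0 :=
      ((contMDiff_orbitMap (E := E) (EG := EG) q).continuous.continuousAt).comp hcont
    refine h1.eventually_mem ((isOpen_extChartAt_source q).mem_nhds ?_)
    simp only [hγ0, one_smul]
    exact mem_extChartAt_source _
  have hderiv : ∀ᶠ t in 𝓝 (0 : ℝ),
      HasDerivAt (fun t => extChartAt 𝓘(ℝ, E) q (γ t • q)) 0 t := by
    filter_upwards [hγ, hsrc] with t ht1 ht2
    rw [extChartAt_source] at ht2
    have h1 := (((contMDiff_orbitMap (E := E) (EG := EG) q).mdifferentiable (by simp)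
      (γ t)).hasMFDerivAt.comp t ht1)
    have h2 := ((mdifferentiableAt_extChartAt (I := 𝓘(ℝ, E)) ht2).hasMFDerivAt.comp t h1)
    have h4 : (mfderiv 𝓘(ℝ, EG) 𝓘(ℝ, E) (fun g : G => g • q) (γ t) : EG →L[ℝ] E)
        (mulInvariantVectorField ξ (γ t) : EG) = 0 :=
      (mfderiv_orbitMap_mulInvariantVectorField (E := E) q (γ t) ξ).trans
        ((congrArg (mfderiv 𝓘(ℝ, E) 𝓘(ℝ, E) (fun x : Q => γ t • x) ((1 : G) • q) :
          E →L[ℝ] E) hξ).trans (map_zero _))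
    have h5 : ∀ s : ℝ, (mfderiv 𝓘(ℝ, E) 𝓘(ℝ, E) (extChartAt 𝓘(ℝ, E) q) (γ t • q) : E →L[ℝ] E)
        ((mfderiv 𝓘(ℝ, EG) 𝓘(ℝ, E) (fun g : G => g • q) (γ t) : EG →L[ℝ] E)
          (s • (mulInvariantVectorField ξ (γ t) : EG))) = 0 := fun s => by
      rw [map_smul, map_smul, h4, map_zero, smul_zero]
    have h3 := (hasMFDerivAt_iff_hasFDerivAt.1 h2).congr_fderiv
      (g' := (0 : ℝ →L[ℝ] E)) (ContinuousLinearMap.ext fun s => h5 s)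
    exact h3.hasDerivAt
  -- The coordinate curve has zero derivative on an interval, hence is constant there; injectivity
  -- of the chart returns the statement to Q.
  have hconst : ∀ᶠ t in 𝓝 (0 : ℝ), γ t = 1 := by
    obtain ⟨ε, hε, hball⟩ := Metric.eventually_nhds_iff_ball.1 (hderiv.and hsrc)
    refine Metric.eventually_nhds_iff_ball.2 ⟨ε, hε, fun t ht => ?_⟩
    have h0 := Metric.mem_ball_self (x := (0 : ℝ)) hε
    have h1 := Metric.isOpen_ball.is_const_of_deriv_eq_zero
      (convex_ball (0 : ℝ) ε).isPreconnected
      (fun s hs => (hball s hs).1.differentiableAt.differentiableWithinAt)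
      (fun s hs => (hball s hs).1.deriv) ht h0
    have h2 := (extChartAt 𝓘(ℝ, E) q).injOn (hball t ht).2 (hball 0 h0).2 h1
    rw [hγ0, one_smul] at h2
    exact hfree _ q h2
  have h1 := hγ.self_of_nhds
  have h2 : HasMFDerivAt 𝓘(ℝ, ℝ) 𝓘(ℝ, EG) (fun _ : ℝ => (1 : G)) 0
      (0 : TangentSpace 𝓘(ℝ, ℝ) (0 : ℝ) →L[ℝ] TangentSpace 𝓘(ℝ, EG) (1 : G)) :=
    hasMFDerivAt_const _ _
  have h3 := h2.congr_of_eventuallyEq hconst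
  have h4 : (ContinuousLinearMap.smulRight (1 : ℝ →L[ℝ] ℝ) (mulInvariantVectorField ξ (γ 0) : EG) :
    ℝ →L[ℝ] EG) = 0 := hasMFDerivAt_unique h1 h3
  have h5 : (mulInvariantVectorField ξ (γ 0) : EG) = 0 := by
    have h := congrArg (fun L : ℝ →L[ℝ] EG => L 1) h4
    exact (one_smul ℝ (mulInvariantVectorField ξ (γ 0) : EG)).symm.trans h
  rw [hγ0] at h5
  have h6 : (fun x : G => 1 * x) = id := by funext x; simp
  have h7 : (mulInvariantVectorField ξ (1 : G) : EG) = ξ := by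
    change (mfderiv 𝓘(ℝ, EG) 𝓘(ℝ, EG) (fun x : G => 1 * x) (1 : G) : EG →L[ℝ] EG) ξ = ξ
    rw [h6, mfderiv_id]
    rfl
  exact h7.symm.trans h5

end Free

/-! ### The coframe of a vertical complement -/

section Coframe

variable {E : Type*} [NormedAddCommGroup E] [NormedSpace ℝ E]
  {Q : Type*} [TopologicalSpace Q] [ChartedSpace E Q] [IsManifold 𝓘(ℝ, E) ∞ Q]
  {EG : Type*} [NormedAddCommGroup EG] [NormedSpace ℝ EG]
  {G : Type*} [TopologicalSpace G] [ChartedSpace EG G] [Group G] [LieGroup 𝓘(ℝ, EG) ∞ G]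
  [MulAction G Q] [ContMDiffSMul 𝓘(ℝ, EG) 𝓘(ℝ, E) ∞ G Q]
  {D W : (q : Q) → Submodule ℝ (TangentSpace 𝓘(ℝ, E) q)} {k : ℕ}
  {ξ : Fin k → GroupLieAlgebra 𝓘(ℝ, EG) G}
  {β : (q : Q) → Fin k → TangentSpace 𝓘(ℝ, E) q →L[ℝ] ℝ}

/-- `β` is the coframe of `W` that is dual to the frame of generators of `ξ` and vanishes
on `D`. -/
structure IsDualCoframe (D : (q : Q) → Submodule ℝ (TangentSpace 𝓘(ℝ, E) q))
    (ξ : Fin k → GroupLieAlgebra 𝓘(ℝ, EG) G)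
    (β : (q : Q) → Fin k → TangentSpace 𝓘(ℝ, E) q →L[ℝ] ℝ) : Prop where
  apply_generator : ∀ q i j, β q i (infinitesimalGenerator EG G q (ξ j)) = if i = j then 1 else 0
  apply_of_mem : ∀ q i, ∀ v ∈ D q, β q i v = 0

/-- Pointwise, β_i is the i-th coordinate of the projection onto W along D. Smoothness is a separate
matter, settled by `IsDualCoframe.isSmooth`. -/
theorem exists_isDualCoframe [FiniteDimensional ℝ E] (hcompl : ∀ q, IsCompl (D q) (W q))
    (hξ : ∀ q : Q, LinearIndependent ℝ fun i => infinitesimalGenerator (E := E) EG G q (ξ i))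
    (hW : ∀ q : Q, W q = Submodule.span ℝ
      (Set.range fun i => infinitesimalGenerator (E := E) EG G q (ξ i))) :
    ∃ β : (q : Q) → Fin k → TangentSpace 𝓘(ℝ, E) q →L[ℝ] ℝ, IsDualCoframe D ξ β := by
  have key : ∀ q : Q, ∃ b : Fin k → TangentSpace 𝓘(ℝ, E) q →L[ℝ] ℝ,
      (∀ i j, b i (infinitesimalGenerator EG G q (ξ j)) = if i = j then 1 else 0) ∧
      ∀ i, ∀ v ∈ D q, b i v = 0 := by
    intro q
    have : FiniteDimensional ℝ (TangentSpace 𝓘(ℝ, E) q) :=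
      inferInstanceAs (FiniteDimensional ℝ E)
    have : T2Space (TangentSpace 𝓘(ℝ, E) q) := inferInstanceAs (T2Space E)
    have hc := (hcompl q).symm
    rw [hW q] at hc
    refine ⟨fun i => ⟨((Module.Basis.span (hξ q)).coord i).comp
      (Submodule.projectionOnto _ _ hc),
      LinearMap.continuous_of_finiteDimensional _⟩, fun i j => ?_, fun i v hv => ?_⟩
    · have hmem := Submodule.subset_span (R := ℝ) (Set.mem_range_self (f := fun i =>
        infinitesimalGenerator (E := E) EG G q (ξ i)) j)
      have h1 := Submodule.projectionOnto_apply_left hc ⟨_, hmem⟩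
      have h2 : (⟨_, hmem⟩ : Submodule.span ℝ (Set.range fun i =>
        infinitesimalGenerator (E := E) EG G q (ξ i))) = Module.Basis.span (hξ q) j :=
        (Module.Basis.span_apply (hξ q) j).symm
      refine (congrArg ((Module.Basis.span (hξ q)).coord i) (h1.trans h2)).trans ?_
      rw [Module.Basis.coord_apply, Module.Basis.repr_self, Finsupp.single_apply]
      simp only [eq_comm]
    · have h1 := (Submodule.projectionOnto_apply_eq_zero_iff hc).2 hv
      exact (congrArg ((Module.Basis.span (hξ q)).coord i) h1).trans (map_zero _)
  choose b hb1 hb2 using key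
  exact ⟨b, hb1, hb2⟩

/-- A family of 1-forms on `Q` is smooth if its expressions in charts are. -/
def IsSmoothCoframe (β : (q : Q) → Fin k → TangentSpace 𝓘(ℝ, E) q →L[ℝ] ℝ) : Prop :=
  ∀ (q₀ : Q) (i : Fin k), ∃ B : Q → E →L[ℝ] ℝ, ContMDiffAt 𝓘(ℝ, E) 𝓘(ℝ, E →L[ℝ] ℝ) ∞ B q₀ ∧
    ∀ᶠ q in 𝓝 q₀, ∀ v, β q i v = B q (chartDeriv 𝓘(ℝ, E) q₀ q v)

theorem contMDiffAt_chartDeriv_field {X : (q : Q) → TangentSpace 𝓘(ℝ, E) q} {q₀ : Q}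
    (hX : ContMDiffAt 𝓘(ℝ, E) (𝓘(ℝ, E).prod 𝓘(ℝ, E)) ∞
      (fun q => (⟨q, X q⟩ : TangentBundle 𝓘(ℝ, E) Q)) q₀) :
    ContMDiffAt 𝓘(ℝ, E) 𝓘(ℝ, E) ∞ (fun q => chartDeriv 𝓘(ℝ, E) q₀ q (X q)) q₀ := by
  have : IsManifold 𝓘(ℝ, E) 1 Q := isManifold_one_of_infty
  have h := (Bundle.contMDiffAt_totalSpace.1 hX).2
  refine h.congr_of_eventuallyEq ?_
  filter_upwards [eventually_mem_extChartAt_source (I := 𝓘(ℝ, E)) q₀] with q hq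
  rw [extChartAt_source] at hq
  have h1 := TangentBundle.continuousLinearMapAt_trivializationAt (I := 𝓘(ℝ, E)) hq
  have h2 : chartDeriv 𝓘(ℝ, E) q₀ q =
    (trivializationAt E (TangentSpace 𝓘(ℝ, E)) q₀).continuousLinearMapAt ℝ q := h1.symm
  rw [h2]
  exact Bundle.Trivialization.continuousLinearMapAt_apply_of_mem (R := ℝ)
    (trivializationAt E (TangentSpace 𝓘(ℝ, E)) q₀) hq _

/-- The linear combinations of a finite family of vectors. -/
def combination {F : Type*} [NormedAddCommGroup F] [NormedSpace ℝ F] {ι : Type*} [Fintype ι]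
    (v : ι → F) : (ι → ℝ) →L[ℝ] F :=
  ∑ i, (ContinuousLinearMap.proj i : (ι → ℝ) →L[ℝ] ℝ).smulRight (v i)

theorem combination_apply {F : Type*} [NormedAddCommGroup F] [NormedSpace ℝ F] {ι : Type*}
    [Fintype ι] (v : ι → F) (c : ι → ℝ) : combination v c = ∑ i, c i • v i := by
  simp [combination]

/-- A local smooth frame of D together with the generators is a smooth frame of TQ. In a chart it is
a smooth family of invertible operators Ψ, and inversion of operators is smooth. -/
theorem IsDualCoframe.isSmooth [FiniteDimensional ℝ E] (hβ : IsDualCoframe D ξ β)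
    (hD : IsSmoothDistribution D) (hcompl : ∀ q, IsCompl (D q) (W q))
    (hW : ∀ q : Q, W q = Submodule.span ℝ
      (Set.range fun i => infinitesimalGenerator (E := E) EG G q (ξ i))) :
    IsSmoothCoframe β := by
  intro q₀ i
  obtain ⟨U, hU, r, X, hX, hXD⟩ := hD q₀
  have : CompleteSpace E := FiniteDimensional.complete ℝ E
  -- the frame of `TQ` near `q₀`, in the chart
  set V : (q : Q) → Fin r ⊕ Fin k → TangentSpace 𝓘(ℝ, E) q :=
    fun q => Sum.elim (fun j => X j q) fun j => infinitesimalGenerator EG G q (ξ j) with hV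
  set Ψ : Q → (Fin r ⊕ Fin k → ℝ) →L[ℝ] E := fun q =>
    combination fun j => (chartDeriv 𝓘(ℝ, E) q₀ q (V q j) : E) with hΨ
  have hΨsmooth : ContMDiffAt 𝓘(ℝ, E) 𝓘(ℝ, (Fin r ⊕ Fin k → ℝ) →L[ℝ] E) ∞ Ψ q₀ := by
    have hVs : ∀ j, ContMDiffAt 𝓘(ℝ, E) 𝓘(ℝ, E) ∞
        (fun q => chartDeriv 𝓘(ℝ, E) q₀ q (V q j)) q₀ := by
      rintro (j | j)
      · exact contMDiffAt_chartDeriv_field ((hX j).contMDiffAt hU)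
      · exact contMDiffAt_chartDeriv_infinitesimalGenerator (ξ j) q₀
    have h1 : ∀ j : Fin r ⊕ Fin k, ContMDiff 𝓘(ℝ, E) 𝓘(ℝ, (Fin r ⊕ Fin k → ℝ) →L[ℝ] E) ∞
        (fun w : E => (ContinuousLinearMap.proj j :
          (Fin r ⊕ Fin k → ℝ) →L[ℝ] ℝ).smulRight w) := fun j =>
      (ContinuousLinearMap.smulRightL ℝ (Fin r ⊕ Fin k → ℝ) E
        (ContinuousLinearMap.proj j)).contMDiff
    simp only [hΨ, combination]
    exact ContMDiffAt.sum fun j _ => (h1 j).contMDiffAt.comp q₀ (hVs j)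
  have hcomb : ∀ q ∈ U, ∀ v : TangentSpace 𝓘(ℝ, E) q, ∃ c : Fin r ⊕ Fin k → ℝ,
      v = ∑ j, c j • V q j := by
    intro q hq v
    obtain ⟨y, z, hy, hz, hyz⟩ := Submodule.codisjoint_iff_exists_add_eq.1 (hcompl q).codisjoint v
    rw [← (hXD q hq).2] at hy
    rw [hW q] at hz
    obtain ⟨a, ha⟩ := (Submodule.mem_span_range_iff_exists_fun ℝ).1 hy
    obtain ⟨b, hb⟩ := (Submodule.mem_span_range_iff_exists_fun ℝ).1 hz
    refine ⟨Sum.elim a b, ?_⟩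
    rw [Fintype.sum_sum_type, ← hyz, ← ha, ← hb]
    rfl
  have hΨapply : ∀ q (c : Fin r ⊕ Fin k → ℝ),
      Ψ q c = chartDeriv 𝓘(ℝ, E) q₀ q (∑ j, c j • V q j) := fun q c => by
    rw [hΨ]
    simp only [combination_apply, map_sum, map_smul]
  have hβV : ∀ q ∈ U, ∀ (c : Fin r ⊕ Fin k → ℝ) (i : Fin k),
      β q i (∑ j, c j • V q j) = c (Sum.inr i) := by
    intro q hq c i
    have h1 : ∀ j, β q i (X j q) = 0 := fun j => hβ.apply_of_mem q i _ (by
      rw [← (hXD q hq).2]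
      exact Submodule.subset_span (Set.mem_range_self (f := fun j => X j q) j))
    simp [Fintype.sum_sum_type, hV, h1, hβ.apply_generator]
  have hUnhds : q₀ ∈ U := mem_of_mem_nhds hU
  have hbij : ∀ q ∈ U, q ∈ (extChartAt 𝓘(ℝ, E) q₀).source → Function.Bijective (Ψ q) := by
    intro q hq hs
    have hc := chartDeriv_bijective hs
    constructor
    · rw [injective_iff_map_eq_zero]
      intro c hc0
      rw [hΨapply] at hc0
      have h1 := hc.1 (hc0.trans (map_zero _).symm)
      have h2 : ∀ j, c (Sum.inr j) = 0 := fun j => by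
        rw [← hβV q hq c j, h1, map_zero]
      have h3 : ∑ j, c (Sum.inl j) • X j q = 0 := by
        have h4 : ∑ j, c j • V q j = ∑ j, c (Sum.inl j) • X j q +
          ∑ j, c (Sum.inr j) • infinitesimalGenerator EG G q (ξ j) := Fintype.sum_sum_type _
        rw [h4] at h1
        simpa [h2] using h1
      have h4 := Fintype.linearIndependent_iff.1 (hXD q hq).1 _ h3
      funext j
      rcases j with j | j
      · exact h4 j
      · exact h2 j
    · intro w
      obtain ⟨v, rfl⟩ := hc.2 w
      obtain ⟨c, hv⟩ := hcomb q hq v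
      exact ⟨c, by rw [hΨapply, ← hv]⟩
  have hinv : ∀ q ∈ U, q ∈ (extChartAt 𝓘(ℝ, E) q₀).source →
      ∃ e : (Fin r ⊕ Fin k → ℝ) ≃L[ℝ] E, (e : (Fin r ⊕ Fin k → ℝ) →L[ℝ] E) = Ψ q := by
    intro q hq hs
    refine ⟨ContinuousLinearEquiv.ofBijective (Ψ q)
      (LinearMap.ker_eq_bot.2 (hbij q hq hs).1) (LinearMap.range_eq_top.2 (hbij q hq hs).2), ?_⟩
    rfl
  -- β_i is the row of Ψ⁻¹ that belongs to the i-th generator. The values of the total function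
  -- `inverse` at noninvertible operators do not matter, since Ψ q is invertible for q near q₀.
  refine ⟨fun q => ((ContinuousLinearMap.proj (Sum.inr i)) :
    (Fin r ⊕ Fin k → ℝ) →L[ℝ] ℝ).comp (Ψ q).inverse, ?_, ?_⟩
  · have h1 : ContMDiffAt 𝓘(ℝ, E) 𝓘(ℝ, E →L[ℝ] (Fin r ⊕ Fin k → ℝ)) ∞
        (fun q => (Ψ q).inverse) q₀ := by
      obtain ⟨e, he⟩ := hinv q₀ hUnhds (mem_extChartAt_source _)
      have h2 : ContDiffAt ℝ ∞ ContinuousLinearMap.inverse (Ψ q₀) := by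
        rw [← he]
        exact contDiffAt_map_inverse e
      exact h2.contMDiffAt.comp q₀ hΨsmooth
    exact contMDiffAt_const.clm_comp h1
  · filter_upwards [hU, eventually_mem_extChartAt_source (I := 𝓘(ℝ, E)) q₀] with q hq hs v
    obtain ⟨c, rfl⟩ := hcomb q hq v
    obtain ⟨e, he⟩ := hinv q hq hs
    rw [hβV q hq, ← hΨapply, ContinuousLinearMap.comp_apply, ← he,
      ContinuousLinearMap.inverse_equiv]
    simp

end Coframe

/-! ### The retraction of `T^*Q` onto the annihilator of a vertical complement -/

section Retraction

variable {E : Type*} [NormedAddCommGroup E] [NormedSpace ℝ E]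
  {Q : Type*} [TopologicalSpace Q] [ChartedSpace E Q] [IsManifold 𝓘(ℝ, E) ∞ Q]
  {EG : Type*} [NormedAddCommGroup EG] [NormedSpace ℝ EG]
  {G : Type*} [TopologicalSpace G] [ChartedSpace EG G] [Group G] [LieGroup 𝓘(ℝ, EG) ∞ G]
  [MulAction G Q] [ContMDiffSMul 𝓘(ℝ, EG) 𝓘(ℝ, E) ∞ G Q]
  {D W : (q : Q) → Submodule ℝ (TangentSpace 𝓘(ℝ, E) q)} {k : ℕ}
  {ξ : Fin k → GroupLieAlgebra 𝓘(ℝ, EG) G}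
  {β : (q : Q) → Fin k → TangentSpace 𝓘(ℝ, E) q →L[ℝ] ℝ}

/-- The generators of `ξ` form a frame of the complement `W` of `D`, and `β` is the dual smooth
coframe. -/
structure IsVerticalFrame (D W : (q : Q) → Submodule ℝ (TangentSpace 𝓘(ℝ, E) q))
    (ξ : Fin k → GroupLieAlgebra 𝓘(ℝ, EG) G)
    (β : (q : Q) → Fin k → TangentSpace 𝓘(ℝ, E) q →L[ℝ] ℝ) : Prop where
  dual : IsDualCoframe D ξ β
  smooth : IsSmoothCoframe β
  span : ∀ q : Q, W q = Submodule.span ℝ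
    (Set.range fun i => infinitesimalGenerator (E := E) EG G q (ξ i))
  isCompl : ∀ q, IsCompl (D q) (W q)

/-- The pull-back to `T^*Q` of the `i`-th form of a coframe. -/
def liftedForm (β : (q : Q) → Fin k → TangentSpace 𝓘(ℝ, E) q →L[ℝ] ℝ) (i : Fin k)
    (m : CotangentBundle E Q) : TangentSpace (cotangentModel E) m →L[ℝ] ℝ :=
  (β m.proj i).comp (tangentProj m)

theorem isSmoothForm_liftedForm (hβ : IsSmoothCoframe β) (i : Fin k) :
    IsSmoothForm (cotangentModel E) (liftedForm β i) := by
  intro m₀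
  obtain ⟨B, hB, hβB⟩ := hβ m₀.proj i
  have hm₀ := mem_extChartAt_source (I := cotangentModel E) m₀
  set φ := extChartAt (cotangentModel E) m₀ with hφ
  have hsymm : ContMDiffAt 𝓘(ℝ, E × (E →L[ℝ] ℝ)) 𝓘(ℝ, E) ∞
      (fun y => (φ.symm y).proj) (φ m₀) :=
    ContMDiffAt.comp _ ((Bundle.contMDiff_proj _) _)
      ((contMDiffOn_extChartAt_symm m₀).contMDiffAt (eventually_mem_extChartAt_target hm₀))
  have hleft : (φ.symm (φ m₀)).proj = m₀.proj := congrArg _ (φ.left_inv hm₀)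
  have h1 : ContMDiffAt 𝓘(ℝ, E × (E →L[ℝ] ℝ)) 𝓘(ℝ, E →L[ℝ] ℝ) ∞
      (fun y => B (φ.symm y).proj) (φ m₀) :=
    ContMDiffAt.comp (g := B) _ (by rwa [hleft]) hsymm
  have h2 : ContDiffAt ℝ ∞ (fun y => (B (φ.symm y).proj).comp
      (ContinuousLinearMap.fst ℝ E (E →L[ℝ] ℝ))) (φ m₀) :=
    h1.contDiffAt.clm_comp contDiffAt_const
  refine h2.congr_of_eventuallyEq ?_
  have h3 : ∀ᶠ y in 𝓝 (φ m₀), ∀ v, β (φ.symm y).proj i v =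
      B (φ.symm y).proj (chartDeriv 𝓘(ℝ, E) m₀.proj (φ.symm y).proj v) := by
    refine hsymm.continuousAt.eventually
      (p := fun q => ∀ v, β q i v = B q (chartDeriv 𝓘(ℝ, E) m₀.proj q v)) ?_
    simpa only [hleft] using hβB
  filter_upwards [eventually_mem_extChartAt_target hm₀, h3] with y hy hyB
  refine ContinuousLinearMap.ext fun w => ?_
  have h4 := hyB (tangentProj (φ.symm y)
    (mfderiv 𝓘(ℝ, E × (E →L[ℝ] ℝ)) (cotangentModel E) φ.symm y w))
  rw [← chartDeriv_fst (φ.map_target hy), chartDeriv_mfderiv_symm hy] at h4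
  exact h4

/-- The fibrewise linear retraction `p ↦ p - ∑ p(ξ_Q) β` of `T^*Q`. -/
def coframeRetraction (ξ : Fin k → GroupLieAlgebra 𝓘(ℝ, EG) G)
    (β : (q : Q) → Fin k → TangentSpace 𝓘(ℝ, E) q →L[ℝ] ℝ) (m : CotangentBundle E Q) :
    CotangentBundle E Q :=
  ⟨m.proj, m.snd - ∑ i, momentum (ξ i) m • β m.proj i⟩

theorem coframeRetraction_snd_apply (m : CotangentBundle E Q) (v : TangentSpace 𝓘(ℝ, E) m.proj) :
    (coframeRetraction ξ β m).snd v = m.snd v - ∑ i, momentum (ξ i) m * β m.proj i v := by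
  have key : ∀ (p : E →L[ℝ] ℝ) (c : Fin k → ℝ) (b : Fin k → E →L[ℝ] ℝ) (v : E),
      (p - ∑ i, c i • b i) v = p v - ∑ i, c i * b i v := fun p c b v => by
    simp
  exact key m.snd _ (β m.proj) v

theorem coframeRetraction_eq_self {m : CotangentBundle E Q} (h : ∀ i, momentum (ξ i) m = 0) :
    coframeRetraction ξ β m = m := by
  simp [coframeRetraction, h]

/-- The retraction in a chart. -/
theorem exists_extChartAt_coframeRetraction (hβ : IsSmoothCoframe β) (m₀ : CotangentBundle E Q) :
    ∃ B : Fin k → Q → E →L[ℝ] ℝ, (∀ i, ContMDiffAt 𝓘(ℝ, E) 𝓘(ℝ, E →L[ℝ] ℝ) ∞ (B i) m₀.proj) ∧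
      ∀ᶠ m in 𝓝 m₀, extChartAt (cotangentModel E) m₀ (coframeRetraction ξ β m) =
        ((extChartAt (cotangentModel E) m₀ m).1, (extChartAt (cotangentModel E) m₀ m).2 -
          ∑ i, momentum (ξ i) m • B i m.proj) := by
  choose B hB hβB using fun i => hβ m₀.proj i
  refine ⟨B, hB, ?_⟩
  have hproj : ContinuousAt (fun m : CotangentBundle E Q => m.proj) m₀ :=
    (mdifferentiable_cotangent_proj m₀).continuousAt
  filter_upwards [hproj.eventually (Filter.eventually_all.2 hβB),
    eventually_mem_extChartAt_source (I := cotangentModel E) m₀] with m hm hs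
  have hs' : coframeRetraction ξ β m ∈ (extChartAt (cotangentModel E) m₀).source :=
    mem_cotangent_extChartAt_source.2 (mem_cotangent_extChartAt_source.1 hs)
  refine Prod.ext ?_ (ContinuousLinearMap.ext fun w => ?_)
  · simp only [cotangent_extChartAt_apply]
    rfl
  · obtain ⟨v, rfl⟩ := (chartDeriv_bijective (mem_cotangent_extChartAt_source.1 hs)).2 w
    refine (snd_apply_eq_chart hs' v).symm.trans ?_
    refine (coframeRetraction_snd_apply m v).trans ?_
    rw [snd_apply_eq_chart hs]
    simp [hm]

theorem contMDiff_coframeRetraction (hβ : IsSmoothCoframe β) :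
    ContMDiff (cotangentModel E) (cotangentModel E) ∞
      (coframeRetraction ξ β : CotangentBundle E Q → CotangentBundle E Q) := by
  intro m₀
  obtain ⟨B, hB, hr⟩ := exists_extChartAt_coframeRetraction (ξ := ξ) hβ m₀
  have h1 := (contMDiffAt_cotangent (f := fun m : CotangentBundle E Q => m)
    (x := m₀) (I' := cotangentModel E)).1 contMDiffAt_id
  refine contMDiffAt_cotangent.2 ⟨h1.1, ?_⟩
  have h2 : ContMDiffAt (cotangentModel E) 𝓘(ℝ, E →L[ℝ] ℝ) ∞
      (fun m : CotangentBundle E Q => (extChartAt (cotangentModel E) m₀ m).2 -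
        ∑ i, momentum (ξ i) m • B i m.proj) m₀ := by
    refine h1.2.sub (ContMDiffAt.sum fun i _ => ?_)
    exact (contMDiff_momentum (ξ i) m₀).smul (ContMDiffAt.comp m₀ (hB i) h1.1)
  refine h2.congr_of_eventuallyEq ?_
  filter_upwards [hr] with m hm
  have h3 := congrArg Prod.snd hm
  rw [cotangent_extChartAt_apply] at h3
  rw [cotangent_extChartAt_apply]
  exact h3

namespace IsVerticalFrame

/-- W is globally spanned by finitely many generators, so W° is cut out by finitely many global
smooth functions. -/
theorem mem_annihilator_iff (h : IsVerticalFrame D W ξ β) {m : CotangentBundle E Q} :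
    m ∈ annihilator W ↔ ∀ i, momentum (ξ i) m = 0 := by
  constructor
  · intro hm i
    refine hm _ ?_
    rw [h.span]
    exact Submodule.subset_span (Set.mem_range_self i)
  · intro hm v hv
    rw [h.span] at hv
    have h1 : Submodule.span ℝ (Set.range fun i => infinitesimalGenerator EG G m.proj (ξ i)) ≤
        LinearMap.ker (m.snd : TangentSpace 𝓘(ℝ, E) m.proj →ₗ[ℝ] ℝ) := by
      rw [Submodule.span_le]
      rintro _ ⟨i, rfl⟩
      exact hm i
    exact h1 hv

theorem coframeRetraction_mem (h : IsVerticalFrame D W ξ β) (m : CotangentBundle E Q) :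
    coframeRetraction ξ β m ∈ annihilator W := by
  rw [h.mem_annihilator_iff]
  intro i
  refine (coframeRetraction_snd_apply m _).trans ?_
  have h1 : ∀ j, β m.proj j (infinitesimalGenerator EG G m.proj (ξ i)) =
      if j = i then 1 else 0 := fun j => h.dual.apply_generator _ _ _
  change m.snd _ - ∑ j, momentum (ξ j) m *
    β m.proj j (infinitesimalGenerator EG G m.proj (ξ i)) = 0
  simp only [h1, mul_ite, mul_one, mul_zero, Finset.sum_ite_eq', Finset.mem_univ, if_true]
  exact sub_self _

/-- The retraction of `T^*Q` onto the annihilator of `W`. -/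
def retract (h : IsVerticalFrame D W ξ β) (m : CotangentBundle E Q) : annihilator W :=
  ⟨coframeRetraction ξ β m, h.coframeRetraction_mem m⟩

theorem retract_coe (h : IsVerticalFrame D W ξ β) (m : annihilator W) :
    h.retract (m : CotangentBundle E Q) = m :=
  Subtype.ext (coframeRetraction_eq_self (h.mem_annihilator_iff.1 m.2))

theorem continuous_retract (h : IsVerticalFrame D W ξ β) : Continuous h.retract :=
  (contMDiff_coframeRetraction h.smooth).continuous.subtype_mk _

/-- Locally f ∘ retract is an ambient extension composed with a smooth map. A function given only by
local extensions thereby acquires one global extension, without partitions of unity. -/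
theorem contMDiff_comp_retract (h : IsVerticalFrame D W ξ β) {f : annihilator W → ℝ}
    (hf : f ∈ smoothFunctions (cotangentModel E) (annihilator W)) :
    ContMDiff (cotangentModel E) 𝓘(ℝ, ℝ) ∞ (fun m => f (h.retract m)) := by
  intro m₀
  obtain ⟨F, hF, hFf⟩ := hf (h.retract m₀)
  refine ((hF.comp (contMDiff_coframeRetraction (ξ := ξ) h.smooth)) m₀).congr_of_eventuallyEq ?_
  filter_upwards [h.continuous_retract.continuousAt.eventually hFf] with m hm
  exact hm.symm

theorem isExtensionNear_comp_retract (h : IsVerticalFrame D W ξ β) {f : annihilator W → ℝ}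
    (hf : f ∈ smoothFunctions (cotangentModel E) (annihilator W)) (m : annihilator W) :
    IsExtensionNear (cotangentModel E) f m (fun x => f (h.retract x)) :=
  ⟨h.contMDiff_comp_retract hf, Filter.Eventually.of_forall fun s => congrArg f (h.retract_coe s)⟩

/-- For the nontrivial direction, let F vanish on W° near m. Then F composed with the retraction
vanishes near m, and at m ∈ W° the derivative of the retraction fixes every v with dJ_i(v) = 0.
Hence dF(v) = 0. -/
theorem mem_submanifoldTangent_iff (h : IsVerticalFrame D W ξ β) {m : annihilator W}
    {v : TangentSpace (cotangentModel E) (m : CotangentBundle E Q)} :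
    v ∈ submanifoldTangent (cotangentModel E) (annihilator W) m ↔
      ∀ i, mvfderiv (cotangentModel E) (momentum (ξ i)) (m : CotangentBundle E Q) v = 0 := by
  constructor
  · intro hv i
    exact hv _ ⟨contMDiff_momentum (ξ i), Filter.Eventually.of_forall fun s =>
      h.mem_annihilator_iff.1 s.2 i⟩
  · rintro hv F ⟨hF, hF0⟩
    have hJ0 := h.mem_annihilator_iff.1 m.2
    obtain ⟨m, hmW⟩ := m
    simp only at hv hJ0 ⊢
    have hm := mem_extChartAt_source (I := cotangentModel E) m
    obtain ⟨B, hB, hr⟩ := exists_extChartAt_coframeRetraction (ξ := ξ) h.smooth m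
    have hd : ∀ i, mvfderiv (cotangentModel E) (momentum (ξ i)) m v = _ := fun i =>
      mvfderiv_eq_fderiv_chart hm ((contMDiff_momentum (ξ i)).mdifferentiable (by simp) m) v
    simp only [hv] at hd
    rw [mvfderiv_eq_fderiv_chart hm (hF.mdifferentiable (by simp) m)]
    set φ := extChartAt (cotangentModel E) m with hφ
    set w := chartDeriv (cotangentModel E) m m v with hw
    have hφm : φ.symm (φ m) = m := φ.left_inv hm
    have hsymm : ContMDiffAt 𝓘(ℝ, E × (E →L[ℝ] ℝ)) (cotangentModel E) ∞ φ.symm (φ m) :=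
      (contMDiffOn_extChartAt_symm m).contMDiffAt (eventually_mem_extChartAt_target hm)
    have hJs : ∀ i, HasFDerivAt (fun y => momentum (ξ i) (φ.symm y))
        (fderiv ℝ (fun y => momentum (ξ i) (φ.symm y)) (φ m)) (φ m) := fun i =>
      (((contMDiff_momentum (ξ i)).contMDiffAt.comp (φ m) hsymm).contDiffAt.differentiableAt
        (by simp)).hasFDerivAt
    have hBs : ∀ i, HasFDerivAt (fun y => B i (φ.symm y).proj)
        (fderiv ℝ (fun y => B i (φ.symm y).proj) (φ m)) (φ m) := fun i => by
      have h1 : ContMDiffAt 𝓘(ℝ, E × (E →L[ℝ] ℝ)) 𝓘(ℝ, E →L[ℝ] ℝ) ∞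
          (fun y => B i (φ.symm y).proj) (φ m) :=
        ContMDiffAt.comp (g := B i) (φ m) (by rw [hφm]; exact hB i)
          (((Bundle.contMDiff_proj _) _).comp (φ m) hsymm)
      exact (h1.contDiffAt.differentiableAt (by simp)).hasFDerivAt
    -- Derivative of the retraction in the chart. The terms J_i · dB_i vanish because m lies in W°,
    -- the terms dJ_i(v) B_i by the hypothesis on v.
    have hR := (hasFDerivAt_fst (𝕜 := ℝ) (p := φ m)).prodMk
      ((hasFDerivAt_snd (𝕜 := ℝ) (p := φ m)).sub
      (HasFDerivAt.fun_sum (u := Finset.univ) fun i _ => (hJs i).smul (hBs i)))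
    have hRm : ((φ m).1, (φ m).2 - ∑ i, momentum (ξ i) (φ.symm (φ m)) • B i (φ.symm (φ m)).proj) =
        φ m := by
      simp [hφm, hJ0]
    have hFs : HasFDerivAt (fun y => F (φ.symm y)) (fderiv ℝ (fun y => F (φ.symm y)) (φ m))
        ((φ m).1, (φ m).2 - ∑ i, momentum (ξ i) (φ.symm (φ m)) • B i (φ.symm (φ m)).proj) := by
      rw [hRm]
      exact ((hF.contMDiffAt.comp (φ m) hsymm).contDiffAt.differentiableAt (by simp)).hasFDerivAt
    have hcomp := HasFDerivAt.comp (φ m) hFs hR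
    have hzero : (fun y : E × (E →L[ℝ] ℝ) => F (φ.symm (y.1, y.2 -
        ∑ i, momentum (ξ i) (φ.symm y) • B i (φ.symm y).proj))) =ᶠ[𝓝 (φ m)] fun _ => 0 := by
      have hc : Filter.Tendsto φ.symm (𝓝 (φ m)) (𝓝 m) := by
        have := hsymm.continuousAt.tendsto
        rwa [hφm] at this
      have hret : ∀ᶠ x in 𝓝 m, F (h.retract x) = 0 := by
        refine (h.continuous_retract.tendsto m).eventually
          (p := fun s : annihilator W => F s = 0) ?_
        rwa [show h.retract m = ⟨m, hmW⟩ from h.retract_coe ⟨m, hmW⟩]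
      filter_upwards [hc.eventually hr, hc.eventually hret,
        eventually_mem_extChartAt_target hm] with y hy1 hy2 hy3
      rw [φ.right_inv hy3] at hy1
      rw [← hy1, φ.left_inv]
      · exact hy2
      · exact mem_cotangent_extChartAt_source.2
          (mem_cotangent_extChartAt_source.1 (φ.map_target hy3))
    have hfin := congrArg (fun L => L w)
      (hcomp.unique ((hasFDerivAt_const (0 : ℝ) (φ m)).congr_of_eventuallyEq hzero))
    simpa [hφm, hJ0, ← hd] using hfin

end IsVerticalFrame

/-! ### Invariance of the annihilator -/

theorem cotangentLift_mem_annihilator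
    (EG : Type*) [NormedAddCommGroup EG] [NormedSpace ℝ EG]
    {G : Type*} [TopologicalSpace G] [ChartedSpace EG G] [Group G] [LieGroup 𝓘(ℝ, EG) ∞ G]
    [MulAction G Q] [ContMDiffSMul 𝓘(ℝ, EG) 𝓘(ℝ, E) ∞ G Q]
    (hWinv : IsInvariantDistribution G W) (g : G) {m : CotangentBundle E Q}
    (hm : m ∈ annihilator W) : cotangentLift g m ∈ annihilator W := by
  have hG : ∀ g : G, ContMDiff 𝓘(ℝ, E) 𝓘(ℝ, E) ∞ (fun x : Q => g • x) := fun g =>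
    ContMDiffSMul.contMDiff_const_smul (I := 𝓘(ℝ, EG)) (n := ∞) g
  intro v hv
  have hv' : v ∈ W (g • m.proj) := hv
  rw [← hWinv g m.proj] at hv'
  obtain ⟨w, hw, rfl⟩ := hv'
  exact (cotangentLift_snd_apply_mfderiv hG g m w).trans (hm w hw)

/-- Functions constant along the orbit of `m` near `m` are killed by the generators at `m`. -/
theorem mvfderiv_cotangentGenerator_eq_zero {F : CotangentBundle E Q → ℝ} {m : CotangentBundle E Q}
    (hF : MDifferentiable (cotangentModel E) 𝓘(ℝ, ℝ) F) {c : ℝ}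
    (h : ∀ᶠ g in 𝓝 (1 : G), F (cotangentLift g m) = c) (η : GroupLieAlgebra 𝓘(ℝ, EG) G) :
    mvfderiv (cotangentModel E) F m (cotangentGenerator EG G m η) = 0 := by
  have h1 := ((hF (cotangentLift (1 : G) m)).hasMFDerivAt.comp (1 : G)
    ((contMDiff_orbitMap_cotangent (EG := EG) m).mdifferentiable (by simp) (1 : G)).hasMFDerivAt)
  have h2 : HasMFDerivAt 𝓘(ℝ, EG) 𝓘(ℝ, ℝ) (fun _ : G => c) 1
      (0 : TangentSpace 𝓘(ℝ, EG) (1 : G) →L[ℝ] TangentSpace 𝓘(ℝ, ℝ) c) := hasMFDerivAt_const _ _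
  have h3 := h2.congr_of_eventuallyEq h
  have h4 := congrArg (fun L : EG →L[ℝ] ℝ => L η) (hasMFDerivAt_unique h1 h3)
  have h5 : ∀ m' : CotangentBundle E Q, m' = m → ∀ v : E × (E →L[ℝ] ℝ),
      (mfderiv (cotangentModel E) 𝓘(ℝ, ℝ) F m' : E × (E →L[ℝ] ℝ) →L[ℝ] ℝ) v =
        (mfderiv (cotangentModel E) 𝓘(ℝ, ℝ) F m : E × (E →L[ℝ] ℝ) →L[ℝ] ℝ) v :=
    fun m' h v => by rw [h]
  exact (h5 _ (cotangentLift_one m) _).symm.trans h4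

/-- The orbit of m stays in W° because W is invariant. Applied to the ξ_j, whose generators are the
Hamiltonian vectors of the J_j, this makes W° coisotropic. -/
theorem cotangentGenerator_mem_submanifoldTangent (hWinv : IsInvariantDistribution G W)
    (m : annihilator W) (η : GroupLieAlgebra 𝓘(ℝ, EG) G) :
    cotangentGenerator EG G (m : CotangentBundle E Q) η ∈
      submanifoldTangent (cotangentModel E) (annihilator W) m := by
  rintro F ⟨hF, hF0⟩
  refine mvfderiv_cotangentGenerator_eq_zero (c := 0) (hF.mdifferentiable (by simp)) ?_ η
  have hc : Continuous fun g : G =>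
      (⟨cotangentLift g m.1, cotangentLift_mem_annihilator EG hWinv g m.2⟩ : annihilator W) :=
    (contMDiff_orbitMap_cotangent (EG := EG) m.1).continuous.subtype_mk _
  refine (hc.tendsto 1).eventually (p := fun s : annihilator W => F s = 0) ?_
  have h1 : (⟨cotangentLift (1 : G) m.1, cotangentLift_mem_annihilator EG hWinv 1 m.2⟩ :
      annihilator W) = m := Subtype.ext (cotangentLift_one m.1)
  rwa [h1]

end Retraction

/-! ### Coisotropic linear algebra -/

section SymplecticLinearAlgebra

variable {V : Type*} [AddCommGroup V] [Module ℝ V] {k : ℕ}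

/-- A symplectic form `ω₀` with inverse `s`, and covectors `J i`, `b i` that are canonically
conjugate. -/
structure IsConjugateFrame (ω₀ : V →ₗ[ℝ] Module.Dual ℝ V) (s : Module.Dual ℝ V →ₗ[ℝ] V)
    (J b : Fin k → Module.Dual ℝ V) : Prop where
  form_sharp : ∀ α u, ω₀ (s α) u = α u
  skew : ∀ u v, ω₀ u v = -ω₀ v u
  nondegenerate : ∀ u, ω₀ u = 0 → u = 0
  J_J : ∀ i j, J i (s (J j)) = 0
  b_J : ∀ i j, b i (s (J j)) = if i = j then 1 else 0
  b_b : ∀ i j, b i (s (b j)) = 0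

/-- The projection to the common kernel of the `J i` along the span of the `s (b i)`. -/
def tangentProjection (s : Module.Dual ℝ V →ₗ[ℝ] V) (J b : Fin k → Module.Dual ℝ V) : V →ₗ[ℝ] V :=
  LinearMap.id + ∑ i, (J i).smulRight (s (b i))

/-- The projection to the common kernel of the `J i` and `b i` along the span of the `s (J i)` and
`s (b i)`. -/
def symplecticProjection (s : Module.Dual ℝ V →ₗ[ℝ] V) (J b : Fin k → Module.Dual ℝ V) :
    V →ₗ[ℝ] V :=
  tangentProjection s J b - ∑ i, (b i).smulRight (s (J i))

theorem tangentProjection_apply (s : Module.Dual ℝ V →ₗ[ℝ] V) (J b : Fin k → Module.Dual ℝ V)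
    (u : V) : tangentProjection s J b u = u + ∑ i, J i u • s (b i) := by
  simp [tangentProjection]

theorem symplecticProjection_apply (s : Module.Dual ℝ V →ₗ[ℝ] V) (J b : Fin k → Module.Dual ℝ V)
    (u : V) : symplecticProjection s J b u =
      u + ∑ i, J i u • s (b i) - ∑ i, b i u • s (J i) := by
  simp [symplecticProjection, tangentProjection_apply]

namespace IsConjugateFrame

variable {ω₀ : V →ₗ[ℝ] Module.Dual ℝ V} {s : Module.Dual ℝ V →ₗ[ℝ] V}
  {J b : Fin k → Module.Dual ℝ V}

theorem sharp_skew (h : IsConjugateFrame ω₀ s J b) (α β : Module.Dual ℝ V) :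
    α (s β) = -β (s α) := by
  rw [← h.form_sharp α, ← h.form_sharp β, h.skew]

theorem form_sharp_right (h : IsConjugateFrame ω₀ s J b) (u : V) (α : Module.Dual ℝ V) :
    ω₀ u (s α) = -α u := by
  rw [h.skew, h.form_sharp]

theorem J_b (h : IsConjugateFrame ω₀ s J b) (i j : Fin k) :
    J i (s (b j)) = if i = j then -1 else 0 := by
  rw [h.sharp_skew, h.b_J]
  by_cases hij : i = j
  · simp [hij]
  · simp [hij, Ne.symm hij]

theorem J_tangentProjection (h : IsConjugateFrame ω₀ s J b) (i : Fin k) (u : V) :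
    J i (tangentProjection s J b u) = 0 := by
  simp [tangentProjection_apply, h.J_b]

theorem J_symplecticProjection (h : IsConjugateFrame ω₀ s J b) (i : Fin k) (u : V) :
    J i (symplecticProjection s J b u) = 0 := by
  simp [symplecticProjection_apply, h.J_b, h.J_J]

theorem b_symplecticProjection (h : IsConjugateFrame ω₀ s J b) (i : Fin k) (u : V) :
    b i (symplecticProjection s J b u) = 0 := by
  simp [symplecticProjection_apply, h.b_J, h.b_b]

theorem tangentProjection_eq_self {u : V} (hu : ∀ i, J i u = 0) :
    tangentProjection s J b u = u := by
  simp [tangentProjection_apply, hu]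

theorem form_symplecticProjection_sharp (h : IsConjugateFrame ω₀ s J b) (α : Module.Dual ℝ V)
    (u : V) : ω₀ (symplecticProjection s J b (s α)) u =
      α u + ∑ i, J i (s α) * b i u - ∑ i, b i (s α) * J i u := by
  simp [symplecticProjection_apply, h.form_sharp, LinearMap.sum_apply]

/-- {J = b = 0} is a symplectic subspace: an arbitrary u differs from its symplectic projection by
combinations of s (J i) and s (b i), and these are ω₀-orthogonal to X. -/
theorem eq_zero_of_form_eq_zero (h : IsConjugateFrame ω₀ s J b) {X : V} (hJ : ∀ i, J i X = 0)
    (hb : ∀ i, b i X = 0)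
    (hX : ∀ Y, (∀ i, J i Y = 0) → (∀ i, b i Y = 0) → ω₀ X Y = 0) : X = 0 := by
  refine h.nondegenerate X (LinearMap.ext fun u => ?_)
  have h1 := hX (symplecticProjection s J b u) (fun i => h.J_symplecticProjection i u)
    fun i => h.b_symplecticProjection i u
  simpa [symplecticProjection_apply, h.form_sharp_right, hJ, hb] using h1

/-- The kernel of ω₀ on the coisotropic space {J = 0}. The s (J i) are orthogonal to that space, so
the symplectic part of v is still orthogonal to {J = b = 0} and vanishes. -/
theorem eq_sum_of_form_eq_zero (h : IsConjugateFrame ω₀ s J b) {v : V} (hJ : ∀ i, J i v = 0)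
    (hv : ∀ u, (∀ i, J i u = 0) → ω₀ v u = 0) : v = ∑ i, b i v • s (J i) := by
  have h1 : symplecticProjection s J b v = v - ∑ i, b i v • s (J i) := by
    simp [symplecticProjection_apply, hJ]
  rw [← sub_eq_zero, ← h1]
  refine h.eq_zero_of_form_eq_zero (fun i => h.J_symplecticProjection i v)
    (fun i => h.b_symplecticProjection i v) fun Y hY hY' => ?_
  rw [h1]
  simp [hv Y hY, LinearMap.sum_apply, h.form_sharp, hY]

variable {T : Submodule ℝ V}

/-- The bivector on `T` determined by the symplectic form on `{b = 0} ⊆ T`. -/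
def coisotropicSharp (h : IsConjugateFrame ω₀ s J b) (hT : ∀ v, v ∈ T ↔ ∀ i, J i v = 0) :
    Module.Dual ℝ T →ₗ[ℝ] T :=
  -- The form α on T is extended to V through the projection to T, turned into a vector by s, and
  -- projected to {J = b = 0}. The minus sign is the convention π^♯(α) = -X.
  -(((symplecticProjection s J b).codRestrict T fun u =>
    (hT _).2 fun i => h.J_symplecticProjection i u) ∘ₗ s ∘ₗ
    LinearMap.dualMap ((tangentProjection s J b).codRestrict T fun u =>
      (hT _).2 fun i => h.J_tangentProjection i u))

/-- Existence: the corrections made by the symplectic projection pair to zero with vectors on which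
J and b vanish. Uniqueness: the form is nondegenerate on those vectors. -/
theorem coisotropicSharp_eq_iff (h : IsConjugateFrame ω₀ s J b)
    (hT : ∀ v, v ∈ T ↔ ∀ i, J i v = 0) (α : Module.Dual ℝ T) (X : T) :
    ((∀ i, b i X = 0) ∧ ∀ Y : T, (∀ i, b i Y = 0) → ω₀ X Y = α Y) ↔
      h.coisotropicSharp hT α = -X := by
  set X₀ : T := -h.coisotropicSharp hT α with hX₀
  have hb₀ : ∀ i, b i X₀ = 0 := fun i => by
    simpa [hX₀, coisotropicSharp] using h.b_symplecticProjection i _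
  have hform : ∀ Y : T, (∀ i, b i Y = 0) → ω₀ X₀ Y = α Y := fun Y hY => by
    have hJY := (hT _).1 Y.2
    have h1 : (tangentProjection s J b).codRestrict T (fun u =>
      (hT _).2 fun i => h.J_tangentProjection i u) Y = Y :=
      Subtype.ext (tangentProjection_eq_self hJY)
    have h2 := h.form_symplecticProjection_sharp (LinearMap.dualMap
      ((tangentProjection s J b).codRestrict T fun u =>
        (hT _).2 fun i => h.J_tangentProjection i u) α) Y
    simp only [hY, hJY, mul_zero, Finset.sum_const_zero, add_zero, sub_zero,
      LinearMap.dualMap_apply, h1] at h2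
    simpa [hX₀, coisotropicSharp] using h2
  rw [← neg_eq_iff_eq_neg, ← hX₀]
  constructor
  · rintro ⟨h1, h2⟩
    have h3 : ((X₀ - X : T) : V) = 0 := by
      refine h.eq_zero_of_form_eq_zero ((hT _).1 (X₀ - X).2) (fun i => ?_) fun Y hJY hbY => ?_
      · simp [hb₀, h1]
      · have h4 := hform ⟨Y, (hT _).2 hJY⟩ hbY
        have h5 := h2 ⟨Y, (hT _).2 hJY⟩ hbY
        simp only at h4 h5
        simp [h4, h5]
    exact sub_eq_zero.1 (Subtype.ext h3)
  · rintro rfl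
    exact ⟨hb₀, hform⟩

/-- By uniqueness the particular extension used in the definition is irrelevant: any A extending the
covector gives the same vector. -/
theorem coisotropicSharp_restrict (h : IsConjugateFrame ω₀ s J b)
    (hT : ∀ v, v ∈ T ↔ ∀ i, J i v = 0) (A : Module.Dual ℝ V) :
    (h.coisotropicSharp hT (A ∘ₗ T.subtype) : V) = -symplecticProjection s J b (s A) := by
  have h1 := (h.coisotropicSharp_eq_iff hT (A ∘ₗ T.subtype)
    ⟨symplecticProjection s J b (s A), (hT _).2 fun i => h.J_symplecticProjection i _⟩).1
    ⟨fun i => h.b_symplecticProjection i _, fun Y hY => by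
      simp [h.form_symplecticProjection_sharp, hY, (hT _).1 Y.2]⟩
  rw [h1]
  rfl

/-- Evaluate ω₀ on the two solution vectors, once by the defining property of each. -/
theorem coisotropicSharp_skew (h : IsConjugateFrame ω₀ s J b)
    (hT : ∀ v, v ∈ T ↔ ∀ i, J i v = 0) (α β : Module.Dual ℝ T) :
    β (h.coisotropicSharp hT α) = -α (h.coisotropicSharp hT β) := by
  obtain ⟨hα, hα'⟩ := (h.coisotropicSharp_eq_iff hT α (-h.coisotropicSharp hT α)).2
    (neg_neg _).symm
  obtain ⟨hβ, hβ'⟩ := (h.coisotropicSharp_eq_iff hT β (-h.coisotropicSharp hT β)).2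
    (neg_neg _).symm
  have h1 := hα' _ hβ
  have h2 := hβ' _ hα
  rw [h.skew, h1] at h2
  simp only [map_neg, neg_neg] at h2
  linarith

theorem apply_coisotropicSharp_restrict (h : IsConjugateFrame ω₀ s J b)
    (hT : ∀ v, v ∈ T ↔ ∀ i, J i v = 0) (A B : Module.Dual ℝ V) :
    B (h.coisotropicSharp hT (A ∘ₗ T.subtype) : V) =
      -(B (s A) + ∑ i, J i (s A) * B (s (b i)) - ∑ i, b i (s A) * B (s (J i))) := by
  rw [h.coisotropicSharp_restrict]
  simp [symplecticProjection_apply]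

/-- In the general formula every correction term contains a factor J i (s A) = -A (s (J i)) or B (s
(J i)). Both vanish for basic covectors, and the ambient Poisson pairing remains. -/
theorem apply_coisotropicSharp_restrict_of_basic (h : IsConjugateFrame ω₀ s J b)
    (hT : ∀ v, v ∈ T ↔ ∀ i, J i v = 0) {A B : Module.Dual ℝ V} (hA : ∀ i, A (s (J i)) = 0)
    (hB : ∀ i, B (s (J i)) = 0) :
    B (h.coisotropicSharp hT (A ∘ₗ T.subtype) : V) = -B (s A) := by
  rw [h.apply_coisotropicSharp_restrict]
  simp [hB, h.sharp_skew (J _) A, hA]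

/-- For basic A the equation i_X ω₀ = A holds against all of T, whereas the definition only provides
it on {b = 0}. -/
theorem form_neg_coisotropicSharp_of_basic (h : IsConjugateFrame ω₀ s J b)
    (hT : ∀ v, v ∈ T ↔ ∀ i, J i v = 0) {A : Module.Dual ℝ V} (hA : ∀ i, A (s (J i)) = 0) (u : T) :
    ω₀ (-h.coisotropicSharp hT (A ∘ₗ T.subtype) : T) u = A u := by
  rw [Submodule.coe_neg, h.coisotropicSharp_restrict, neg_neg,
    h.form_symplecticProjection_sharp]
  simp [h.sharp_skew (J _) A, hA, (hT _).1 u.2]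

end IsConjugateFrame

end SymplecticLinearAlgebra

/-! ### Differentials of functions on a submanifold -/

section SubmanifoldDifferential

variable {E : Type*} [NormedAddCommGroup E] [NormedSpace ℝ E] {H : Type*} [TopologicalSpace H]
  {I : ModelWithCorners ℝ E H} {M : Type*} [TopologicalSpace M] [ChartedSpace H M]
  {S : Set M} {f g : S → ℝ}

theorem submanifoldDifferential_add (hf : f ∈ smoothFunctions I S) (hg : g ∈ smoothFunctions I S)
    (m : S) : submanifoldDifferential I (f + g) m =
      submanifoldDifferential I f m + submanifoldDifferential I g m := by
  obtain ⟨F, hF⟩ := hf m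
  obtain ⟨K, hK⟩ := hg m
  rw [submanifoldDifferential_eq I f m F hF, submanifoldDifferential_eq I g m K hK,
    submanifoldDifferential_eq I (f + g) m (F + K) ⟨hF.1.add hK.1, by
      filter_upwards [hF.2, hK.2] with s h1 h2
      simp [h1, h2]⟩]
  refine LinearMap.ext fun v => ?_
  exact congrArg (fun L => L v.1) (mvfderiv_add (hF.1.mdifferentiable (by simp) m)
    (hK.1.mdifferentiable (by simp) m))

theorem submanifoldDifferential_mul (hf : f ∈ smoothFunctions I S) (hg : g ∈ smoothFunctions I S)
    (m : S) : submanifoldDifferential I (f * g) m =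
      f m • submanifoldDifferential I g m + g m • submanifoldDifferential I f m := by
  obtain ⟨F, hF⟩ := hf m
  obtain ⟨K, hK⟩ := hg m
  rw [submanifoldDifferential_eq I f m F hF, submanifoldDifferential_eq I g m K hK,
    submanifoldDifferential_eq I (f * g) m (F * K) ⟨hF.1.mul hK.1, by
      filter_upwards [hF.2, hK.2] with s h1 h2
      simp [h1, h2]⟩]
  refine LinearMap.ext fun v => ?_
  rw [← hF.2.self_of_nhds, ← hK.2.self_of_nhds]
  exact congrArg (fun L => L v.1) (mvfderiv_mul (hF.1.mdifferentiable (by simp) (m : M))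
    (hK.1.mdifferentiable (by simp) (m : M)))

theorem submanifoldDifferential_smul (c : ℝ) (hf : f ∈ smoothFunctions I S) (m : S) :
    submanifoldDifferential I (c • f) m = c • submanifoldDifferential I f m := by
  have h1 : submanifoldDifferential I (algebraMap ℝ (S → ℝ) c) m = 0 := by
    rw [submanifoldDifferential_eq I (algebraMap ℝ (S → ℝ) c) m (fun _ => c) ⟨contMDiff_const,
      Filter.Eventually.of_forall fun s => rfl⟩]
    refine LinearMap.ext fun v => ?_
    exact congrArg (fun L => L v.1) (mvfderiv_const c)
  rw [Algebra.smul_def, submanifoldDifferential_mul (Subalgebra.algebraMap_mem _ c) hf, h1,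
    smul_zero, add_zero]
  rfl

end SubmanifoldDifferential

/-! ### Reduction of invariant bivector fields -/

section Reduction

variable {E : Type*} [NormedAddCommGroup E] [NormedSpace ℝ E]
  {Q : Type*} [TopologicalSpace Q] [ChartedSpace E Q] [IsManifold 𝓘(ℝ, E) ∞ Q]
  {EG : Type*} [NormedAddCommGroup EG] [NormedSpace ℝ EG]
  {G : Type*} [TopologicalSpace G] [ChartedSpace EG G] [Group G] [LieGroup 𝓘(ℝ, EG) ∞ G]
  [MulAction G Q] [ContMDiffSMul 𝓘(ℝ, EG) 𝓘(ℝ, E) ∞ G Q]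
  {W : (q : Q) → Submodule ℝ (TangentSpace 𝓘(ℝ, E) q)}

theorem orbitProj_eq_of_cotangentLift {m m' : annihilator W} {g : G}
    (h : (m' : CotangentBundle E Q) = cotangentLift g m.1) :
    orbitProj EG G W m' = orbitProj EG G W m :=
  Quotient.sound (s := orbitSetoid EG G W) ⟨g, h.symm⟩

theorem exists_cotangentLift_of_orbitRel {m m' : annihilator W}
    (h : (orbitSetoid EG G W).r m' m) :
    ∃ g : G, (m' : CotangentBundle E Q) = cotangentLift g m.1 := by
  obtain ⟨g, hg⟩ := h
  exact ⟨g, hg.symm⟩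

theorem reducedFunctions_ext {f g : reducedFunctions EG G W}
    (h : ∀ m : annihilator W, pullback f m = pullback g m) : f = g :=
  Subtype.ext (funext fun x => Quotient.inductionOn x h)

/-- As f ∘ ρ is invariant, an extension near g m composed with the lift of g is an extension near m.
This matches the ambient form of `IsInvariantBivector`. -/
theorem submanifoldDifferential_pullback_cotangentLift (hWinv : IsInvariantDistribution G W)
    (f : reducedFunctions EG G W) {m m' : annihilator W} {g : G}
    (h : (m' : CotangentBundle E Q) = cotangentLift g m.1) {F : CotangentBundle E Q → ℝ}
    (hF : IsExtensionNear (cotangentModel E) (pullback f) m' F) :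
    submanifoldDifferential (cotangentModel E) (pullback f) m =
      restrictDifferential (cotangentModel E) (fun x => F (cotangentLift g x)) m := by
  refine submanifoldDifferential_eq _ _ _ _ ⟨hF.1.comp (contMDiff_cotangentLift EG g), ?_⟩
  have hc : Continuous fun s : annihilator W =>
      (⟨cotangentLift g s.1, cotangentLift_mem_annihilator EG hWinv g s.2⟩ : annihilator W) :=
    ((contMDiff_cotangentLift EG g).continuous.comp continuous_subtype_val).subtype_mk _
  have h1 : (⟨cotangentLift g m.1, cotangentLift_mem_annihilator EG hWinv g m.2⟩ :
      annihilator W) = m' := Subtype.ext h.symm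
  have h2 : ∀ᶠ s : annihilator W in
      𝓝 ⟨cotangentLift g m.1, cotangentLift_mem_annihilator EG hWinv g m.2⟩,
      F s = pullback f s := by
    rw [h1]
    exact hF.2
  filter_upwards [(hc.tendsto m).eventually h2] with s hs
  refine hs.trans ?_
  exact congrArg (f : ReducedSpace EG G W → ℝ) (orbitProj_eq_of_cotangentLift (g := g) rfl)

/-- The value `π(d(f ∘ ρ), d(g ∘ ρ))` on `W°`. -/
def upstairsBracket (sharp : SharpMap (cotangentModel E) (annihilator W))
    (f g : reducedFunctions EG G W) (m : annihilator W) : ℝ :=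
  submanifoldDifferential (cotangentModel E) (pullback g) m
    (sharp m (submanifoldDifferential (cotangentModel E) (pullback f) m))

theorem upstairsBracket_invariant {sharp : SharpMap (cotangentModel E) (annihilator W)}
    (hWinv : IsInvariantDistribution G W) (hinv : IsInvariantBivector G sharp)
    (f g : reducedFunctions EG G W) {m m' : annihilator W} {a : G}
    (h : (m' : CotangentBundle E Q) = cotangentLift a m.1) :
    upstairsBracket sharp f g m' = upstairsBracket sharp f g m := by
  obtain ⟨F, hF⟩ := f.2 m'
  obtain ⟨K, hK⟩ := g.2 m'
  rw [upstairsBracket, upstairsBracket, submanifoldDifferential_pullback_cotangentLift hWinv f h hF,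
    submanifoldDifferential_pullback_cotangentLift hWinv g h hK,
    submanifoldDifferential_eq _ (pullback f) m' F hF,
    submanifoldDifferential_eq _ (pullback g) m' K hK]
  exact (hinv a m m' h F K hF.1 hK.1).symm

/-- The bracket upstairs is constant on orbits and smooth, so it descends; bilinearity and the
Leibniz rule come from those of the differential. -/
theorem exists_isReduction {sharp : SharpMap (cotangentModel E) (annihilator W)}
    (hWinv : IsInvariantDistribution G W) (hinv : IsInvariantBivector G sharp)
    (hbiv : IsBivectorField (cotangentModel E) sharp) :
    ∃ L : AlmostPoissonBracket (reducedFunctions EG G W), IsReduction sharp L := by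
  set br : reducedFunctions EG G W → reducedFunctions EG G W → reducedFunctions EG G W :=
    fun f g => ⟨Quotient.lift (upstairsBracket sharp f g) fun m' m h => by
      obtain ⟨a, ha⟩ := exists_cotangentLift_of_orbitRel h
      exact upstairsBracket_invariant hWinv hinv f g ha, hbiv.2 _ f.2 _ g.2⟩ with hbr
  have hpull : ∀ f g m, pullback (br f g) m = upstairsBracket sharp f g m := fun f g m => rfl
  have hadd : ∀ (f g : reducedFunctions EG G W) (m : annihilator W),
      submanifoldDifferential (cotangentModel E) (pullback (f + g)) m =
        submanifoldDifferential (cotangentModel E) (pullback f) m +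
          submanifoldDifferential (cotangentModel E) (pullback g) m := fun f g m =>
    submanifoldDifferential_add f.2 g.2 m
  have hmul : ∀ (f g : reducedFunctions EG G W) (m : annihilator W),
      submanifoldDifferential (cotangentModel E) (pullback (f * g)) m =
        pullback f m • submanifoldDifferential (cotangentModel E) (pullback g) m +
          pullback g m • submanifoldDifferential (cotangentModel E) (pullback f) m :=
    fun f g m => submanifoldDifferential_mul f.2 g.2 m
  have hsmul : ∀ (c : ℝ) (f : reducedFunctions EG G W) (m : annihilator W),
      submanifoldDifferential (cotangentModel E) (pullback (c • f)) m =
        c • submanifoldDifferential (cotangentModel E) (pullback f) m := fun c f m =>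
    submanifoldDifferential_smul c f.2 m
  have h1 : ∀ f f' g, br (f + f') g = br f g + br f' g := fun f f' g =>
    reducedFunctions_ext fun m => by
      change upstairsBracket sharp _ _ m = upstairsBracket sharp _ _ m + upstairsBracket sharp _ _ m
      simp [upstairsBracket, hadd]
  have h2 : ∀ (c : ℝ) f g, br (c • f) g = c • br f g := fun c f g =>
    reducedFunctions_ext fun m => by
      change upstairsBracket sharp _ _ m = c • upstairsBracket sharp _ _ m
      simp [upstairsBracket, hsmul]
  have h3 : ∀ f g g', br f (g + g') = br f g + br f g' := fun f g g' =>
    reducedFunctions_ext fun m => by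
      change upstairsBracket sharp _ _ m = upstairsBracket sharp _ _ m + upstairsBracket sharp _ _ m
      simp [upstairsBracket, hadd]
  have h4 : ∀ (c : ℝ) f g, br f (c • g) = c • br f g := fun c f g =>
    reducedFunctions_ext fun m => by
      change upstairsBracket sharp _ _ m = c • upstairsBracket sharp _ _ m
      simp [upstairsBracket, hsmul]
  refine ⟨⟨LinearMap.mk₂ ℝ br h1 h2 h3 h4, fun f g => reducedFunctions_ext fun m => ?_,
    fun f g h => reducedFunctions_ext fun m => ?_⟩, fun f g m => rfl⟩
  · exact hbiv.1 m _ _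
  · change upstairsBracket sharp _ _ m = pullback f m * upstairsBracket sharp _ _ m +
      upstairsBracket sharp _ _ m * pullback g m
    simp only [upstairsBracket, hmul, map_add, map_smul, smul_eq_mul]
    ring

theorem almostPoissonBracket_ext {L L' : AlmostPoissonBracket (reducedFunctions EG G W)}
    (h : ∀ f g (m : annihilator W), pullback (L.bracket f g) m = pullback (L'.bracket f g) m) :
    L = L' := by
  have h1 : L.bracket = L'.bracket :=
    LinearMap.ext fun f => LinearMap.ext fun g => reducedFunctions_ext (h f g)
  cases L
  cases L'
  simp only at h1
  subst h1
  rfl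

/-! ### Invariance of the bivector field -/

/-- Naturality: the lift of g preserves Ω_Q, T(W°) and C₀, so it carries the solution of the
defining problem at m to the one at g m. -/
theorem isInvariantBivector_of_isDefinedBy [FiniteDimensional ℝ E]
    (EG : Type*) [NormedAddCommGroup EG] [NormedSpace ℝ EG]
    {G : Type*} [TopologicalSpace G] [ChartedSpace EG G] [Group G] [LieGroup 𝓘(ℝ, EG) ∞ G]
    [MulAction G Q] [ContMDiffSMul 𝓘(ℝ, EG) 𝓘(ℝ, E) ∞ G Q]
    {D : (q : Q) → Submodule ℝ (TangentSpace 𝓘(ℝ, E) q)}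
    (hDinv : IsInvariantDistribution G D) (hWinv : IsInvariantDistribution G W)
    {sharp : SharpMap (cotangentModel E) (annihilator W)}
    (h : IsDefinedBy (cotangentModel E) (distributionC₀ W D) canonicalForm sharp) :
    IsInvariantBivector G sharp := by
  rintro g ⟨m, hm⟩ ⟨_, hm'⟩ rfl F K hF hK
  have hG : ∀ g : G, ContMDiff 𝓘(ℝ, E) 𝓘(ℝ, E) ∞ (fun x : Q => g • x) := fun g =>
    ContMDiffSMul.contMDiff_const_smul (I := 𝓘(ℝ, EG)) (n := ∞) g
  have hl : ∀ (a : G) x, MDifferentiableAt (cotangentModel E) (cotangentModel E)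
      (cotangentLift a : CotangentBundle E Q → CotangentBundle E Q) x := fun a =>
    (contMDiff_cotangentLift EG a).mdifferentiable (by simp)
  set L : TangentSpace (cotangentModel E) m →L[ℝ] TangentSpace (cotangentModel E)
    (cotangentLift g m) := mfderiv (cotangentModel E) (cotangentModel E) (cotangentLift g) m with hL
  have hLform := canonicalForm_cotangentLift EG g m
  have hLproj := tangentProj_mfderiv_cotangentLift EG g m
  have hLd : ∀ {A : CotangentBundle E Q → ℝ}, ContMDiff (cotangentModel E) 𝓘(ℝ, ℝ) ∞ A → ∀ v,
      mvfderiv (cotangentModel E) (fun x => A (cotangentLift g x)) m v =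
        mvfderiv (cotangentModel E) A (cotangentLift g m) (L v) := fun hA v =>
    mvfderiv_comp_of_mdifferentiableAt (hA.mdifferentiable (by simp) _) (hl g m) v
  have hlift : ∀ a : G, Continuous fun s : annihilator W =>
      (⟨cotangentLift a s.1, cotangentLift_mem_annihilator EG hWinv a s.2⟩ : annihilator W) :=
    fun a => ((contMDiff_cotangentLift EG a).continuous.comp continuous_subtype_val).subtype_mk _
  -- L preserves a nondegenerate form, hence is injective; equality of dimensions makes it
  -- bijective.
  have hLinj : Function.Injective L := by
    rw [injective_iff_map_eq_zero]
    intro u hu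
    refine canonicalFlat_injective m (LinearMap.ext fun v => ?_)
    rw [map_zero, canonicalFlat_apply, ← hLform]
    have h1 : canonicalFlat (cotangentLift g m) (L u) = 0 := by rw [hu, map_zero]
    exact congrArg (fun A => A (L v)) h1
  have hLsurj : Function.Surjective L :=
    (LinearMap.injective_iff_surjective_of_finrank_eq_finrank (f := L.toLinearMap) rfl).1 hLinj
  have hLT : ∀ v, v ∈ submanifoldTangent (cotangentModel E) (annihilator W) ⟨m, hm⟩ ↔
      L v ∈ submanifoldTangent (cotangentModel E) (annihilator W) ⟨cotangentLift g m, hm'⟩ := by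
    intro v
    constructor
    · rintro hv A ⟨hA, hA0⟩
      rw [← hLd hA]
      exact hv _ ⟨hA.comp (contMDiff_cotangentLift EG g),
        ((hlift g).tendsto ⟨m, hm⟩).eventually (p := fun s : annihilator W => A s = 0) hA0⟩
    · rintro hv A ⟨hA, hA0⟩
      have hA' := hA.comp (contMDiff_cotangentLift EG g⁻¹)
      have h1 := hLd hA' v
      have hinv : ∀ x : CotangentBundle E Q,
          cotangentLift g⁻¹ (cotangentLift g x) = x := fun x => by
        rw [← cotangentLift_mul EG, inv_mul_cancel, cotangentLift_one]
      simp only [Function.comp_apply, hinv] at h1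
      refine h1.trans (hv _ ⟨hA', ?_⟩)
      refine ((hlift g⁻¹).tendsto ⟨cotangentLift g m, hm'⟩).eventually
        (p := fun s : annihilator W => A s = 0) ?_
      have h2 : (⟨cotangentLift g⁻¹ (cotangentLift g m),
        cotangentLift_mem_annihilator EG hWinv g⁻¹ hm'⟩ : annihilator W) = ⟨m, hm⟩ :=
        Subtype.ext (hinv m)
      rwa [h2]
  have hLD : ∀ v, tangentProj m v ∈ D m.proj ↔
      tangentProj (cotangentLift g m) (L v) ∈ D (g • m.proj) := by
    intro v
    rw [← hDinv g m.proj]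
    have h1 := hLproj v
    constructor
    · intro hv
      exact ⟨_, hv, h1.symm⟩
    · rintro ⟨w, hw, hwv⟩
      have h2 := hwv.trans h1
      obtain ⟨e, he⟩ := isInvertible_mfderiv_translation hG g m.proj
      have hinj : Function.Injective
          (mfderiv 𝓘(ℝ, E) 𝓘(ℝ, E) (fun x : Q => g • x) m.proj : E →L[ℝ] E) := by
        rw [← he]
        exact e.injective
      rwa [← hinj h2]
  set α := restrictDifferential (cotangentModel E) (S := annihilator W)
    (fun x => F (cotangentLift g x)) ⟨m, hm⟩ with hα
  set X := -sharp ⟨m, hm⟩ α with hX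
  obtain ⟨hXC, hXα⟩ := (h ⟨m, hm⟩ α X).2 (neg_neg _).symm
  -- L X solves the problem at g m for dF, and the defining equivalence identifies it with minus the
  -- value of `sharp` there.
  have h1 := (h ⟨cotangentLift g m, hm'⟩ (restrictDifferential (cotangentModel E) F _)
    ⟨L X, (hLT X).1 X.2⟩).1 ⟨(hLD X).1 hXC, ?_⟩
  · rw [h1]
    have h2 : sharp ⟨m, hm⟩ α = -X := (neg_neg _).symm
    refine ((congrArg _ h2).trans (map_neg _ X)).trans (Eq.trans ?_ (map_neg _ _).symm)
    exact congrArg Neg.neg (hLd hK X)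
  · rintro ⟨Y', hY'⟩ hYC
    obtain ⟨Y, rfl⟩ := hLsurj Y'
    refine (hLform X Y).trans ((hXα ⟨Y, (hLT Y).2 hY'⟩ ((hLD Y).2 hYC)).trans ?_)
    exact hLd hF Y

end Reduction

/-! ### The bivector field of a vertical complement with the vertical-symmetry condition -/

section VerticalSymmetry

variable {E : Type*} [NormedAddCommGroup E] [NormedSpace ℝ E] [FiniteDimensional ℝ E]
  {Q : Type*} [TopologicalSpace Q] [ChartedSpace E Q] [IsManifold 𝓘(ℝ, E) ∞ Q]
  {EG : Type*} [NormedAddCommGroup EG] [NormedSpace ℝ EG]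
  {G : Type*} [TopologicalSpace G] [ChartedSpace EG G] [Group G] [LieGroup 𝓘(ℝ, EG) ∞ G]
  [MulAction G Q] [ContMDiffSMul 𝓘(ℝ, EG) 𝓘(ℝ, E) ∞ G Q]
  {D W : (q : Q) → Submodule ℝ (TangentSpace 𝓘(ℝ, E) q)} {k : ℕ}
  {ξ : Fin k → GroupLieAlgebra 𝓘(ℝ, EG) G}
  {β : (q : Q) → Fin k → TangentSpace 𝓘(ℝ, E) q →L[ℝ] ℝ}

theorem canonicalSharp_mvfderiv_momentum (η : GroupLieAlgebra 𝓘(ℝ, EG) G)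
    (m : CotangentBundle E Q) :
    canonicalSharp m (mvfderiv (cotangentModel E) (momentum η) m).toLinearMap =
      cotangentGenerator EG G m η :=
  (eq_canonicalSharp fun u => canonicalForm_cotangentGenerator η m u).symm

theorem tangentProj_eq_zero_of_chartDeriv_fst_eq_zero {m : CotangentBundle E Q}
    {v : TangentSpace (cotangentModel E) m} (h : (chartDeriv (cotangentModel E) m m v).1 = 0) :
    tangentProj m v = 0 := by
  rw [chartDeriv_fst (mem_extChartAt_source m)] at h
  exact (chartDeriv_bijective (mem_extChartAt_source (I := 𝓘(ℝ, E)) m.proj)).1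
    (h.trans (map_zero _).symm)

/-- The vector corresponding to a horizontal covector is vertical. -/
theorem tangentProj_canonicalSharp_liftedForm (i : Fin k) (m : CotangentBundle E Q) :
    tangentProj m (canonicalSharp m (liftedForm β i m).toLinearMap) = 0 := by
  refine tangentProj_eq_zero_of_chartDeriv_fst_eq_zero ?_
  -- Pairing with the vertical vector (0, p) reads off p of the base component, and the lifted form
  -- vanishes on vertical vectors.
  refine SeparatingDual.eq_zero_of_forall_dual_eq_zero (R := ℝ) fun p => ?_
  obtain ⟨v, hv⟩ := (chartDeriv_bijective (mem_extChartAt_source (I := cotangentModel E) m)).2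
    ((0, p) : E × (E →L[ℝ] ℝ))
  have h1 : tangentProj m v = 0 := tangentProj_eq_zero_of_chartDeriv_fst_eq_zero (by rw [hv])
  have h2 := canonicalForm_canonicalSharp m (liftedForm β i m).toLinearMap v
  rw [canonicalForm_eq_self_chart, hv] at h2
  have h3 : (liftedForm β i m) v = 0 := (congrArg (β m.proj i) h1).trans (map_zero _)
  have h4 := h2.trans h3
  simpa using h4

namespace IsVerticalFrame

theorem mem_distribution_iff (h : IsVerticalFrame D W ξ β) {q : Q} {v : TangentSpace 𝓘(ℝ, E) q} :
    v ∈ D q ↔ ∀ i, β q i v = 0 := by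
  refine ⟨fun hv i => h.dual.apply_of_mem q i v hv, fun hv => ?_⟩
  obtain ⟨y, z, hy, hz, rfl⟩ :=
    Submodule.codisjoint_iff_exists_add_eq.1 (h.isCompl q).codisjoint v
  rw [h.span] at hz
  obtain ⟨c, rfl⟩ := (Submodule.mem_span_range_iff_exists_fun ℝ).1 hz
  have hc : ∀ i, c i = 0 := fun i => by
    have h1 := hv i
    rw [map_add, h.dual.apply_of_mem q i y hy, map_sum] at h1
    simpa [h.dual.apply_generator] using h1
  simpa [hc] using hy

/-- The geometric input of the linear algebra: `J_J` is tangency of the lifted generators to W°,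
`b_J` is duality of coframe and frame, and `b_b` holds because sharps of horizontal covectors are
vertical. -/
theorem isConjugateFrame (h : IsVerticalFrame D W ξ β) (hWinv : IsInvariantDistribution G W)
    (m : annihilator W) :
    IsConjugateFrame (canonicalFlat m.1) (canonicalSharp m.1)
      (fun i => (mvfderiv (cotangentModel E) (momentum (ξ i)) m.1).toLinearMap)
      (fun i => (liftedForm β i m.1).toLinearMap) where
  form_sharp α u := canonicalForm_canonicalSharp m.1 α u
  skew u v := canonicalForm_skew m.1 u v
  nondegenerate u hu := canonicalFlat_injective m.1 (hu.trans (map_zero _).symm)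
  J_J i j := by
    rw [canonicalSharp_mvfderiv_momentum]
    exact h.mem_submanifoldTangent_iff.1
      (cotangentGenerator_mem_submanifoldTangent hWinv m (ξ j)) i
  b_J i j := by
    rw [canonicalSharp_mvfderiv_momentum]
    exact (congrArg (β m.1.proj i) (tangentProj_cotangentGenerator m.1 (ξ j))).trans
      (h.dual.apply_generator _ _ _)
  b_b i j := (congrArg (β m.1.proj i) (tangentProj_canonicalSharp_liftedForm j m.1)).trans
    (map_zero _)

/-- The bivector field on `W°` determined by `C₀` and the canonical form. -/
def bivector (h : IsVerticalFrame D W ξ β) (hWinv : IsInvariantDistribution G W) :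
    SharpMap (cotangentModel E) (annihilator W) := fun m =>
  (h.isConjugateFrame hWinv m).coisotropicSharp fun _ => h.mem_submanifoldTangent_iff

theorem isDefinedBy_bivector (h : IsVerticalFrame D W ξ β)
    (hWinv : IsInvariantDistribution G W) :
    IsDefinedBy (cotangentModel E) (distributionC₀ W D) canonicalForm (h.bivector hWinv) := by
  intro m α X
  have hC : ∀ Y : submanifoldTangent (cotangentModel E) (annihilator W) m,
      Y ∈ distributionC₀ W D m ↔ ∀ i, liftedForm β i m.1 Y = 0 := fun Y =>
    h.mem_distribution_iff
  simp only [hC]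
  exact (h.isConjugateFrame hWinv m).coisotropicSharp_eq_iff _ α X

theorem isDefinedBy_iff (h : IsVerticalFrame D W ξ β) (hWinv : IsInvariantDistribution G W)
    (sharp : SharpMap (cotangentModel E) (annihilator W)) :
    IsDefinedBy (cotangentModel E) (distributionC₀ W D) canonicalForm sharp ↔
      sharp = h.bivector hWinv := by
  constructor
  · intro hs
    funext m
    refine LinearMap.ext fun α => ?_
    have h1 := (hs m α _).1 ((h.isDefinedBy_bivector hWinv m α (-h.bivector hWinv m α)).2
      (neg_neg _).symm)
    rw [h1, neg_neg]
  · rintro rfl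
    exact h.isDefinedBy_bivector hWinv

/-- With global extensions through the retraction, `apply_coisotropicSharp_restrict` expresses π₀ by
sums and products of pairings of smooth 1-forms on T^*Q; this expression is the required extension.
-/
theorem isBivectorField_bivector (h : IsVerticalFrame D W ξ β)
    (hWinv : IsInvariantDistribution G W) :
    IsBivectorField (cotangentModel E) (h.bivector hWinv) := by
  refine ⟨fun m α γ => (h.isConjugateFrame hWinv m).coisotropicSharp_skew _ α γ,
    fun f hf g hg m => ?_⟩
  have hF := h.contMDiff_comp_retract hf
  have hK := h.contMDiff_comp_retract hg
  set F := fun x => f (h.retract x) with hFdef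
  set K := fun x => g (h.retract x) with hKdef
  have sF := isSmoothForm_mvfderiv hF
  have sK := isSmoothForm_mvfderiv hK
  have sJ : ∀ i, IsSmoothForm (cotangentModel E)
      (mvfderiv (cotangentModel E) (momentum (ξ i) : CotangentBundle E Q → ℝ)) := fun i =>
    isSmoothForm_mvfderiv (contMDiff_momentum (ξ i))
  have sb : ∀ i, IsSmoothForm (cotangentModel E) (liftedForm β i) :=
    isSmoothForm_liftedForm h.smooth
  refine ⟨fun x => -(formPairing (mvfderiv (cotangentModel E) F) (mvfderiv (cotangentModel E) K) x +
    ∑ i, formPairing (mvfderiv (cotangentModel E) F)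
        (mvfderiv (cotangentModel E) (momentum (ξ i))) x *
      formPairing (liftedForm β i) (mvfderiv (cotangentModel E) K) x -
    ∑ i, formPairing (mvfderiv (cotangentModel E) F) (liftedForm β i) x *
      formPairing (mvfderiv (cotangentModel E) (momentum (ξ i)))
        (mvfderiv (cotangentModel E) K) x), ?_, ?_⟩
  · refine ContMDiff.neg (ContMDiff.sub (ContMDiff.add (contMDiff_formPairing sF sK)
      (ContMDiff.sum fun i _ => ?_)) (ContMDiff.sum fun i _ => ?_))
    · exact (contMDiff_formPairing sF (sJ i)).mul (contMDiff_formPairing (sb i) sK)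
    · exact (contMDiff_formPairing sF (sb i)).mul (contMDiff_formPairing (sJ i) sK)
  · refine Filter.Eventually.of_forall fun s => ?_
    beta_reduce
    rw [submanifoldDifferential_eq _ f s F (h.isExtensionNear_comp_retract hf s),
      submanifoldDifferential_eq _ g s K (h.isExtensionNear_comp_retract hg s)]
    exact ((h.isConjugateFrame hWinv s).apply_coisotropicSharp_restrict
      (fun _ => h.mem_submanifoldTangent_iff)
      (mvfderiv (cotangentModel E) F s.1).toLinearMap
      (mvfderiv (cotangentModel E) K s.1).toLinearMap).symm

end IsVerticalFrame

/-- An extension F of f ∘ ρ need not be invariant on T^*Q. Still, the orbit of m lies in W°, where F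
agrees near m with the invariant function f ∘ ρ, so dF at m is basic. -/
theorem mvfderiv_cotangentGenerator_of_isExtensionNear (hWinv : IsInvariantDistribution G W)
    {f : reducedFunctions EG G W} {m : annihilator W} {F : CotangentBundle E Q → ℝ}
    (hF : IsExtensionNear (cotangentModel E) (pullback f) m F) (η : GroupLieAlgebra 𝓘(ℝ, EG) G) :
    mvfderiv (cotangentModel E) F m.1
      (canonicalSharp m.1 (mvfderiv (cotangentModel E) (momentum η) m.1).toLinearMap) = 0 := by
  rw [canonicalSharp_mvfderiv_momentum]
  refine mvfderiv_cotangentGenerator_eq_zero (c := pullback f m)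
    (hF.1.mdifferentiable (by simp)) ?_ η
  have hc : Continuous fun g : G =>
      (⟨cotangentLift g m.1, cotangentLift_mem_annihilator EG hWinv g m.2⟩ : annihilator W) :=
    (contMDiff_orbitMap_cotangent (EG := EG) m.1).continuous.subtype_mk _
  have h1 : (⟨cotangentLift (1 : G) m.1, cotangentLift_mem_annihilator EG hWinv 1 m.2⟩ :
      annihilator W) = m := Subtype.ext (cotangentLift_one m.1)
  have h2 : ∀ᶠ s : annihilator W in
      𝓝 ⟨cotangentLift (1 : G) m.1, cotangentLift_mem_annihilator EG hWinv 1 m.2⟩,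
      F s = pullback f s := by
    rw [h1]
    exact hF.2
  filter_upwards [(hc.tendsto 1).eventually h2] with g hg
  refine hg.trans ?_
  exact congrArg (f : ReducedSpace EG G W → ℝ) (orbitProj_eq_of_cotangentLift (g := g) rfl)

namespace IsVerticalFrame

/-- The reduced bracket is computed by the canonical bracket of any extensions. -/
theorem upstairsBracket_eq_cotangentBracket (h : IsVerticalFrame D W ξ β)
    (hWinv : IsInvariantDistribution G W) {f g : reducedFunctions EG G W} {m : annihilator W}
    {F K : CotangentBundle E Q → ℝ}
    (hF : IsExtensionNear (cotangentModel E) (pullback f) m F)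
    (hK : IsExtensionNear (cotangentModel E) (pullback g) m K) :
    upstairsBracket (h.bivector hWinv) f g m = cotangentBracket F K m.1 := by
  rw [upstairsBracket, submanifoldDifferential_eq _ _ m F hF,
    submanifoldDifferential_eq _ _ m K hK]
  exact (h.isConjugateFrame hWinv m).apply_coisotropicSharp_restrict_of_basic
    (fun _ => h.mem_submanifoldTangent_iff)
    (A := (mvfderiv (cotangentModel E) F m.1).toLinearMap)
    (B := (mvfderiv (cotangentModel E) K m.1).toLinearMap)
    (fun i => mvfderiv_cotangentGenerator_of_isExtensionNear hWinv hF (ξ i))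
    (fun i => mvfderiv_cotangentGenerator_of_isExtensionNear hWinv hK (ξ i))

/-- The canonical bracket of two extensions is itself an extension of the reduced bracket. Since any
extension may be used, iterated brackets are computed on T^*Q, where the Jacobi identity holds. -/
theorem isPoisson_of_isReduction (h : IsVerticalFrame D W ξ β)
    (hWinv : IsInvariantDistribution G W) {L : AlmostPoissonBracket (reducedFunctions EG G W)}
    (hL : IsReduction (h.bivector hWinv) L) : L.IsPoisson := by
  have hE : ∀ (f : reducedFunctions EG G W) m, IsExtensionNear (cotangentModel E) (pullback f) m
      (fun x => pullback f (h.retract x)) := fun f => h.isExtensionNear_comp_retract f.2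
  have hB : ∀ (f g : reducedFunctions EG G W) m,
      IsExtensionNear (cotangentModel E) (pullback (L.bracket f g)) m
        (cotangentBracket (fun x => pullback f (h.retract x))
          fun x => pullback g (h.retract x)) := fun f g m =>
    ⟨contMDiff_cotangentBracket (hE f m).1 (hE g m).1, Filter.Eventually.of_forall fun s =>
      ((hL f g s).trans
        (h.upstairsBracket_eq_cotangentBracket hWinv (hE f s) (hE g s))).symm⟩
  have hBB : ∀ (f g l : reducedFunctions EG G W) (m : annihilator W),
      pullback (L.bracket f (L.bracket g l)) m =
        cotangentBracket (fun x => pullback f (h.retract x))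
          (cotangentBracket (fun x => pullback g (h.retract x))
            fun x => pullback l (h.retract x)) m.1 := fun f g l m =>
    (hL _ _ m).trans (h.upstairsBracket_eq_cotangentBracket hWinv (hE f m) (hB g l m))
  intro f g l
  refine reducedFunctions_ext fun m => ?_
  change pullback (L.bracket f (L.bracket g l)) m + pullback (L.bracket g (L.bracket l f)) m +
    pullback (L.bracket l (L.bracket f g)) m = 0
  rw [hBB, hBB, hBB]
  exact cotangentBracket_jacobi (hE f m).1 (hE g m).1 (hE l m).1 m.1

theorem eq_cotangentGenerator_of_mem_kernelForm (h : IsVerticalFrame D W ξ β)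
    (hWinv : IsInvariantDistribution G W) {m : annihilator W}
    {v : TangentSpace (cotangentModel E) m.1} (hv : v ∈ kernelForm W m) :
    v = cotangentGenerator EG G m.1 (∑ i, liftedForm β i m.1 v • ξ i) := by
  have h1 := (h.isConjugateFrame hWinv m).eq_sum_of_form_eq_zero (v := v)
    (h.mem_submanifoldTangent_iff.1 hv.1)
    fun u hu => hv.2 u (h.mem_submanifoldTangent_iff.2 hu)
  simp only [canonicalSharp_mvfderiv_momentum] at h1
  rw [map_sum]
  simp only [map_smul]
  exact h1

/-- Kernel vectors are combinations of the generators of the ξ_i by linear algebra. Conversely, Ω_Q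
pairs the generator of ξ_i with u as dJ_i(u), which vanishes on T(W°). -/
theorem kernelForm_eq (h : IsVerticalFrame D W ξ β) (hWinv : IsInvariantDistribution G W)
    (hinj : ∀ q : Q, Function.Injective (infinitesimalGenerator (E := E) EG G q))
    (m : annihilator W) : kernelForm W m = distributionW₀ W EG G m := by
  have hgen : ∀ c : Fin k → ℝ, infinitesimalGenerator (E := E) EG G m.1.proj (∑ i, c i • ξ i) =
      ∑ i, c i • infinitesimalGenerator EG G m.1.proj (ξ i) := fun c => by
    simp only [map_sum, map_smul]
  refine Set.Subset.antisymm (fun v hv => ?_) ?_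
  · have h1 := h.eq_cotangentGenerator_of_mem_kernelForm hWinv hv
    refine ⟨⟨_, h1.symm⟩, ?_⟩
    have h2 : tangentProj m.1 v ∈ W m.1.proj := by
      rw [h1, tangentProj_cotangentGenerator, hgen, h.span]
      exact (Submodule.mem_span_range_iff_exists_fun ℝ).2 ⟨_, rfl⟩
    exact h2
  · rintro _ ⟨⟨η, rfl⟩, hη⟩
    have h2 : infinitesimalGenerator EG G m.1.proj η ∈ W m.1.proj := by
      rw [← tangentProj_cotangentGenerator]
      exact hη
    rw [h.span] at h2
    obtain ⟨c, hc⟩ := (Submodule.mem_span_range_iff_exists_fun ℝ).1 h2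
    -- A vertical vector over W could a priori come from some η outside 𝔤_W; injectivity of the
    -- generator map excludes this.
    have h3 : η = ∑ i, c i • ξ i := hinj _ (by rw [hgen, hc])
    refine ⟨cotangentGenerator_mem_submanifoldTangent hWinv m η, fun u hu => ?_⟩
    have h4 := h.mem_submanifoldTangent_iff.1 hu
    have h5 : canonicalFlat m.1 (cotangentGenerator EG G m.1 η) u = 0 := by
      rw [h3]
      simp [LinearMap.sum_apply, canonicalForm_cotangentGenerator, h4]
    exact h5

/-- d(f ∘ ρ) is basic, so the vector that π₀ assigns to it solves the Hamiltonian equation on the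
whole tangent space of W°. -/
theorem isHamiltonianField_bivector (h : IsVerticalFrame D W ξ β)
    (hWinv : IsInvariantDistribution G W) (f : reducedFunctions EG G W) :
    IsHamiltonianField (pullback f) fun m =>
      -h.bivector hWinv m (submanifoldDifferential (cotangentModel E) (pullback f) m) := by
  constructor
  · intro g hg
    have h1 := (smoothFunctions (cotangentModel E) (annihilator W)).neg_mem
      ((h.isBivectorField_bivector hWinv).2 _ f.2 _ hg)
    refine (congrArg (· ∈ smoothFunctions (cotangentModel E) (annihilator W)) ?_).mp h1
    funext m
    exact (map_neg _ _).symm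
  · intro m u
    have hF : IsExtensionNear (cotangentModel E) (pullback f) m
      (fun x => pullback f (h.retract x)) := h.isExtensionNear_comp_retract f.2 m
    beta_reduce
    rw [submanifoldDifferential_eq _ (pullback f) m _ hF]
    exact (h.isConjugateFrame hWinv m).form_neg_coisotropicSharp_of_basic
      (fun _ => h.mem_submanifoldTangent_iff)
      (A := (mvfderiv (cotangentModel E) (fun x => pullback f (h.retract x)) m.1).toLinearMap)
      (fun i => mvfderiv_cotangentGenerator_of_isExtensionNear hWinv hF (ξ i)) u

/-- X - Y takes values in the kernel of Ω_{W°}, hence is tangent to the orbits, where g ∘ ρ is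
constant. -/
theorem submanifoldDifferential_eq_of_isHamiltonianField (h : IsVerticalFrame D W ξ β)
    (hWinv : IsInvariantDistribution G W) {f : annihilator W → ℝ}
    {X Y : SubmanifoldField (cotangentModel E) (annihilator W)} (hX : IsHamiltonianField f X)
    (hY : IsHamiltonianField f Y) (g : reducedFunctions EG G W) (m : annihilator W) :
    submanifoldDifferential (cotangentModel E) (pullback g) m (X m) =
      submanifoldDifferential (cotangentModel E) (pullback g) m (Y m) := by
  have hker : ((X m - Y m : submanifoldTangent (cotangentModel E) (annihilator W) m) :
      TangentSpace (cotangentModel E) m.1) ∈ kernelForm W m := by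
    refine ⟨(X m - Y m).2, fun u hu => ?_⟩
    have h1 := hX.2 m ⟨u, hu⟩
    have h2 := hY.2 m ⟨u, hu⟩
    have h3 : canonicalFlat m.1 ((X m : TangentSpace (cotangentModel E) m.1) - Y m) u =
        canonicalFlat m.1 (X m : TangentSpace (cotangentModel E) m.1) u -
          canonicalFlat m.1 (Y m : TangentSpace (cotangentModel E) m.1) u := by
      rw [map_sub]
      rfl
    exact h3.trans (sub_eq_zero.2 (h1.trans h2.symm))
  have hK := h.isExtensionNear_comp_retract g.2 m
  rw [submanifoldDifferential_eq _ (pullback g) m _ hK, ← sub_eq_zero, ← map_sub]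
  have h1 := h.eq_cotangentGenerator_of_mem_kernelForm hWinv hker
  rw [← canonicalSharp_mvfderiv_momentum] at h1
  have h2 := mvfderiv_cotangentGenerator_of_isExtensionNear hWinv hK
    (∑ i, liftedForm β i m.1 ((X m - Y m : submanifoldTangent (cotangentModel E)
      (annihilator W) m) : TangentSpace (cotangentModel E) m.1) • ξ i)
  rw [← h1] at h2
  exact h2

theorem isPresymplecticReduction_iff (h : IsVerticalFrame D W ξ β)
    (hWinv : IsInvariantDistribution G W) {Λ : AlmostPoissonBracket (reducedFunctions EG G W)}
    (hΛ : IsReduction (h.bivector hWinv) Λ) (L : AlmostPoissonBracket (reducedFunctions EG G W)) :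
    IsPresymplecticReduction L ↔ L = Λ := by
  have hX₀ := h.isHamiltonianField_bivector hWinv
  have hval : ∀ (f g : reducedFunctions EG G W) m, pullback (Λ.bracket f g) m =
      -submanifoldDifferential (cotangentModel E) (pullback g) m (-h.bivector hWinv m
        (submanifoldDifferential (cotangentModel E) (pullback f) m)) := fun f g m => by
    rw [hΛ f g m, map_neg, neg_neg]
  constructor
  · intro hL
    refine almostPoissonBracket_ext fun f g m => ?_
    rw [hval, (hL f).2 _ (hX₀ f) g m]
  · rintro rfl f
    refine ⟨⟨_, hX₀ f⟩, fun X hX g m => ?_⟩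
    rw [hval, h.submanifoldDifferential_eq_of_isHamiltonianField hWinv hX (hX₀ f)]

end IsVerticalFrame

/-- The vertical-symmetry condition for a free action yields a global frame of `W`. -/
theorem exists_isVerticalFrame [FiniteDimensional ℝ EG]
    (hfree : ∀ (g : G) (q : Q), g • q = q → g = 1)
    (hD : IsSmoothDistribution D) (hcompl : ∀ q, IsCompl (D q) (W q))
    (gW : Submodule ℝ (GroupLieAlgebra 𝓘(ℝ, EG) G))
    (hW : ∀ q, W q = gW.map (infinitesimalGenerator EG G q)) :
    ∃ (k : ℕ) (ξ : Fin k → GroupLieAlgebra 𝓘(ℝ, EG) G)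
      (β : (q : Q) → Fin k → TangentSpace 𝓘(ℝ, E) q →L[ℝ] ℝ), IsVerticalFrame D W ξ β := by
  have : FiniteDimensional ℝ (GroupLieAlgebra 𝓘(ℝ, EG) G) :=
    inferInstanceAs (FiniteDimensional ℝ EG)
  -- One basis of 𝔤_W serves all q: by freeness its generators stay independent at every point.
  set b := Module.finBasis ℝ gW with hb
  have hli : ∀ q : Q, LinearIndependent ℝ
      fun i => infinitesimalGenerator (E := E) EG G q (b i : GroupLieAlgebra 𝓘(ℝ, EG) G) := fun q =>
    (b.linearIndependent.map' gW.subtype gW.ker_subtype).map' _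
      (LinearMap.ker_eq_bot.2 (infinitesimalGenerator_injective hfree q))
  have hspan : ∀ q : Q, W q = Submodule.span ℝ (Set.range fun i =>
      infinitesimalGenerator (E := E) EG G q (b i : GroupLieAlgebra 𝓘(ℝ, EG) G)) := fun q => by
    have h1 : gW = Submodule.span ℝ (Set.range fun i =>
        (b i : GroupLieAlgebra 𝓘(ℝ, EG) G)) := by
      have h2 := congrArg (Submodule.map gW.subtype) b.span_eq
      rw [Submodule.map_span, Submodule.map_top, Submodule.range_subtype, ← Set.range_comp] at h2
      exact h2.symm
    rw [hW q]
    conv_lhs => rw [h1]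
    rw [Submodule.map_span, ← Set.range_comp]
    rfl
  obtain ⟨β, hβ⟩ := exists_isDualCoframe hcompl hli hspan
  exact ⟨_, _, β, hβ, hβ.isSmooth hD hcompl hspan, hspan, hcompl⟩

end VerticalSymmetry

end

/-! ### The theorem -/

theorem mainTheorem7
    -- the configuration manifold `Q`
    {E : Type*} [NormedAddCommGroup E] [NormedSpace ℝ E] [FiniteDimensional ℝ E]
    {Q : Type*} [TopologicalSpace Q] [ChartedSpace E Q] [IsManifold 𝓘(ℝ, E) ∞ Q]
    [T2Space Q] [SecondCountableTopology Q]
    -- the Lie group `G`, acting smoothly, properly and freely on `Q`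
    {EG : Type*} [NormedAddCommGroup EG] [NormedSpace ℝ EG] [FiniteDimensional ℝ EG]
    {G : Type*} [TopologicalSpace G] [ChartedSpace EG G] [Group G] [LieGroup 𝓘(ℝ, EG) ∞ G]
    [MulAction G Q] [ContMDiffSMul 𝓘(ℝ, EG) 𝓘(ℝ, E) ∞ G Q] [ProperSMul G Q]
    (hfree : ∀ (g : G) (q : Q), g • q = q → g = 1)
    -- the invariant constraint distribution `D` and an invariant vertical complement `W`
    (D W : (q : Q) → Submodule ℝ (TangentSpace 𝓘(ℝ, E) q))
    (hD : IsSmoothDistribution D) (hDinv : IsInvariantDistribution G D)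
    (hW : IsSmoothDistribution W) (hWinv : IsInvariantDistribution G W)
    (hcompl : ∀ q, IsCompl (D q) (W q)) (hvert : ∀ q, W q ≤ verticalSpace EG G q)
    -- the vertical-symmetry condition
    (hsymm : ∃ gW : LieSubalgebra ℝ (GroupLieAlgebra 𝓘(ℝ, EG) G),
      ∀ q, W q = gW.toSubmodule.map (infinitesimalGenerator EG G q)) :
    -- `C₀` and `Ω_Q` define a unique bivector `π₀` on `W°`, and it is smooth and `G`-invariant
    ∃ π₀ : SharpMap (cotangentModel E) (annihilator W),
      (∀ sharp : SharpMap (cotangentModel E) (annihilator W),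
        IsDefinedBy (cotangentModel E) (distributionC₀ W D) canonicalForm sharp ↔ sharp = π₀) ∧
      IsBivectorField (cotangentModel E) π₀ ∧
      IsInvariantBivector G π₀ ∧
      -- the reduction of `π₀` to `W°/G` is a Poisson structure `Λ₀`
      ∃ Λ₀ : AlmostPoissonBracket (reducedFunctions EG G W),
        (∀ L, IsReduction π₀ L ↔ L = Λ₀) ∧
        Λ₀.IsPoisson ∧
        -- `Ker Ω_{W°} = W₀`, and the reduction of `Ω_{W°}` to `W°/G` is `Λ₀`
        (∀ m : annihilator W, kernelForm W m = distributionW₀ W EG G m) ∧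
        (∀ L : AlmostPoissonBracket (reducedFunctions EG G W),
          IsPresymplecticReduction L ↔ L = Λ₀) := by
  obtain ⟨gW, hgW⟩ := hsymm
  obtain ⟨k, ξ, β, h⟩ := exists_isVerticalFrame hfree hD hcompl gW.toSubmodule hgW
  have hbiv := h.isBivectorField_bivector hWinv
  have hinv : IsInvariantBivector G (h.bivector hWinv) :=
    isInvariantBivector_of_isDefinedBy EG hDinv hWinv (h.isDefinedBy_bivector hWinv)
  obtain ⟨Λ, hΛ⟩ := exists_isReduction (EG := EG) hWinv hinv hbiv
  refine ⟨h.bivector hWinv, h.isDefinedBy_iff hWinv, hbiv, hinv, Λ, fun L => ⟨fun hL => ?_, ?_⟩,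
    h.isPoisson_of_isReduction hWinv hΛ,
    h.kernelForm_eq hWinv (infinitesimalGenerator_injective hfree),
    h.isPresymplecticReduction_iff hWinv hΛ⟩
  · exact almostPoissonBracket_ext fun f g m => (hL f g m).trans (hΛ f g m).symm
  · rintro rfl
    exact hΛ
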